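/- **Conventions.** $\mathbb T=\mathbb R/2\pi\mathbb Z$. Greek indices $\alpha$ run over $1,2,3$, the Latin index $j$ over $1,2$, and repeated indices are summed. $y=(y_1,y_2,y_3)$, $y'=(y_1,y_2)$. States are $U=(u,H,q)\in\mathbb R^3\times\mathbb R^3\times\mathbb R$; components $1,2,3$ are velocity, $4,5,6$ magnetic, $7$ pressure. $I^+=[0,1]$, $I^-=[-1,0]$, $\Gamma_0=\{y_3=0\}$. ${\bf c}_0f=\widehat f(0)=\frac1{2\pi}\int_0^{2\pi}f\,{\rm d}\theta$ is the mean in $\theta$. **Data.** Let $T>0$, $\tau\in\mathbb R$, $\xi\in\mathbb R^2$, constants $u_j^{0,\pm},H_j^{0,\pm}$ ($j=1,2$), $u_3^{0,\pm}=H_3^{0,\pm}=0$, $U^{0,\pm}=(u^{0,\pm},H^{0,\pm},0)$, $c^\pm=\tau+\xi_ju_j^{0,\pm}$, $b^\pm=\xi_jH_j^{0,\pm}$. Let $\chi\in C^\infty(\mathbb R)$ equal $1$ on $[-\frac13,\frac13]$ and vanish outside $[-\frac23,\frac23]$. Let $A_0={\rm diag}(1,1,1,1,1,1,0)$ and let $$f_\alpha(U)=\big(u_\alpha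 u-H_\alpha H+q\,e_\alpha,\ u_\alpha H-H_\alpha u,\ u_\alpha\big)$$ be the fluxes of incompressible MHD; $A_\alpha^\pm={\rm d}f_\alpha(U^{0,\pm})$, $\mathbb A_\alpha={\rm d}^2f_\alpha$ (a constant symmetric bilinear map), $\mathcal A^\pm=\tau A_0+\xi_jA_j^\pm$, $L_s^\pm=A_0\partial_t+A_\alpha^\pm\partial_{y_\alpha}$, $\mathcal L_f^\pm=A_3^\pm\partial_{Y_3}+\mathcal A^\pm\partial_\theta$. **Spaces.** $\underline S^\pm$: functions of $(t,y,\theta)\in[0,T]\times\mathbb T^2\times I^\pm\times\mathbb T$ that are smooth up to the boundary ($H^\infty$). $S_\star^\pm$: functions of $(t,y,Y_3,\theta)$, $\pm Y_3\ge0$, smooth up to the boundary, for which there is $\delta>0$ such that every partial derivative is $O(e^{-\delta|Y_3|})$ uniformly in the other variables. Front profiles lie in $H^\infty([0,T]\times\mathbb T^2\times\mathbb T)$, with variables $(t,y',\theta)$. **The functions $\chi^{[\ell]},\dot\chi^{[\ell]}$.** For front profiles $\psi^0=\psi^1=0,\psi^2,\psi^3,\dots$, let $x_3=y_3+O(\varepsilon^2)$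 be the formal power series in $\varepsilon$ solving $y_3=x_3-\chi(x_3)\sum_{m\ge2}\varepsilon^m\psi^m(t,y',\theta)$. Then $\chi(x_3)=\sum_\ell\varepsilon^\ell\chi^{[\ell]}(t,y,\theta)$ and $\chi'(x_3)=\sum_\ell\varepsilon^\ell\dot\chi^{[\ell]}(t,y,\theta)$, by Taylor expansion at $y_3$. **Cascade sources.** For profiles $U^{\ell,\pm}$ ($U^{0,\pm}$ being the above constant), with all summation indices $\ge0$ unless stated otherwise, put (superscript $\pm$ omitted) $$\begin{aligned}F^m={}&-L_sU^m+\sum_{\ell_1+\ell_2=m+2}\partial_\theta\psi^{\ell_1}\mathcal A\,\partial_{Y_3}U^{\ell_2}+\sum_{\ell_1+\ell_2=m+1}(\partial_t\psi^{\ell_1}A_0+\partial_{y_j}\psi^{\ell_1}A_j)\partial_{Y_3}U^{\ell_2}\\&+\sum_{\ell_1+\ell_2+\ell_3=m+1}\chi^{[\ell_1]}\partial_\theta\psi^{\ell_2}\mathcal A\,\partial_{y_3}U^{\ell_3}+\sum_{\ell_1+\ell_2+\ell_3=m}\chi^{[\ell_1]}(\partial_t\psi^{\ell_2}A_0+\partial_{y_j}\psi^{\ell_2}A_j)\partial_{y_3}U^{\ell_3}+\sum_{\ell_1+\ell_2+\ell_3=m}\dot\chi^{[\ell_1]}\psi^{\ell_2}A_3\partial_{y_3}U^{\ell_3}\\&-\sum_{\substack{\ell_1+\ell_2=m\\\ell_1,\ell_2\ge1}}\mathbb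 A_\alpha(U^{\ell_1},\partial_{y_\alpha}U^{\ell_2})-\sum_{\substack{\ell_1+\ell_2=m+1\\\ell_1,\ell_2\ge1}}\big[\xi_j\mathbb A_j(U^{\ell_1},\partial_\theta U^{\ell_2})+\mathbb A_3(U^{\ell_1},\partial_{Y_3}U^{\ell_2})\big]\\&+\sum_{\substack{\ell_1+\ell_2+\ell_3=m+2\\\ell_2,\ell_3\ge1}}\partial_\theta\psi^{\ell_1}\xi_j\mathbb A_j(U^{\ell_2},\partial_{Y_3}U^{\ell_3})+\sum_{\substack{\ell_1+\ell_2+\ell_3=m+1\\\ell_2,\ell_3\ge1}}\partial_{y_j}\psi^{\ell_1}\mathbb A_j(U^{\ell_2},\partial_{Y_3}U^{\ell_3})\\&+\sum_{\substack{\ell_1+\dots+\ell_4=m+1\\\ell_3,\ell_4\ge1}}\chi^{[\ell_1]}\partial_\theta\psi^{\ell_2}\xi_j\mathbb A_j(U^{\ell_3},\partial_{y_3}U^{\ell_4})+\sum_{\substack{\ell_1+\dots+\ell_4=m\\\ell_3,\ell_4\ge1}}\big[\chi^{[\ell_1]}\partial_{y_j}\psi^{\ell_2}\mathbb A_j+\dot\chi^{[\ell_1]}\psi^{\ell_2}\mathbb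 A_3\big](U^{\ell_3},\partial_{y_3}U^{\ell_4}),\end{aligned}$$ $$\begin{aligned}F_8^m={}&-\partial_{y_\alpha}H_\alpha^m+\sum_{\ell_1+\ell_2=m+2}\partial_\theta\psi^{\ell_1}\xi_j\partial_{Y_3}H_j^{\ell_2}+\sum_{\ell_1+\ell_2=m+1}\partial_{y_j}\psi^{\ell_1}\partial_{Y_3}H_j^{\ell_2}\\&+\sum_{\ell_1+\ell_2+\ell_3=m+1}\chi^{[\ell_1]}\partial_\theta\psi^{\ell_2}\xi_j\partial_{y_3}H_j^{\ell_3}+\sum_{\ell_1+\ell_2+\ell_3=m}\big[\chi^{[\ell_1]}\partial_{y_j}\psi^{\ell_2}\partial_{y_3}H_j^{\ell_3}+\dot\chi^{[\ell_1]}\psi^{\ell_2}\partial_{y_3}H_3^{\ell_3}\big],\end{aligned}$$ $$\begin{aligned}G_1^m&=\partial_t\psi^{m+1}+u_j^0\partial_{y_j}\psi^{m+1}+\sum_{\substack{\ell_1+\ell_2=m+2\\\ell_2\ge1}}\partial_\theta\psi^{\ell_1}\xi_ju_j^{\ell_2}|_{y_3=Y_3=0}+\sum_{\substack{\ell_1+\ell_2=m+1\\\ell_2\ge1}}\partial_{y_j}\psi^{\ell_1}u_j^{\ell_2}|_{y_3=Y_3=0},\\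 G_2^m&=H_j^0\partial_{y_j}\psi^{m+1}+\sum_{\substack{\ell_1+\ell_2=m+2\\\ell_2\ge1}}\partial_\theta\psi^{\ell_1}\xi_jH_j^{\ell_2}|_{y_3=Y_3=0}+\sum_{\substack{\ell_1+\ell_2=m+1\\\ell_2\ge1}}\partial_{y_j}\psi^{\ell_1}H_j^{\ell_2}|_{y_3=Y_3=0}.\end{aligned}$$ If $U^\ell=\underline U^\ell+U_\star^\ell$ with $\underline U^\ell\in\underline S^\pm$, $U_\star^\ell\in S_\star^\pm$, then $\underline F^m,\underline F_8^m$ are given by the same formulas with every $U^\ell$ replaced by $\underline U^\ell$ (they are the limits as $Y_3\to\pm\infty$), and $F_\star^m=F^m-\underline F^m$, $F_{8,\star}^m=F_8^m-\underline F_8^m$. **Hypotheses.** Let $m\ge1$, and let $U^{\mu,\pm}=\underline U^{\mu,\pm}+U_\star^{\mu,\pm}\in\underline S^\pm\oplus S_\star^\pm$ ($1\le\mu\le m$), $\psi^2,\dots,\psi^m\in H^\infty([0,T]\times\mathbb T^2\times\mathbb T)$, and $\psi^{m+1}_\sharp\in H^\infty([0,T]\times\mathbb T^2\times\mathbb T)$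 with ${\bf c}_0\psi_\sharp^{m+1}=0$, be such that, where $\psi^{m+1}$ is taken to be $\psi_\sharp^{m+1}$: 1. for $\mu=1,\dots,m$ and on both sides, $\mathcal L_f^\pm U^{\mu,\pm}=F^{\mu-1,\pm}$ and $\partial_{Y_3}H_3^{\mu,\pm}+\xi_j\partial_\theta H_j^{\mu,\pm}=F_8^{\mu-1,\pm}$, and at $y_3=Y_3=0$: $u_3^{\mu,\pm}-c^\pm\partial_\theta\psi^{\mu+1}=G_1^{\mu-1,\pm}$, $H_3^{\mu,\pm}-b^\pm\partial_\theta\psi^{\mu+1}=G_2^{\mu-1,\pm}$, $q^{\mu,+}-q^{\mu,-}=0$; 2. ${\bf c}_0\underline F^{m,\pm}=0$ and ${\bf c}_0\underline F_8^{m,\pm}=0$; 3. for $j=1,2$, $u_j^{0,\pm}\widehat F_{7,\star}^{m,\pm}(0)-H_j^{0,\pm}\widehat F_{8,\star}^{m,\pm}(0)=\widehat F_{j,\star}^{m,\pm}(0)$ and $H_j^{0,\pm}\widehat F_{7,\star}^{m,\pm}(0)-u_j^{0,\pm}\widehat F_{8,\star}^{m,\pm}(0)=\widehat F_{3+j,\star}^{m,\pm}(0)$.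 Let $\widehat u_{3,\star}^{m+1,\pm}(0)$ and $\widehat H_{3,\star}^{m+1,\pm}(0)$ be the solutions in $S_\star^\pm$, independent of $\theta$, of $$\partial_{Y_3}\widehat u_{3,\star}^{m+1,\pm}(0)=\widehat F_{7,\star}^{m,\pm}(0),\qquad\partial_{Y_3}\widehat H_{3,\star}^{m+1,\pm}(0)=\widehat F_{8,\star}^{m,\pm}(0).$$ **Sources of the slow mean problem.** Given a slow mean $\widehat\psi^{m+1}(0)\in H^\infty([0,T]\times\mathbb T^2)$, set $\psi^{m+1}=\psi^{m+1}_\sharp+\widehat\psi^{m+1}(0)$ and, on each side, $$\begin{aligned}\mathbb F^m={\bf c}_0\Big\{&\sum_{\ell_1+\ell_2+\ell_3=m+2}\chi^{[\ell_1]}\partial_\theta\psi^{\ell_2}\mathcal A\,\partial_{y_3}\underline U^{\ell_3}+\sum_{\ell_1+\ell_2+\ell_3=m+1}\chi^{[\ell_1]}(\partial_t\psi^{\ell_2}A_0+\partial_{y_j}\psi^{\ell_2}A_j)\partial_{y_3}\underline U^{\ell_3}\\&+\sum_{\ell_1+\ell_2+\ell_3=m+1}\dot\chi^{[\ell_1]}\psi^{\ell_2}A_3\partial_{y_3}\underline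 U^{\ell_3}-\sum_{\substack{\ell_1+\ell_2=m+1\\\ell_1,\ell_2\ge1}}\mathbb A_\alpha(\underline U^{\ell_1},\partial_{y_\alpha}\underline U^{\ell_2})\\&+\sum_{\substack{\ell_1+\dots+\ell_4=m+2\\\ell_3,\ell_4\ge1}}\chi^{[\ell_1]}\partial_\theta\psi^{\ell_2}\xi_j\mathbb A_j(\underline U^{\ell_3},\partial_{y_3}\underline U^{\ell_4})\\&+\sum_{\substack{\ell_1+\dots+\ell_4=m+1\\\ell_3,\ell_4\ge1}}\big[\chi^{[\ell_1]}\partial_{y_j}\psi^{\ell_2}\mathbb A_j+\dot\chi^{[\ell_1]}\psi^{\ell_2}\mathbb A_3\big](\underline U^{\ell_3},\partial_{y_3}\underline U^{\ell_4})\Big\},\end{aligned}$$ $$\mathbb F_8^m={\bf c}_0\Big\{\sum_{\ell_1+\ell_2+\ell_3=m+2}\chi^{[\ell_1]}\partial_\theta\psi^{\ell_2}\xi_j\partial_{y_3}\underline H_j^{\ell_3}+\sum_{\ell_1+\ell_2+\ell_3=m+1}\big[\chi^{[\ell_1]}\partial_{y_j}\psi^{\ell_2}\partial_{y_3}\underline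 H_j^{\ell_3}+\dot\chi^{[\ell_1]}\psi^{\ell_2}\partial_{y_3}\underline H_3^{\ell_3}\big]\Big\},$$ $$\mathbb G_1^m=\widehat G_1^m(0)-\widehat u_{3,\star}^{m+1}(0)|_{y_3=Y_3=0},\qquad\mathbb G_2^m=\widehat G_2^m(0)-\widehat H_{3,\star}^{m+1}(0)|_{y_3=Y_3=0}.$$ (Terms containing $\psi^0$, $\psi^1$ or a derivative of $U^0$ vanish, so only $U^1,\dots,U^m$ and $\psi^2,\dots,\psi^{m+1}$ enter all these sources.) **Conclusion.** On both sides, and for every choice of the slow mean $\widehat\psi^{m+1}(0)\in H^\infty([0,T]\times\mathbb T^2)$: $$\partial_t\mathbb F_8^{m,\pm}=\partial_{y_\alpha}\mathbb F_{3+\alpha}^{m,\pm}\qquad\text{on }[0,T]\times\mathbb T^2\times I^\pm,$$ $$\mathbb F_6^{m,\pm}|_{\Gamma_0}=(\partial_t+u_j^{0,\pm}\partial_{y_j})\mathbb G_2^{m,\pm}-H_j^{0,\pm}\partial_{y_j}\mathbb G_1^{m,\pm}\qquad\text{on }[0,T]\times\mathbb T^2.$$ -/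

import Mathlib

open scoped ContDiff
open Finset

namespace CurrentVortexSheet

/-! ### States, fluxes and parameters -/

/-- The two sides of the sheet. -/
inductive Side where
  | plus : Side
  | minus : Side

/-- `+1` on the side `+` and `-1` on the side `-`. -/
def Side.sgn : Side → ℝ
  | .plus => 1
  | .minus => -1

/-- Labels of the seven coordinates of a state `U = (u₁, u₂, u₃, H₁, H₂, H₃, q)`. -/
inductive Comp where
  | vel (i : Fin 3) : Comp
  | mag (i : Fin 3) : Comp
  | pres : Comp

/-- The fluxes `f_α` of the conservative form `A₀ ∂ₜ U + ∂_α f_α(U) = 0` of the incompressible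
MHD equations: momentum `u_α u - H_α H + q e_α`, induction `u_α H - H_α u`, divergence `u_α`. -/
def flux (α : Fin 3) (U : Comp → ℝ) : Comp → ℝ
  | .vel i => U (.vel α) * U (.vel i) - U (.mag α) * U (.mag i) + if i = α then U .pres else 0
  | .mag i => U (.vel α) * U (.mag i) - U (.mag α) * U (.vel i)
  | .pres => U (.vel α)

/-- The symmetric bilinear map `𝔸_α = d² f_α` (the fluxes are quadratic, so it does not depend
on the base state). -/
def hess (α : Fin 3) (V W : Comp → ℝ) : Comp → ℝ
  | .vel i => V (.vel α) * W (.vel i) + V (.vel i) * W (.vel α)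
      - (V (.mag α) * W (.mag i) + V (.mag i) * W (.mag α))
  | .mag i => V (.vel α) * W (.mag i) + V (.mag i) * W (.vel α)
      - (V (.mag α) * W (.vel i) + V (.vel i) * W (.mag α))
  | .pres => 0

/-- The Jacobian `d f_α(U)` applied to `V`. -/
def jac (α : Fin 3) (U V : Comp → ℝ) : Comp → ℝ
  | .vel i => hess α U V (.vel i) + if i = α then V .pres else 0
  | .mag i => hess α U V (.mag i)
  | .pres => V (.vel α)

/-- `jac` is the derivative of `flux`. -/
theorem hasDerivAt_flux (α : Fin 3) (U V : Comp → ℝ) (k : Comp) :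
    HasDerivAt (fun r : ℝ => flux α (fun k' => U k' + r * V k') k) (jac α U V k) 0 := by
  have h : ∀ k' : Comp, HasDerivAt (fun r : ℝ => U k' + r * V k') (V k') 0 := fun k' => by
    simpa using ((hasDerivAt_id (0 : ℝ)).mul_const (V k')).const_add (U k')
  cases k with
  | vel i =>
    by_cases hi : i = α
    · have := (((h (.vel α)).fun_mul (h (.vel i))).fun_sub
        ((h (.mag α)).fun_mul (h (.mag i)))).fun_add (h .pres)
      simp only [flux, jac, hess, hi, if_true, zero_mul, add_zero] at this ⊢
      exact this.congr_deriv (by ring)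
    · have := ((h (.vel α)).fun_mul (h (.vel i))).fun_sub ((h (.mag α)).fun_mul (h (.mag i)))
      simp only [flux, jac, hess, hi, if_false, zero_mul, add_zero] at this ⊢
      exact this.congr_deriv (by ring)
  | mag i =>
    have := ((h (.vel α)).fun_mul (h (.mag i))).fun_sub ((h (.mag α)).fun_mul (h (.vel i)))
    simp only [flux, jac, hess, zero_mul, add_zero] at this ⊢
    exact this.congr_deriv (by ring)
  | pres => simpa [flux, jac] using h (.vel α)

/-- `hess` is the derivative of `jac` with respect to the base state. -/
theorem hasDerivAt_jac (α : Fin 3) (U V W : Comp → ℝ) (k : Comp) :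
    HasDerivAt (fun r : ℝ => jac α (fun k' => U k' + r * V k') W k) (hess α V W k) 0 := by
  have h : ∀ k' k'' : Comp,
      HasDerivAt (fun r : ℝ => (U k' + r * V k') * W k'') (V k' * W k'') 0 := fun k' k'' => by
    simpa using (((hasDerivAt_id (0 : ℝ)).mul_const (V k')).const_add (U k')).mul_const (W k'')
  cases k with
  | vel i =>
    simp only [jac, hess]
    exact (((h _ _).add (h _ _)).sub ((h _ _).add (h _ _))).add_const _
  | mag i =>
    simp only [jac, hess]
    exact ((h _ _).add (h _ _)).sub ((h _ _).add (h _ _))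
  | pres => simpa [jac, hess] using hasDerivAt_const (0 : ℝ) (W (.vel α))

/-- The constants of the problem: the final time `T`, the tangential parts of the constant
reference velocities and magnetic fields on both sides, the time frequency `tau`, the tangential
frequency `xi`, and the cut-off function `chi`. -/
structure Params where
  T : ℝ
  T_pos : 0 < T
  u0 : Side → Fin 2 → ℝ
  H0 : Side → Fin 2 → ℝ
  tau : ℝ
  xi : Fin 2 → ℝ
  chi : ℝ → ℝ
  chi_smooth : ContDiff ℝ ∞ chi
  chi_eq_one : ∀ r ∈ Set.Icc (-(1 / 3) : ℝ) (1 / 3), chi r = 1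
  chi_eq_zero : ∀ r, r ∉ Set.Icc (-(2 / 3) : ℝ) (2 / 3) → chi r = 0

namespace Params

variable (P : Params)

/-- The reference state `U⁰ = (u₁⁰, u₂⁰, 0, H₁⁰, H₂⁰, 0, 0)`. -/
def U0 (s : Side) : Comp → ℝ
  | .vel i => ![P.u0 s 0, P.u0 s 1, 0] i
  | .mag i => ![P.H0 s 0, P.H0 s 1, 0] i
  | .pres => 0

/-- `b = ξ_j H_j⁰`. -/
def b (s : Side) : ℝ := ∑ j, P.xi j * P.H0 s j

/-- `c = τ + ξ_j u_j⁰`. -/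
def c (s : Side) : ℝ := P.tau + ∑ j, P.xi j * P.u0 s j

/-- The matrix `A₀ = diag(1, 1, 1, 1, 1, 1, 0)`. -/
def A0 (V : Comp → ℝ) : Comp → ℝ
  | .vel i => V (.vel i)
  | .mag i => V (.mag i)
  | .pres => 0

/-- The matrices `A_α = d f_α(U⁰)`. -/
def A (s : Side) (α : Fin 3) (V : Comp → ℝ) : Comp → ℝ := jac α (P.U0 s) V

/-- The matrix `𝒜 = τ A₀ + ξ_j A_j`. -/
def calA (s : Side) (V : Comp → ℝ) (k : Comp) : ℝ :=
  P.tau * A0 V k + ∑ j : Fin 2, P.xi j * P.A s j.castSucc V k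

end Params

/-! ### Functions of `(t, y₁, y₂, y₃, Y₃, θ)` -/

/-- Points `(t, y₁, y₂, y₃, Y₃, θ)`; functions on the torus are `2π`-periodic functions of the
corresponding real variables, and a function of fewer variables is a function that does not
depend on the other ones. -/
abbrev Pt := Fin 6 → ℝ

/-- The index in `(t, y₁, y₂, y₃, Y₃, θ)` of the slow space variable `y_α`. -/
def sp (α : Fin 3) : Fin 6 := ![1, 2, 3] α

/-- The index in `(t, y₁, y₂, y₃, Y₃, θ)` of the tangential variable `y_j`. -/
def tg (j : Fin 2) : Fin 6 := ![1, 2] j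

/-- The closed domain `0 ≤ t ≤ T`, `0 ≤ ± y₃ ≤ 1`, `± Y₃ ≥ 0`. -/
def dom (T : ℝ) (s : Side) : Set Pt :=
  {x | x 0 ∈ Set.Icc 0 T ∧ s.sgn * x 3 ∈ Set.Icc 0 1 ∧ 0 ≤ s.sgn * x 4}

/-- Partial derivative number `i` on the domain `D` (one-sided at boundary points). -/
noncomputable def pd (D : Set Pt) (i : Fin 6) (f : Pt → ℝ) (x : Pt) : ℝ :=
  fderivWithin ℝ f D x (Pi.single i 1)

/-- `f` does not depend on variable number `i`. -/
def IndepOf (i : Fin 6) (f : Pt → ℝ) : Prop := ∀ x r, f (Function.update x i r) = f x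

/-- `f` is `2π`-periodic in `y₁`, `y₂` and `θ`. -/
def IsPeriodic (f : Pt → ℝ) : Prop :=
  ∀ i ∈ ({1, 2, 5} : Set (Fin 6)), ∀ x, f (Function.update x i (x i + 2 * Real.pi)) = f x

/-- The space `H^∞` of profiles `f(t, y, θ)`: by Sobolev embedding on a bounded domain, these are
the functions that are smooth up to the boundary. -/
structure InSbar (T : ℝ) (s : Side) (f : Pt → ℝ) : Prop where
  smooth : ContDiffOn ℝ ∞ f (dom T s)
  periodic : IsPeriodic f
  indep : IndepOf 4 f

/-- The space of surface wave profiles `f(t, y, Y₃, θ)`: smooth up to the boundary, with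
exponential decay in `Y₃` of all partial derivatives, uniformly in the other variables. -/
structure InSstar (T : ℝ) (s : Side) (f : Pt → ℝ) : Prop where
  smooth : ContDiffOn ℝ ∞ f (dom T s)
  periodic : IsPeriodic f
  decay : ∃ δ : ℝ, 0 < δ ∧ ∀ l : List (Fin 6), ∃ C : ℝ, ∀ x ∈ dom T s,
    |l.foldr (pd (dom T s)) f x| ≤ C * Real.exp (-δ * |x 4|)

/-- The space `H^∞([0,T] × 𝕋² × 𝕋)` of front profiles `f(t, y', θ)`. -/
structure IsFront (T : ℝ) (f : Pt → ℝ) : Prop where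
  smooth : ContDiffOn ℝ ∞ f {x | x 0 ∈ Set.Icc 0 T}
  periodic : IsPeriodic f
  indep_y : IndepOf 3 f
  indep_Y : IndepOf 4 f

/-- The mean `𝐜₀` (zero Fourier mode) with respect to `θ`. -/
noncomputable def mean (f : Pt → ℝ) (x : Pt) : ℝ :=
  (2 * Real.pi)⁻¹ * ∫ θ in (0 : ℝ)..(2 * Real.pi), f (Function.update x 5 θ)

/-- The point `(t, y', 0, 0, θ)`; composing with it gives the double trace on `y₃ = Y₃ = 0`. -/
def atZero (x : Pt) : Pt := Function.update (Function.update x 3 0) 4 0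

/-! ### The expansions of `χ(x₃)` and `χ'(x₃)` -/

/-- The formal series `∑_N g_N X^N / N!`, for `X` without constant term: substitution of `y + X`
in a function whose derivatives at `y` are the `g_N`. -/
noncomputable def taylorSubst (g : ℕ → ℝ) (X : PowerSeries ℝ) : PowerSeries ℝ :=
  PowerSeries.mk fun m =>
    ∑ N ∈ range (m + 1), g N / (N.factorial : ℝ) * PowerSeries.coeff m (X ^ N)

/-- Picard iteration for the formal series `X = x₃ - y₃` solving `X = χ(y₃ + X) Ψ`, where the
`g_N` are the derivatives of `χ` at `y₃` and `Ψ` has no constant term. The coefficients of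
`ε^0, …, ε^n` are final after `n` steps. -/
noncomputable def picard (g : ℕ → ℝ) (Ψ : PowerSeries ℝ) : ℕ → PowerSeries ℝ
  | 0 => 0
  | n + 1 => Ψ * taylorSubst g (picard g Ψ n)

namespace Params

variable (P : Params)

/-- The coefficient `χ^{[ℓ]}` of `ε^ℓ` in `χ(x₃)`, where `y₃ = x₃ - χ(x₃) ∑ ε^m ψ^m`. -/
noncomputable def chiC (ψ : ℕ → Pt → ℝ) (l : ℕ) (x : Pt) : ℝ :=
  PowerSeries.coeff l (taylorSubst (fun N => iteratedDeriv N P.chi (x 3))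
    (picard (fun N => iteratedDeriv N P.chi (x 3)) (PowerSeries.mk fun n => ψ n x) l))

/-- The coefficient `χ̇^{[ℓ]}` of `ε^ℓ` in `χ'(x₃)`, where `y₃ = x₃ - χ(x₃) ∑ ε^m ψ^m`. -/
noncomputable def chiDotC (ψ : ℕ → Pt → ℝ) (l : ℕ) (x : Pt) : ℝ :=
  PowerSeries.coeff l (taylorSubst (fun N => iteratedDeriv (N + 1) P.chi (x 3))
    (picard (fun N => iteratedDeriv N P.chi (x 3)) (PowerSeries.mk fun n => ψ n x) l))

end Params

/-! ### Sums over indices with a given sum -/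

/-- `∑_{ℓ₁+ℓ₂=n}`. -/
def sum2 (n : ℕ) (g : ℕ → ℕ → ℝ) : ℝ := ∑ p ∈ antidiagonal n, g p.1 p.2

/-- `∑_{ℓ₁+ℓ₂+ℓ₃=n}`. -/
def sum3 (n : ℕ) (g : ℕ → ℕ → ℕ → ℝ) : ℝ := sum2 n fun l₁ r => sum2 r fun l₂ l₃ => g l₁ l₂ l₃

/-- `∑_{ℓ₁+ℓ₂+ℓ₃+ℓ₄=n}`. -/
def sum4 (n : ℕ) (g : ℕ → ℕ → ℕ → ℕ → ℝ) : ℝ :=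
  sum2 n fun l₁ r => sum3 r fun l₂ l₃ l₄ => g l₁ l₂ l₃ l₄

/-! ### Source terms of the WKB cascade

`U` is a family of profiles `(U^m)_m` on the side `s`, where `U^0` is the constant reference
state, and `ψ` is the family of front profiles `(ψ^m)_m`, where `ψ^0 = ψ^1 = 0`. -/

namespace Params

variable (P : Params) (s : Side) (U : ℕ → Comp → Pt → ℝ) (ψ : ℕ → Pt → ℝ)

/-- Partial derivative number `i` on the domain of the side `s`. -/
noncomputable def d (i : Fin 6) (f : Pt → ℝ) (x : Pt) : ℝ := pd (dom P.T s) i f x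

/-- The vector `∂_i U^ℓ` at a point. -/
noncomputable def dU (i : Fin 6) (l : ℕ) (x : Pt) : Comp → ℝ := fun k => P.d s i (U l k) x

/-- The vector `U^ℓ` at a point. -/
def val (l : ℕ) (x : Pt) : Comp → ℝ := fun k => U l k x

/-- `ξ_j 𝔸_j(V, W)`. -/
def xiHess (V W : Comp → ℝ) (k : Comp) : ℝ := ∑ j : Fin 2, P.xi j * hess j.castSucc V W k

/-- The slow operator `L_s = A₀ ∂ₜ + A_α ∂_{y_α}` applied to `U^m`. -/
noncomputable def Ls (m : ℕ) (k : Comp) (x : Pt) : ℝ :=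
  A0 (P.dU s U 0 m x) k + ∑ α : Fin 3, P.A s α (P.dU s U (sp α) m x) k

/-- The fast operator `L_f = A₃ ∂_{Y₃} + 𝒜 ∂_θ` applied to `U^m`. -/
noncomputable def Lf (m : ℕ) (k : Comp) (x : Pt) : ℝ :=
  P.A s 2 (P.dU s U 4 m x) k + P.calA s (P.dU s U 5 m x) k

/-- `(∂ₜψ^a A₀ + ∂_{y_j}ψ^a A_j) V`. -/
noncomputable def slopeA (a : ℕ) (V : Comp → ℝ) (k : Comp) (x : Pt) : ℝ :=
  P.d s 0 (ψ a) x * A0 V k + ∑ j : Fin 2, P.d s (tg j) (ψ a) x * P.A s j.castSucc V k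

/-- `∂_{y_j}ψ^a 𝔸_j(V, W)`. -/
noncomputable def slopeHess (a : ℕ) (V W : Comp → ℝ) (k : Comp) (x : Pt) : ℝ :=
  ∑ j : Fin 2, P.d s (tg j) (ψ a) x * hess j.castSucc V W k

/-- The source term `F^m` of the cascade `L_f U^{m+1} = F^m`. -/
noncomputable def F (m : ℕ) (k : Comp) (x : Pt) : ℝ :=
  - P.Ls s U m k x
  + sum2 (m + 2) (fun a e => P.d s 5 (ψ a) x * P.calA s (P.dU s U 4 e x) k)
  + sum2 (m + 1) (fun a e => P.slopeA s ψ a (P.dU s U 4 e x) k x)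
  + sum3 (m + 1) (fun a e f =>
      P.chiC ψ a x * P.d s 5 (ψ e) x * P.calA s (P.dU s U 3 f x) k)
  + sum3 m (fun a e f => P.chiC ψ a x * P.slopeA s ψ e (P.dU s U 3 f x) k x)
  + sum3 m (fun a e f => P.chiDotC ψ a x * ψ e x * P.A s 2 (P.dU s U 3 f x) k)
  - sum2 m (fun a e => if 1 ≤ a ∧ 1 ≤ e then
      ∑ α : Fin 3, hess α (val U a x) (P.dU s U (sp α) e x) k else 0)
  - sum2 (m + 1) (fun a e => if 1 ≤ a ∧ 1 ≤ e then
      P.xiHess (val U a x) (P.dU s U 5 e x) k else 0)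
  - sum2 (m + 1) (fun a e => if 1 ≤ a ∧ 1 ≤ e then
      hess 2 (val U a x) (P.dU s U 4 e x) k else 0)
  + sum3 (m + 2) (fun a e f => if 1 ≤ e ∧ 1 ≤ f then
      P.d s 5 (ψ a) x * P.xiHess (val U e x) (P.dU s U 4 f x) k else 0)
  + sum3 (m + 1) (fun a e f => if 1 ≤ e ∧ 1 ≤ f then
      P.slopeHess s ψ a (val U e x) (P.dU s U 4 f x) k x else 0)
  + sum4 (m + 1) (fun a e f g => if 1 ≤ f ∧ 1 ≤ g then
      P.chiC ψ a x * P.d s 5 (ψ e) x * P.xiHess (val U f x) (P.dU s U 3 g x) k else 0)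
  + sum4 m (fun a e f g => if 1 ≤ f ∧ 1 ≤ g then
      P.chiC ψ a x * P.slopeHess s ψ e (val U f x) (P.dU s U 3 g x) k x else 0)
  + sum4 m (fun a e f g => if 1 ≤ f ∧ 1 ≤ g then
      P.chiDotC ψ a x * ψ e x * hess 2 (val U f x) (P.dU s U 3 g x) k else 0)

/-- The source term `F_8^m` of the fast divergence constraint
`∂_{Y₃} H₃^{m+1} + ξ_j ∂_θ H_j^{m+1} = F_8^m`. -/
noncomputable def F8 (m : ℕ) (x : Pt) : ℝ :=
  - (∑ α : Fin 3, P.d s (sp α) (U m (.mag α)) x)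
  + sum2 (m + 2) (fun a e =>
      P.d s 5 (ψ a) x * ∑ j : Fin 2, P.xi j * P.d s 4 (U e (.mag j.castSucc)) x)
  + sum2 (m + 1) (fun a e =>
      ∑ j : Fin 2, P.d s (tg j) (ψ a) x * P.d s 4 (U e (.mag j.castSucc)) x)
  + sum3 (m + 1) (fun a e f => P.chiC ψ a x * P.d s 5 (ψ e) x
      * ∑ j : Fin 2, P.xi j * P.d s 3 (U f (.mag j.castSucc)) x)
  + sum3 m (fun a e f => P.chiC ψ a x
      * ∑ j : Fin 2, P.d s (tg j) (ψ e) x * P.d s 3 (U f (.mag j.castSucc)) x)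
  + sum3 m (fun a e f => P.chiDotC ψ a x * ψ e x * P.d s 3 (U f (.mag 2)) x)

/-- The boundary source term `G_1^m`, a function of `(t, y', θ)`. -/
noncomputable def G1 (m : ℕ) (x : Pt) : ℝ :=
  P.d s 0 (ψ (m + 1)) x + ∑ j : Fin 2, P.u0 s j * P.d s (tg j) (ψ (m + 1)) x
  + sum2 (m + 2) (fun a e => if 1 ≤ e then
      P.d s 5 (ψ a) x * ∑ j : Fin 2, P.xi j * U e (.vel j.castSucc) (atZero x) else 0)
  + sum2 (m + 1) (fun a e => if 1 ≤ e then
      ∑ j : Fin 2, P.d s (tg j) (ψ a) x * U e (.vel j.castSucc) (atZero x) else 0)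

/-- The boundary source term `G_2^m`, a function of `(t, y', θ)`. -/
noncomputable def G2 (m : ℕ) (x : Pt) : ℝ :=
  ∑ j : Fin 2, P.H0 s j * P.d s (tg j) (ψ (m + 1)) x
  + sum2 (m + 2) (fun a e => if 1 ≤ e then
      P.d s 5 (ψ a) x * ∑ j : Fin 2, P.xi j * U e (.mag j.castSucc) (atZero x) else 0)
  + sum2 (m + 1) (fun a e => if 1 ≤ e then
      ∑ j : Fin 2, P.d s (tg j) (ψ a) x * U e (.mag j.castSucc) (atZero x) else 0)

/-! ### Source terms of the slow mean problem -/

/-- The interior source term `𝔽^m`; here `U` is the family of residual profiles. -/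
noncomputable def slowF (m : ℕ) (k : Comp) : Pt → ℝ := mean fun x =>
  sum3 (m + 2) (fun a e f =>
      P.chiC ψ a x * P.d s 5 (ψ e) x * P.calA s (P.dU s U 3 f x) k)
  + sum3 (m + 1) (fun a e f => P.chiC ψ a x * P.slopeA s ψ e (P.dU s U 3 f x) k x)
  + sum3 (m + 1) (fun a e f => P.chiDotC ψ a x * ψ e x * P.A s 2 (P.dU s U 3 f x) k)
  - sum2 (m + 1) (fun a e => if 1 ≤ a ∧ 1 ≤ e then
      ∑ α : Fin 3, hess α (val U a x) (P.dU s U (sp α) e x) k else 0)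
  + sum4 (m + 2) (fun a e f g => if 1 ≤ f ∧ 1 ≤ g then
      P.chiC ψ a x * P.d s 5 (ψ e) x * P.xiHess (val U f x) (P.dU s U 3 g x) k else 0)
  + sum4 (m + 1) (fun a e f g => if 1 ≤ f ∧ 1 ≤ g then
      P.chiC ψ a x * P.slopeHess s ψ e (val U f x) (P.dU s U 3 g x) k x else 0)
  + sum4 (m + 1) (fun a e f g => if 1 ≤ f ∧ 1 ≤ g then
      P.chiDotC ψ a x * ψ e x * hess 2 (val U f x) (P.dU s U 3 g x) k else 0)

/-- The interior source term `𝔽_8^m`; here `U` is the family of residual profiles. -/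
noncomputable def slowF8 (m : ℕ) : Pt → ℝ := mean fun x =>
  sum3 (m + 2) (fun a e f => P.chiC ψ a x * P.d s 5 (ψ e) x
      * ∑ j : Fin 2, P.xi j * P.d s 3 (U f (.mag j.castSucc)) x)
  + sum3 (m + 1) (fun a e f => P.chiC ψ a x
      * ∑ j : Fin 2, P.d s (tg j) (ψ e) x * P.d s 3 (U f (.mag j.castSucc)) x)
  + sum3 (m + 1) (fun a e f => P.chiDotC ψ a x * ψ e x * P.d s 3 (U f (.mag 2)) x)

/-- The boundary source term `𝔾_1^m = 𝐜₀(G_1^m) - û_{3,⋆}^{m+1}(0)|_{y₃=Y₃=0}`, where `v` stands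
for the fast mean `û_{3,⋆}^{m+1}(0)`. -/
noncomputable def slowG1 (m : ℕ) (v : Pt → ℝ) (x : Pt) : ℝ :=
  mean (P.G1 s U ψ m) x - v (atZero x)

/-- The boundary source term `𝔾_2^m = 𝐜₀(G_2^m) - Ĥ_{3,⋆}^{m+1}(0)|_{y₃=Y₃=0}`, where `w` stands
for the fast mean `Ĥ_{3,⋆}^{m+1}(0)`. -/
noncomputable def slowG2 (m : ℕ) (w : Pt → ℝ) (x : Pt) : ℝ :=
  mean (P.G2 s U ψ m) x - w (atZero x)

end Params

/-! ### Profiles known at step `m` -/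

/-- Profiles on both sides, split as `U^m = Ū^m + U_⋆^m`, and front profiles. -/
structure Profiles where
  Ubar : Side → ℕ → Comp → Pt → ℝ
  Ustar : Side → ℕ → Comp → Pt → ℝ
  psi : ℕ → Pt → ℝ

namespace Profiles

variable (Q : Profiles) (P : Params)

/-- The full profiles `U^m = Ū^m + U_⋆^m`. -/
def U (s : Side) (l : ℕ) (k : Comp) (x : Pt) : ℝ := Q.Ubar s l k x + Q.Ustar s l k x

/-- The residual component of `F^m` (the limit as `Y₃ → ±∞`): since `Ū^ℓ` does not depend on `Y₃`,
it is given by the same expression with `U^ℓ` replaced by `Ū^ℓ`. -/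
noncomputable def Fbar (s : Side) (m : ℕ) (k : Comp) : Pt → ℝ := P.F s (Q.Ubar s) Q.psi m k

/-- The residual component of `F_8^m`. -/
noncomputable def F8bar (s : Side) (m : ℕ) : Pt → ℝ := P.F8 s (Q.Ubar s) Q.psi m

/-- The surface wave component of `F^m`. -/
noncomputable def Fstar (s : Side) (m : ℕ) (k : Comp) (x : Pt) : ℝ :=
  P.F s (Q.U s) Q.psi m k x - Q.Fbar P s m k x

/-- The surface wave component of `F_8^m`. -/
noncomputable def F8star (s : Side) (m : ℕ) (x : Pt) : ℝ :=
  P.F8 s (Q.U s) Q.psi m x - Q.F8bar P s m x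

/-- The profiles `(U¹, ψ²), …, (U^{m-1}, ψ^m), (U^m, ψ_♯^{m+1})` solve the cascade up to step `m`:
regularity, the fast problems number `1, …, m` (interior equations, divergence constraint on the
magnetic field, jump conditions), and, for the sources of step `m`, the vanishing of the slow
means and the compatibility of the fast means. Only the part `ψ_♯^{m+1}` of `ψ^{m+1}` with zero
mean in `θ` is given: it is stored as `psi (m + 1)`. -/
structure SolvesUpTo (m : ℕ) : Prop where
  psi_zero : ∀ x, Q.psi 0 x = 0
  psi_one : ∀ x, Q.psi 1 x = 0
  Ubar_zero : ∀ s k x, Q.Ubar s 0 k x = P.U0 s k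
  Ustar_zero : ∀ s k x, Q.Ustar s 0 k x = 0
  psi_mem : ∀ l, 2 ≤ l → l ≤ m + 1 → IsFront P.T (Q.psi l)
  psi_last_mean : ∀ x : Pt, x 0 ∈ Set.Icc 0 P.T → mean (Q.psi (m + 1)) x = 0
  Ubar_mem : ∀ s l k, 1 ≤ l → l ≤ m → InSbar P.T s (Q.Ubar s l k)
  Ustar_mem : ∀ s l k, 1 ≤ l → l ≤ m → InSstar P.T s (Q.Ustar s l k)
  fast : ∀ s n, n + 1 ≤ m → ∀ k, ∀ x ∈ dom P.T s,
    P.Lf s (Q.U s) (n + 1) k x = P.F s (Q.U s) Q.psi n k x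
  fast_div : ∀ s n, n + 1 ≤ m → ∀ x ∈ dom P.T s,
    P.d s 4 (Q.U s (n + 1) (.mag 2)) x
      + ∑ j : Fin 2, P.xi j * P.d s 5 (Q.U s (n + 1) (.mag j.castSucc)) x
      = P.F8 s (Q.U s) Q.psi n x
  jump_vel : ∀ s n, n + 1 ≤ m → ∀ x ∈ dom P.T s,
    Q.U s (n + 1) (.vel 2) (atZero x) - P.c s * P.d s 5 (Q.psi (n + 2)) x
      = P.G1 s (Q.U s) Q.psi n x
  jump_mag : ∀ s n, n + 1 ≤ m → ∀ x ∈ dom P.T s,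
    Q.U s (n + 1) (.mag 2) (atZero x) - P.b s * P.d s 5 (Q.psi (n + 2)) x
      = P.G2 s (Q.U s) Q.psi n x
  jump_pres : ∀ n, n + 1 ≤ m → ∀ x : Pt, x 0 ∈ Set.Icc 0 P.T →
    Q.U .plus (n + 1) .pres (atZero x) - Q.U .minus (n + 1) .pres (atZero x) = 0
  slow_mean : ∀ s k, ∀ x ∈ dom P.T s, mean (Q.Fbar P s m k) x = 0
  slow_mean8 : ∀ s, ∀ x ∈ dom P.T s, mean (Q.F8bar P s m) x = 0
  fast_mean_vel : ∀ s (j : Fin 2), ∀ x ∈ dom P.T s,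
    P.u0 s j * mean (Q.Fstar P s m .pres) x - P.H0 s j * mean (Q.F8star P s m) x
      = mean (Q.Fstar P s m (.vel j.castSucc)) x
  fast_mean_mag : ∀ s (j : Fin 2), ∀ x ∈ dom P.T s,
    P.H0 s j * mean (Q.Fstar P s m .pres) x - P.u0 s j * mean (Q.F8star P s m) x
      = mean (Q.Fstar P s m (.mag j.castSucc)) x

/-- `v` is the solution in the space of surface wave profiles, independent of `θ`, of
`∂_{Y₃} v = 𝐜₀(g)`. -/
structure IsFastPrimitive (T : ℝ) (s : Side) (g v : Pt → ℝ) : Prop where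
  mem : InSstar T s v
  indep : IndepOf 5 v
  eq : ∀ x ∈ dom T s, pd (dom T s) 4 v x = mean g x

/-- The front profiles once the slow mean `p` of `ψ^{m+1}` is chosen:
`ψ^{m+1} = ψ_♯^{m+1} + p`. -/
noncomputable def fullPsi (m : ℕ) (p : Pt → ℝ) : ℕ → Pt → ℝ :=
  Function.update Q.psi (m + 1) fun x => Q.psi (m + 1) x + p x

end Profiles

end CurrentVortexSheet

/-! The induction equation and the divergence constraint are a single object. With `w = (1, u)` and
`h = (0, H)`, they are the components of the divergence `∑_ν ∂_ν (w_ν h_μ - h_ν w_μ)` of an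
antisymmetric tensor in the variables `(t, x₁, x₂, x₃)`, component `0` being `-div H`. Contracting
once more with commuting derivatives gives zero whatever `w` and `h` are: the residuals of the
magnetic equations are divergence free (`Straightening.sum_ED_Res`). Both identities are
consequences of this one, read order by order in `ε`.

To read it, `ε` becomes a formal variable `X` and profiles become power series over the ring of
smooth functions on a box. The substitution `y₃ = x₃ - χ(x₃) ∑ ε^m ψ^m`, `Y₃ = y₃ / ε`, together
with the fast phase, turns the original derivatives, multiplied by `ε²`, into the derivations `ED`.
They commute because `χ(x₃)` and `χ'(x₃)` obey the rules of implicit differentiation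
(`straightening_tsub`). With all profiles beyond `U^m` set to zero, coefficient `n + 2` of the
residuals is the fast operator on `U^{n+1}` minus the source `F^n`, up to sign in component `0`
(`apply_coeff_ResY`). So the cascade kills every coefficient below `m + 2`, the next one carries
`F^m` and `F_8^m`, and for the residual profiles coefficient `m + 3` has mean `-𝔽^m` or `𝔽_8^m`.

First identity. As `Y₃ → ±∞` the vanishing coefficients pass to the residual profiles. The first
nonzero slow balance in the divergence of their residuals, averaged over `θ`, is `∂ₜ𝔽_8 = ∂_α
𝔽_{3+α}`. The remaining front term is a `θ`-derivative because of a lower coefficient of the same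
identity (`Cascade.pd_slowF8_eq`).

Second identity. Near `y₃ = 0` one has `χ = 1`, and the component of the residuals along the
conormal of the front is a tangential divergence built from the conormal components of `w` and `h`
(`sum_conormal_mul_Res`). On the boundary the jump conditions make these vanish through order `m`,
and at order `m + 1` they equal `-G_1^m` and `-G_2^m`. This concerns the full profiles. The
difference with the residual profiles is a decaying divergence free field, so the mean of its normal
component is recovered by integrating in `Y₃` from infinity (`Box.surface_mem_meanZero`). The
compatibility of the fast means expresses the integrand through `û_{3,⋆}` and `Ĥ_{3,⋆}`, which are
the corrections in `𝔾_1` and `𝔾_2` (`Cascade.slowF_normal_eq`). -/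

namespace CurrentVortexSheet

/-! ### Derivations of formal power series -/

section FormalSeries

open PowerSeries

set_option linter.unusedSectionVars false

variable {A : Type*} [CommRing A] [Algebra ℝ A]

/-- The coefficientwise extension of a derivation to formal power series. -/
noncomputable def liftDer (d : Derivation ℝ A A) :
    Derivation ℝ (PowerSeries A) (PowerSeries A) :=
  Derivation.mk'
    { toFun := fun f => PowerSeries.mk fun n => d (coeff n f)
      map_add' := fun f g => by ext n; simp
      map_smul' := fun c f => by
        ext n
        rw [coeff_mk, coeff_smul, RingHom.id_apply, coeff_smul, coeff_mk, d.map_smul] }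
    (fun f g => by
      ext n
      simp only [LinearMap.coe_mk, AddHom.coe_mk, coeff_mk, coeff_mul, map_sum, Derivation.leibniz,
        smul_eq_mul, map_add, sum_add_distrib]
      congr 1
      rw [← Finset.Nat.sum_antidiagonal_swap]
      rfl)

@[simp] theorem coeff_liftDer (d : Derivation ℝ A A) (n : ℕ) (f : PowerSeries A) :
    coeff n (liftDer d f) = d (coeff n f) := by
  simp [liftDer]

@[simp] theorem liftDer_X (d : Derivation ℝ A A) : liftDer d (X : PowerSeries A) = 0 := by
  ext n
  rw [coeff_liftDer, coeff_X]
  split_ifs <;> simp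

@[simp] theorem liftDer_C (d : Derivation ℝ A A) (a : A) :
    liftDer d (C a) = C (d a) := by
  ext n
  rw [coeff_liftDer, coeff_C, coeff_C]
  split_ifs <;> simp

@[simp] theorem liftDer_X_pow (d : Derivation ℝ A A) (n : ℕ) :
    liftDer d (X ^ n : PowerSeries A) = 0 := by
  simp [Derivation.leibniz_pow]

theorem liftDer_comm {d d' : Derivation ℝ A A} (h : ∀ f, d (d' f) = d' (d f))
    (f : PowerSeries A) : liftDer d (liftDer d' f) = liftDer d' (liftDer d f) := by
  ext n; simp [h]

/-! ### Substitution in a Taylor series -/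

/-- The formal series `∑_N g_N Ξ^N / N!` with coefficients in an algebra. -/
noncomputable def tsub (g : ℕ → A) (Ξ : PowerSeries A) : PowerSeries A :=
  PowerSeries.mk fun m =>
    ∑ N ∈ range (m + 1), (N.factorial : ℝ)⁻¹ • (g N * coeff m (Ξ ^ N))

theorem coeff_pow_of_X_dvd {Ξ : PowerSeries A} (h : X ∣ Ξ) {m N : ℕ} (hmN : m < N) :
    coeff m (Ξ ^ N) = 0 :=
  X_pow_dvd_iff.1 (pow_dvd_pow_of_dvd h N) m hmN

theorem coeff_tsub_of_le (g : ℕ → A) {Ξ : PowerSeries A} (h : X ∣ Ξ) {m M : ℕ} (hM : m ≤ M) :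
    coeff m (tsub g Ξ)
      = coeff m (∑ N ∈ range (M + 1), (N.factorial : ℝ)⁻¹ • (C (g N) * Ξ ^ N)) := by
  simp only [tsub, coeff_mk, map_sum, coeff_smul, coeff_C_mul]
  refine Finset.sum_subset (Finset.range_mono (by omega)) fun N _ hN => ?_
  rw [coeff_pow_of_X_dvd h (by simpa using hN)]
  simp

/-- Chain rule: the coefficients contribute an explicit derivative and the argument contributes the
shifted series. As `X ∣ Ξ`, each coefficient sees only a Taylor polynomial, where this is the
Leibniz rule. -/
theorem liftDer_tsub (d : Derivation ℝ A A) (g : ℕ → A) {Ξ : PowerSeries A} (h : X ∣ Ξ) :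
    liftDer d (tsub g Ξ)
      = tsub (fun N => d (g N)) Ξ + tsub (fun N => g (N + 1)) Ξ * liftDer d Ξ := by
  -- Degree `M + 1` on the left leaves degree `M` in the shifted sum, since differentiating `Ξ ^ N`
  -- lowers the exponent.
  have key : ∀ M : ℕ, liftDer d (∑ N ∈ range (M + 1 + 1),
      (N.factorial : ℝ)⁻¹ • (C (g N) * Ξ ^ N))
      = ∑ N ∈ range (M + 1 + 1), (N.factorial : ℝ)⁻¹ • (C (d (g N)) * Ξ ^ N)
        + (∑ N ∈ range (M + 1), (N.factorial : ℝ)⁻¹ • (C (g (N + 1)) * Ξ ^ N))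
          * liftDer d Ξ := by
    intro M
    have hN : ∀ N : ℕ, liftDer d ((N.factorial : ℝ)⁻¹ • (C (g N) * Ξ ^ N))
        = (N.factorial : ℝ)⁻¹ • (C (d (g N)) * Ξ ^ N)
          + (N.factorial : ℝ)⁻¹ • ((N : ℝ) • (C (g N) * Ξ ^ (N - 1) * liftDer d Ξ)) := by
      intro N
      rw [Derivation.map_smul, Derivation.leibniz, Derivation.leibniz_pow, liftDer_C, ← smul_add]
      congr 1
      simp only [smul_eq_mul, nsmul_eq_mul, Nat.cast_smul_eq_nsmul]
      ring
    rw [map_sum, sum_congr rfl fun N _ => hN N, sum_add_distrib]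
    congr 1
    rw [sum_range_succ', Finset.sum_mul]
    simp only [Nat.cast_zero, zero_smul, smul_zero, add_zero, Nat.add_sub_cancel]
    refine sum_congr rfl fun N _ => ?_
    rw [smul_smul, smul_mul_assoc]
    congr 1
    rw [Nat.factorial_succ]
    push_cast
    field_simp
  ext m
  rw [coeff_liftDer, coeff_tsub_of_le g h (Nat.le_succ m), ← coeff_liftDer, key, map_add, map_add,
    ← coeff_tsub_of_le _ h (Nat.le_succ m)]
  congr 1
  rw [coeff_mul, coeff_mul]
  refine sum_congr rfl fun p hp => ?_
  rw [coeff_tsub_of_le _ h (HasAntidiagonal.antidiagonal.fst_le hp)]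

theorem tsub_zero_fun (Ξ : PowerSeries A) : tsub (fun _ => (0 : A)) Ξ = 0 := by
  ext m; simp [tsub]

theorem tsub_single (a : A) (g : ℕ → A) (h0 : g 0 = a) (hg : ∀ N, g (N + 1) = 0)
    (Ξ : PowerSeries A) : tsub g Ξ = C a := by
  ext m
  rw [tsub, coeff_mk, sum_range_succ']
  simp [hg, h0, coeff_C, coeff_one]

theorem X_pow_dvd_tsub_sub (g : ℕ → A) {Ξ Ξ' : PowerSeries A} {n : ℕ} (h : X ^ n ∣ Ξ - Ξ') :
    X ^ n ∣ tsub g Ξ - tsub g Ξ' := by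
  rw [X_pow_dvd_iff]
  intro m hm
  rw [map_sub, tsub, tsub, coeff_mk, coeff_mk, ← sum_sub_distrib]
  refine sum_eq_zero fun N _ => ?_
  have := X_pow_dvd_iff.1 (h.trans (sub_dvd_pow_sub_pow Ξ Ξ' N)) m hm
  rw [map_sub, sub_eq_zero] at this
  rw [this, sub_self]

theorem map_tsub {B : Type*} [CommRing B] [Algebra ℝ B] (φ : A →ₐ[ℝ] B) (g : ℕ → A)
    (Ξ : PowerSeries A) :
    PowerSeries.map (φ : A →+* B) (tsub g Ξ)
      = tsub (fun N => φ (g N)) (PowerSeries.map (φ : A →+* B) Ξ) := by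
  ext m
  simp [tsub, ← map_pow]

/-- Picard iteration for `Ξ = Ψ ∑_N g_N Ξ^N / N!`. -/
noncomputable def pic (g : ℕ → A) (Ψ : PowerSeries A) : ℕ → PowerSeries A
  | 0 => 0
  | n + 1 => Ψ * tsub g (pic g Ψ n)

theorem X_pow_dvd_pic_sub (g : ℕ → A) {Ψ Ψ' : PowerSeries A} {M : ℕ} (h : X ^ M ∣ Ψ - Ψ')
    (n : ℕ) : X ^ M ∣ pic g Ψ n - pic g Ψ' n := by
  induction n with
  | zero => simp [pic]
  | succ n ih =>
    have : pic g Ψ (n + 1) - pic g Ψ' (n + 1)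
        = (Ψ - Ψ') * tsub g (pic g Ψ n) + Ψ' * (tsub g (pic g Ψ n) - tsub g (pic g Ψ' n)) := by
      simp only [pic]; ring
    rw [this]
    exact dvd_add (h.mul_right _) ((X_pow_dvd_tsub_sub g ih).mul_left _)

/-- The iteration is an `X`-adic contraction: substitution preserves the order of agreement, and the
factor `Ψ`, divisible by `X`, raises it by one. -/
theorem X_pow_dvd_pic_succ_sub (g : ℕ → A) {Ψ : PowerSeries A} (h : X ∣ Ψ) (n : ℕ) :
    X ^ (n + 1) ∣ pic g Ψ (n + 1) - pic g Ψ n := by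
  induction n with
  | zero => simpa [pic] using h.mul_right _
  | succ n ih =>
    have : pic g Ψ (n + 1 + 1) - pic g Ψ (n + 1)
        = Ψ * (tsub g (pic g Ψ (n + 1)) - tsub g (pic g Ψ n)) := by
      simp only [pic]; ring
    rw [this, pow_succ']
    exact mul_dvd_mul h (X_pow_dvd_tsub_sub g ih)

theorem X_pow_dvd_pic_sub_of_le (g : ℕ → A) {Ψ : PowerSeries A} (h : X ∣ Ψ) {n N : ℕ}
    (hn : n ≤ N) : X ^ (n + 1) ∣ pic g Ψ N - pic g Ψ n := by
  induction N, hn using Nat.le_induction with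
  | base => simp
  | succ N hN ih =>
    have := dvd_add ((pow_dvd_pow X (by omega)).trans (X_pow_dvd_pic_succ_sub g h N)) ih
    rwa [sub_add_sub_cancel] at this

/-- The limit of the Picard iteration. -/
noncomputable def picLim (g : ℕ → A) (Ψ : PowerSeries A) : PowerSeries A :=
  PowerSeries.mk fun l => coeff l (pic g Ψ l)

theorem X_pow_dvd_picLim_sub (g : ℕ → A) {Ψ : PowerSeries A} (h : X ∣ Ψ) (n : ℕ) :
    X ^ (n + 1) ∣ picLim g Ψ - pic g Ψ n := by
  rw [X_pow_dvd_iff]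
  intro m hm
  have := X_pow_dvd_iff.1 (X_pow_dvd_pic_sub_of_le g h (Nat.lt_succ_iff.1 hm)) m (Nat.lt_succ_self m)
  rw [map_sub, sub_eq_zero] at this
  rw [map_sub, picLim, coeff_mk, this, sub_self]

/-- Both sides agree with iterate `n + 1` through coefficient `n`, for every `n`. -/
theorem picLim_eq (g : ℕ → A) {Ψ : PowerSeries A} (h : X ∣ Ψ) :
    picLim g Ψ = Ψ * tsub g (picLim g Ψ) := by
  ext n
  have h1 := X_pow_dvd_picLim_sub g h (n + 1)
  have h2 : X ^ (n + 1) ∣ Ψ * tsub g (picLim g Ψ) - pic g Ψ (n + 1) := by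
    simp only [pic]
    rw [← mul_sub]
    exact (X_pow_dvd_tsub_sub g (X_pow_dvd_picLim_sub g h n)).mul_left _
  have h3 := X_pow_dvd_iff.1 h1 n (by omega)
  have h4 := X_pow_dvd_iff.1 h2 n (by omega)
  rw [map_sub, sub_eq_zero] at h3 h4
  rw [h3, h4]

theorem X_dvd_picLim (g : ℕ → A) {Ψ : PowerSeries A} (h : X ∣ Ψ) : X ∣ picLim g Ψ := by
  rw [picLim_eq g h]; exact h.mul_right _

theorem taylorSubst_eq_tsub (g : ℕ → ℝ) (Ξ : PowerSeries ℝ) : taylorSubst g Ξ = tsub g Ξ := by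
  ext m
  simp only [taylorSubst, tsub, coeff_mk, smul_eq_mul]
  exact sum_congr rfl fun N _ => by ring

theorem picard_eq_pic (g : ℕ → ℝ) (Ψ : PowerSeries ℝ) (n : ℕ) : picard g Ψ n = pic g Ψ n := by
  induction n with
  | zero => rfl
  | succ n ih => rw [picard, pic, taylorSubst_eq_tsub, ih]

theorem map_pic {B : Type*} [CommRing B] [Algebra ℝ B] (φ : A →ₐ[ℝ] B) (g : ℕ → A)
    (Ψ : PowerSeries A) (n : ℕ) :
    PowerSeries.map (φ : A →+* B) (pic g Ψ n)
      = pic (fun N => φ (g N)) (PowerSeries.map (φ : A →+* B) Ψ) n := by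
  induction n with
  | zero => simp [pic]
  | succ n ih => simp only [pic, map_mul, map_tsub, ih]

/-- Evaluation of the coefficients of a series `∑_N f_N Ξ^N / N!` at the limit of the Picard
iteration: they are given by finitely many iterations. -/
theorem apply_coeff_tsub_picLim (φ : A →ₐ[ℝ] ℝ) (f g : ℕ → A) {Ψ : PowerSeries A} (h : X ∣ Ψ)
    (Ψ' : PowerSeries ℝ) (l : ℕ)
    (hΨ : ∀ n ≤ l, coeff n Ψ' = φ (coeff n Ψ)) :
    φ (coeff l (tsub f (picLim g Ψ)))
      = coeff l (taylorSubst (fun N => φ (f N)) (picard (fun N => φ (g N)) Ψ' l)) := by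
  rw [taylorSubst_eq_tsub, picard_eq_pic]
  have h1 := X_pow_dvd_iff.1 (X_pow_dvd_tsub_sub f (X_pow_dvd_picLim_sub g h l)) l (by omega)
  rw [map_sub, sub_eq_zero] at h1
  have h2 : X ^ (l + 1) ∣ Ψ' - PowerSeries.map (φ : A →+* ℝ) Ψ := by
    rw [X_pow_dvd_iff]
    intro n hn
    simp [hΨ n (by omega)]
  have h3 := X_pow_dvd_iff.1 (X_pow_dvd_tsub_sub (fun N => φ (f N))
    (X_pow_dvd_pic_sub (fun N => φ (g N)) h2 l)) l (by omega)
  rw [map_sub, sub_eq_zero] at h3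
  rw [h1, h3, ← map_pic, ← map_tsub, coeff_map]
  rfl

end FormalSeries

end CurrentVortexSheet

namespace CurrentVortexSheet

/-! ### Straightened derivatives -/

section Straightened

open PowerSeries

set_option linter.unusedSectionVars false

variable {A : Type*} [CommRing A] [Algebra ℝ A]

/-- The variables `t, y₁, y₂` among `t, y₁, y₂, y₃, Y₃, θ`. -/
def tan (i : Fin 3) : Fin 6 := ![0, 1, 2] i

variable (d : Fin 6 → Derivation ℝ A A) (k : Fin 3 → ℝ)

/-- The tangential derivative `ε² (∂_i + ε⁻¹ k_i ∂_θ)`. -/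
noncomputable def nab (i : Fin 3) : Derivation ℝ (PowerSeries A) (PowerSeries A) :=
  (X ^ 2 : PowerSeries A) • liftDer (d (tan i))
    + (X : PowerSeries A) • (k i • liftDer (d 5))

/-- The normal derivative `ε² (∂_{y₃} + ε⁻¹ ∂_{Y₃})`. -/
noncomputable def dn : Derivation ℝ (PowerSeries A) (PowerSeries A) :=
  (X ^ 2 : PowerSeries A) • liftDer (d 3) + (X : PowerSeries A) • liftDer (d 4)

variable (Φ C₀ C₁ : PowerSeries A)

/-- The derivatives with respect to the original variables `t, x₁, x₂, x₃`, times `ε²`: the front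
is `ε² Φ`, and `C₀`, `C₁` are the series of `χ(x₃)`, `χ'(x₃)`. -/
noncomputable def ED (μ : Fin 4) : Derivation ℝ (PowerSeries A) (PowerSeries A) :=
  Fin.lastCases (motive := fun _ => Derivation ℝ (PowerSeries A) (PowerSeries A))
    ((1 - C₁ * (X ^ 2 * Φ)) • dn d)
    (fun i => nab d k i - (C₀ * nab d k i Φ) • dn d) μ

theorem nab_apply (i : Fin 3) (f : PowerSeries A) :
    nab d k i f = X ^ 2 * liftDer (d (tan i)) f + X * (k i • liftDer (d 5) f) := rfl

theorem dn_apply (f : PowerSeries A) :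
    dn d f = X ^ 2 * liftDer (d 3) f + X * liftDer (d 4) f := rfl

theorem ED_castSucc (i : Fin 3) (f : PowerSeries A) :
    ED d k Φ C₀ C₁ i.castSucc f = nab d k i f - C₀ * nab d k i Φ * dn d f := by
  simp [ED]

theorem ED_last (f : PowerSeries A) :
    ED d k Φ C₀ C₁ 3 f = (1 - C₁ * (X ^ 2 * Φ)) * dn d f := by
  rw [show (3 : Fin 4) = Fin.last 3 from rfl, ED, Fin.lastCases_last]
  rfl

variable {d}

theorem nab_X_pow (i : Fin 3) (n : ℕ) : nab d k i (X ^ n) = 0 := by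
  simp [nab_apply]

theorem dn_X_pow (n : ℕ) : dn d (X ^ n) = 0 := by
  simp [dn_apply]

theorem nab_comm (hd : ∀ i j f, d i (d j f) = d j (d i f)) (i j : Fin 3) (f : PowerSeries A) :
    nab d k i (nab d k j f) = nab d k j (nab d k i f) := by
  simp only [nab_apply, map_add, Derivation.leibniz, Derivation.map_smul, liftDer_X, liftDer_X_pow,
    smul_zero, mul_zero, add_zero, smul_eq_mul, mul_smul_comm, smul_add, smul_smul,
    liftDer_comm (hd (tan i) (tan j)), liftDer_comm (hd 5 (tan j)), liftDer_comm (hd 5 (tan i)),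
    mul_add, mul_comm (k i) (k j)]
  abel_nf
  simp only [← mul_assoc, mul_comm (X ^ 2 : PowerSeries A) X]
  abel

theorem nab_dn_comm (hd : ∀ i j f, d i (d j f) = d j (d i f)) (i : Fin 3) (f : PowerSeries A) :
    nab d k i (dn d f) = dn d (nab d k i f) := by
  simp only [nab_apply, dn_apply, map_add, Derivation.leibniz, Derivation.map_smul, liftDer_X,
    liftDer_X_pow, smul_zero, mul_zero, add_zero, smul_eq_mul, mul_smul_comm, smul_add,
    liftDer_comm (hd 3 (tan i)), liftDer_comm (hd 4 (tan i)), liftDer_comm (hd 5 3),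
    liftDer_comm (hd 5 4), mul_add]
  abel_nf
  simp only [← mul_assoc, mul_comm (X ^ 2 : PowerSeries A) X]
  abel

/-- The relations between the front and the series of `χ(x₃)`, `χ'(x₃)` that make the straightened
derivatives commute. -/
structure Straightening (d : Fin 6 → Derivation ℝ A A) (k : Fin 3 → ℝ) (Φ C₀ C₁ : PowerSeries A) :
    Prop where
  comm : ∀ i j f, d i (d j f) = d j (d i f)
  dn_front : dn d Φ = 0
  nab_C₀ : ∀ i, nab d k i C₀ = C₀ * nab d k i Φ * dn d C₀
  nab_C₁ : ∀ i, nab d k i C₁ = C₀ * nab d k i Φ * dn d C₁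
  dn_C₀ : (1 - C₁ * (X ^ 2 * Φ)) * dn d C₀ = X ^ 2 * C₁

variable {k Φ C₀ C₁}

theorem Straightening.dn_nab_front (h : Straightening d k Φ C₀ C₁) (i : Fin 3) :
    dn d (nab d k i Φ) = 0 := by
  rw [← nab_dn_comm k h.comm, h.dn_front, map_zero]

/-- The relation `nab_C₀` says that the tangential derivative at fixed `x₃` kills `χ(x₃)`, and the
slope of the front does not depend on the normal variables. Only terms symmetric in `i`, `j` remain.
-/
theorem Straightening.ED_comm_castSucc (h : Straightening d k Φ C₀ C₁) (i j : Fin 3)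
    (f : PowerSeries A) :
    ED d k Φ C₀ C₁ i.castSucc (ED d k Φ C₀ C₁ j.castSucc f)
      = ED d k Φ C₀ C₁ j.castSucc (ED d k Φ C₀ C₁ i.castSucc f) := by
  simp only [ED_castSucc, map_sub, Derivation.leibniz, smul_eq_mul, h.dn_nab_front, h.nab_C₀,
    nab_comm k h.comm i j, nab_dn_comm k h.comm]
  ring

/-- Differentiating `χ(x₃)` in the tangential derivative produces `ε² χ'(x₃)`, by `dn_C₀`. This
compensates the tangential derivative of the factor `1 - χ'(x₃) φ`, where `φ` is the front. -/
theorem Straightening.ED_comm_last (h : Straightening d k Φ C₀ C₁) (i : Fin 3)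
    (f : PowerSeries A) :
    ED d k Φ C₀ C₁ i.castSucc (ED d k Φ C₀ C₁ 3 f)
      = ED d k Φ C₀ C₁ 3 (ED d k Φ C₀ C₁ i.castSucc f) := by
  simp only [ED_castSucc, ED_last, map_sub, Derivation.leibniz, smul_eq_mul, h.dn_nab_front,
    h.nab_C₁, nab_dn_comm k h.comm, nab_X_pow, dn_X_pow, Derivation.map_one_eq_zero, h.dn_front]
  linear_combination (nab d k i Φ * dn d f) * h.dn_C₀

theorem Straightening.ED_comm (h : Straightening d k Φ C₀ C₁) (μ ν : Fin 4) (f : PowerSeries A) :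
    ED d k Φ C₀ C₁ μ (ED d k Φ C₀ C₁ ν f) = ED d k Φ C₀ C₁ ν (ED d k Φ C₀ C₁ μ f) := by
  induction μ using Fin.lastCases with
  | last =>
    induction ν using Fin.lastCases with
    | last => rfl
    | cast j => exact (h.ED_comm_last j f).symm
  | cast i =>
    induction ν using Fin.lastCases with
    | last => exact h.ED_comm_last i f
    | cast j => exact h.ED_comm_castSucc i j f

/-! ### The magnetic field equations as the divergence of an antisymmetric tensor -/

variable (d k Φ C₀ C₁)

/-- The residuals of the induction equation (components `1, 2, 3`) and minus the residual of the
divergence constraint (component `0`), for `w = (1, u)` and `h = (0, H)`. -/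
noncomputable def Res (w h : Fin 4 → PowerSeries A) (μ : Fin 4) : PowerSeries A :=
  ∑ ν, ED d k Φ C₀ C₁ ν (w ν * h μ - h ν * w μ)

variable {d k Φ C₀ C₁}

theorem eq_zero_of_eq_neg_self {M : Type*} [AddCommGroup M] [Module ℝ M] {x : M} (h : x = -x) :
    x = 0 := by
  have h2 : (2 : ℝ) • x = 0 := by
    rw [two_smul]; nth_rewrite 2 [h]; exact add_neg_cancel x
  simpa using h2

/-- Commuting derivatives are contracted with an antisymmetric tensor. No equation on the fields is
used, so the identity holds for truncated profiles. -/
theorem Straightening.sum_ED_Res (h : Straightening d k Φ C₀ C₁) (w b : Fin 4 → PowerSeries A) :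
    ∑ μ, ED d k Φ C₀ C₁ μ (Res d k Φ C₀ C₁ w b μ) = 0 := by
  apply eq_zero_of_eq_neg_self
  simp only [Res, map_sum]
  -- Exchanging the two indices leaves the second derivatives unchanged and reverses the sign of the
  -- tensor: the double sum is its own opposite.
  conv_lhs => rw [sum_comm]
  rw [← sum_neg_distrib]
  refine sum_congr rfl fun μ _ => ?_
  rw [← sum_neg_distrib]
  refine sum_congr rfl fun ν _ => ?_
  rw [h.ED_comm, ← map_neg, ← map_neg]
  congr 2
  ring

/-- The conormal `(-∇Φ, 1)` of the front. -/
noncomputable def conormal (d : Fin 6 → Derivation ℝ A A) (k : Fin 3 → ℝ) (Φ : PowerSeries A)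
    (μ : Fin 4) : PowerSeries A :=
  Fin.lastCases (motive := fun _ => PowerSeries A) 1 (fun i => -nab d k i Φ) μ

/-- The conormal component of the residuals is a tangential divergence. -/
theorem sum_conormal_mul_Res (hd : ∀ i j f, d i (d j f) = d j (d i f))
    (w b : Fin 4 → PowerSeries A) :
    ∑ μ, conormal d k Φ μ * Res d k Φ 1 0 w b μ
      = ∑ i : Fin 3, nab d k i (w i.castSucc * ∑ μ, conormal d k Φ μ * b μ
          - b i.castSucc * ∑ μ, conormal d k Φ μ * w μ) := by
  -- What follows is a polynomial identity in `nab` and `dn`. Second tangential derivatives of the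
  -- front cancel by symmetry against the antisymmetric tensor. Normal derivatives cancel because
  -- contracting the tensor twice with the conormal gives zero.
  have h3 : ∀ f, ED d k Φ 1 0 3 f = dn d f := fun f => by rw [ED_last]; ring
  have h0 : ∀ f, ED d k Φ 1 0 0 f = nab d k 0 f - nab d k 0 Φ * dn d f := fun f => by
    simpa using ED_castSucc d k Φ 1 0 0 f
  have h1 : ∀ f, ED d k Φ 1 0 1 f = nab d k 1 f - nab d k 1 Φ * dn d f := fun f => by
    simpa using ED_castSucc d k Φ 1 0 1 f
  have h2 : ∀ f, ED d k Φ 1 0 2 f = nab d k 2 f - nab d k 2 Φ * dn d f := fun f => by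
    simpa using ED_castSucc d k Φ 1 0 2 f
  have c3 : conormal d k Φ 3 = 1 := rfl
  have c0 : conormal d k Φ 0 = - nab d k 0 Φ := rfl
  have c1 : conormal d k Φ 1 = - nab d k 1 Φ := rfl
  have c2 : conormal d k Φ 2 = - nab d k 2 Φ := rfl
  simp only [Res, Fin.sum_univ_four, Fin.sum_univ_three, Fin.castSucc_zero, Fin.castSucc_one,
    show (Fin.castSucc (2 : Fin 3)) = 2 from rfl, h0, h1, h2, h3, c0, c1, c2, c3, map_sub, map_add,
    map_neg,
    Derivation.leibniz, smul_eq_mul, Derivation.map_one_eq_zero, nab_comm k hd 1 0,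
    nab_comm k hd 2 0, nab_comm k hd 2 1]
  ring

end Straightened

end CurrentVortexSheet

namespace CurrentVortexSheet

section Straightened

open PowerSeries

set_option linter.unusedSectionVars false

variable {A : Type*} [CommRing A] [Algebra ℝ A]
variable {d : Fin 6 → Derivation ℝ A A} {k : Fin 3 → ℝ} {Φ C₀ C₁ : PowerSeries A}

/-! ### The series of `χ(x₃)` -/

theorem liftDer_tsub_of_ne {g : ℕ → A} {i : Fin 6} (hg : ∀ N, d i (g N) = 0)
    {Ξ : PowerSeries A} (hΞ : X ∣ Ξ) :
    liftDer (d i) (tsub g Ξ) = tsub (fun N => g (N + 1)) Ξ * liftDer (d i) Ξ := by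
  rw [liftDer_tsub _ _ hΞ]
  simp only [hg, tsub_zero_fun, zero_add]

theorem tan_ne (i : Fin 3) : tan i ≠ 3 ∧ tan i ≠ 4 ∧ tan i ≠ 5 := by
  fin_cases i <;> simp [tan]

theorem nab_tsub {g : ℕ → A} (hg : ∀ i, i ≠ 3 → ∀ N, d i (g N) = 0)
    {Ξ : PowerSeries A} (hΞ : X ∣ Ξ) (i : Fin 3) :
    nab d k i (tsub g Ξ) = tsub (fun N => g (N + 1)) Ξ * nab d k i Ξ := by
  rw [nab_apply, nab_apply, liftDer_tsub_of_ne (hg _ (tan_ne i).1) hΞ,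
    liftDer_tsub_of_ne (hg 5 (by decide)) hΞ, mul_add, ← mul_smul_comm]
  ring

theorem dn_tsub {g : ℕ → A} (hg : ∀ i, i ≠ 3 → ∀ N, d i (g N) = 0)
    (hg' : ∀ N, d 3 (g N) = g (N + 1)) {Ξ : PowerSeries A} (hΞ : X ∣ Ξ) :
    dn d (tsub g Ξ) = tsub (fun N => g (N + 1)) Ξ * (X ^ 2 + dn d Ξ) := by
  rw [dn_apply, dn_apply, liftDer_tsub_of_ne (hg 4 (by decide)) hΞ, liftDer_tsub _ _ hΞ]
  simp only [hg']
  ring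

/-- Implicit differentiation of `Ξ = ε² Φ χ(y₃ + Ξ)`, where `Ξ = x₃ - y₃`. Each derivative of `C₀`
satisfies a linear equation with coefficient `1 - χ'(x₃) φ`; those of `C₁` then follow from the
chain rule. -/
theorem straightening_tsub (hd : ∀ i j f, d i (d j f) = d j (d i f)) (hΦ : dn d Φ = 0)
    {g : ℕ → A} (hg : ∀ i, i ≠ 3 → ∀ N, d i (g N) = 0) (hg' : ∀ N, d 3 (g N) = g (N + 1)) :
    Straightening d k Φ (tsub g (picLim g (X ^ 2 * Φ)))
      (tsub (fun N => g (N + 1)) (picLim g (X ^ 2 * Φ))) := by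
  have hX : X ∣ X ^ 2 * Φ := (dvd_pow_self X two_ne_zero).mul_right _
  set Ξ := picLim g (X ^ 2 * Φ) with hΞ
  have hXΞ : X ∣ Ξ := X_dvd_picLim g hX
  set C₀ := tsub g Ξ with hC₀
  set C₁ := tsub (fun N => g (N + 1)) Ξ with hC₁
  have hfix : Ξ = X ^ 2 * Φ * C₀ := picLim_eq g hX
  -- The constant coefficient is `1`, as the front starts at order two.
  have hunit : IsUnit (1 - C₁ * (X ^ 2 * Φ)) := by
    rw [isUnit_iff_constantCoeff]; simp
  have hdnΞ : dn d Ξ = X ^ 2 * Φ * dn d C₀ := by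
    conv_lhs => rw [hfix]
    simp only [Derivation.leibniz, hΦ, dn_X_pow, smul_eq_mul]
    ring
  have hdn : (1 - C₁ * (X ^ 2 * Φ)) * dn d C₀ = X ^ 2 * C₁ := by
    have := dn_tsub hg hg' hXΞ
    rw [← hC₀, ← hC₁, hdnΞ] at this
    linear_combination this
  have hnabΞ : ∀ i, nab d k i Ξ = X ^ 2 * nab d k i Φ * C₀ + X ^ 2 * Φ * nab d k i C₀ := by
    intro i
    conv_lhs => rw [hfix]
    simp only [Derivation.leibniz, nab_X_pow, smul_eq_mul]
    ring
  have hnab : ∀ i, nab d k i C₀ = C₀ * nab d k i Φ * dn d C₀ := by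
    intro i
    have h1 := nab_tsub (k := k) hg hXΞ i
    rw [← hC₀, ← hC₁, hnabΞ] at h1
    refine hunit.mul_left_cancel ?_
    linear_combination h1 - C₀ * nab d k i Φ * hdn
  refine ⟨hd, hΦ, hnab, fun i => ?_, hdn⟩
  have h1 := nab_tsub (k := k) (g := fun N => g (N + 1)) (fun i hi N => hg i hi (N + 1)) hXΞ i
  have h2 := dn_tsub (g := fun N => g (N + 1)) (fun i hi N => hg i hi (N + 1))
    (fun N => hg' (N + 1)) hXΞ
  rw [h1, h2, hnabΞ, hnab, hdnΞ]
  ring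

/-! ### Leading coefficients -/

theorem coeff_zero_nab (i : Fin 3) (f : PowerSeries A) : coeff 0 (nab d k i f) = 0 := by
  simp [nab_apply]

theorem coeff_one_nab (i : Fin 3) (f : PowerSeries A) :
    coeff 1 (nab d k i f) = k i • d 5 (coeff 0 f) := by
  rw [nab_apply, map_add, coeff_X_pow_mul', if_neg (by norm_num), zero_add, coeff_succ_X_mul 0]
  simp

theorem coeff_add_two_nab (i : Fin 3) (f : PowerSeries A) (n : ℕ) :
    coeff (n + 2) (nab d k i f) = d (tan i) (coeff n f) + k i • d 5 (coeff (n + 1) f) := by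
  rw [nab_apply, map_add, coeff_X_pow_mul, coeff_succ_X_mul (n + 1), coeff_liftDer, coeff_smul,
    coeff_liftDer]

theorem coeff_zero_dn (f : PowerSeries A) : coeff 0 (dn d f) = 0 := by
  simp [dn_apply]

theorem coeff_one_dn (f : PowerSeries A) : coeff 1 (dn d f) = d 4 (coeff 0 f) := by
  rw [dn_apply, map_add, coeff_X_pow_mul', if_neg (by norm_num), zero_add, coeff_succ_X_mul 0]
  simp

theorem coeff_add_two_dn (f : PowerSeries A) (n : ℕ) :
    coeff (n + 2) (dn d f) = d 3 (coeff n f) + d 4 (coeff (n + 1) f) := by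
  rw [dn_apply, map_add, coeff_X_pow_mul, coeff_succ_X_mul (n + 1), coeff_liftDer, coeff_liftDer]

theorem coeff_zero_mul_eq (f g : PowerSeries A) :
    coeff 0 (f * g) = coeff 0 f * coeff 0 g := by
  rw [coeff_mul]; simp

theorem coeff_one_mul_eq (f g : PowerSeries A) :
    coeff 1 (f * g) = coeff 0 f * coeff 1 g + coeff 1 f * coeff 0 g := by
  rw [coeff_mul]; simp [Finset.Nat.antidiagonal_succ]

theorem coeff_two_mul (f g : PowerSeries A) :
    coeff 2 (f * g) = coeff 0 f * coeff 2 g + coeff 1 f * coeff 1 g + coeff 2 f * coeff 0 g := by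
  rw [coeff_mul]; simp [Finset.Nat.antidiagonal_succ, add_assoc]

theorem coeff_three_mul (f g : PowerSeries A) :
    coeff 3 (f * g) = coeff 0 f * coeff 3 g + coeff 1 f * coeff 2 g + coeff 2 f * coeff 1 g
      + coeff 3 f * coeff 0 g := by
  rw [coeff_mul]; simp [Finset.Nat.antidiagonal_succ, add_assoc]

section LowOrder

variable (S : PowerSeries A)

theorem coeff_one_ED_castSucc (i : Fin 3) :
    coeff 1 (ED d k Φ C₀ C₁ i.castSucc S) = k i • d 5 (coeff 0 S) := by
  rw [ED_castSucc, map_sub, coeff_one_nab, coeff_one_mul_eq, coeff_zero_dn, coeff_zero_mul_eq,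
    coeff_zero_nab]
  simp

theorem coeff_two_ED_castSucc (i : Fin 3) :
    coeff 2 (ED d k Φ C₀ C₁ i.castSucc S)
      = d (tan i) (coeff 0 S) + k i • d 5 (coeff 1 S)
        - coeff 0 C₀ * (k i • d 5 (coeff 0 Φ)) * d 4 (coeff 0 S) := by
  rw [ED_castSucc, map_sub, coeff_add_two_nab _ _ 0, coeff_two_mul, coeff_zero_dn,
    coeff_one_mul_eq, coeff_zero_mul_eq, coeff_zero_nab, coeff_one_nab, coeff_one_dn]
  simp

theorem coeff_three_ED_castSucc (h4 : ∀ n, d 4 (coeff n S) = 0) (i : Fin 3) :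
    coeff 3 (ED d k Φ C₀ C₁ i.castSucc S)
      = d (tan i) (coeff 1 S) + k i • d 5 (coeff 2 S)
        - coeff 0 C₀ * (k i • d 5 (coeff 0 Φ)) * d 3 (coeff 0 S) := by
  rw [ED_castSucc, map_sub, coeff_add_two_nab _ _ 1, coeff_three_mul, coeff_zero_dn,
    coeff_one_mul_eq, coeff_zero_mul_eq, coeff_zero_nab, coeff_one_nab, coeff_one_dn,
    coeff_add_two_dn _ 0, h4, h4]
  simp

theorem coeff_one_ED_last : coeff 1 (ED d k Φ C₀ C₁ 3 S) = d 4 (coeff 0 S) := by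
  rw [ED_last, coeff_one_mul_eq, coeff_zero_dn, coeff_one_dn]
  simp

theorem coeff_two_ED_last :
    coeff 2 (ED d k Φ C₀ C₁ 3 S) = d 3 (coeff 0 S) + d 4 (coeff 1 S) := by
  have : coeff 1 (1 - C₁ * (X ^ 2 * Φ)) = 0 := by
    rw [map_sub, coeff_one_mul_eq, coeff_X_pow_mul']; simp [coeff_one]
  rw [ED_last, coeff_two_mul, coeff_zero_dn, this, coeff_add_two_dn _ 0]
  simp

theorem coeff_three_ED_last (h4 : ∀ n, d 4 (coeff n S) = 0) :
    coeff 3 (ED d k Φ C₀ C₁ 3 S) = d 3 (coeff 1 S) := by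
  have : coeff 1 (1 - C₁ * (X ^ 2 * Φ)) = 0 := by
    rw [map_sub, coeff_one_mul_eq, coeff_X_pow_mul']; simp [coeff_one]
  rw [ED_last, coeff_three_mul, coeff_zero_dn, this, coeff_add_two_dn _ 1, coeff_one_dn, h4, h4]
  simp

end LowOrder

theorem ED_X_pow_mul (μ : Fin 4) (N : ℕ) (f : PowerSeries A) :
    ED d k Φ C₀ C₁ μ (X ^ N * f) = X ^ N * ED d k Φ C₀ C₁ μ f := by
  induction μ using Fin.lastCases with
  | last =>
    rw [show Fin.last 3 = 3 from rfl, ED_last, ED_last]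
    simp only [Derivation.leibniz, dn_X_pow, smul_eq_mul]
    ring
  | cast i =>
    simp only [ED_castSucc, Derivation.leibniz, nab_X_pow, dn_X_pow, smul_eq_mul]
    ring

theorem sum_univ_castSucc_three {M : Type*} [AddCommMonoid M] (f : Fin 4 → M) :
    ∑ μ, f μ = ∑ i : Fin 3, f i.castSucc + f 3 := Fin.sum_univ_castSucc f

variable {N : ℕ} {R : Fin 4 → PowerSeries A}

theorem exists_eq_X_pow_mul (hR : ∀ μ, ∀ n < N, coeff n (R μ) = 0) :
    ∃ S : Fin 4 → PowerSeries A, ∀ μ, R μ = X ^ N * S μ := by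
  choose S hS using fun μ => X_pow_dvd_iff.2 (hR μ)
  exact ⟨S, hS⟩

theorem sum_ED_eq_zero_of_X_pow_mul {S : Fin 4 → PowerSeries A}
    (h : ∑ μ, ED d k Φ C₀ C₁ μ (X ^ N * S μ) = 0) : ∑ μ, ED d k Φ C₀ C₁ μ (S μ) = 0 := by
  simp only [ED_X_pow_mul, ← mul_sum] at h
  ext n
  have := congrArg (coeff (n + N)) h
  rwa [coeff_X_pow_mul, map_zero] at this

/-- Once the common factor `X ^ N` is removed, only the fast derivatives cost a single power of `X`,
so they alone act at the lowest order. -/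
theorem coeff_one_sum_ED (hR : ∀ μ, ∀ n < N, coeff n (R μ) = 0)
    (h : ∑ μ, ED d k Φ C₀ C₁ μ (R μ) = 0) :
    ∑ i : Fin 3, k i • d 5 (coeff N (R i.castSucc)) + d 4 (coeff N (R 3)) = 0 := by
  obtain ⟨S, hS⟩ := exists_eq_X_pow_mul hR
  have hN : ∀ n μ, coeff (n + N) (R μ) = coeff n (S μ) := fun n μ => by rw [hS, coeff_X_pow_mul]
  have hN0 : ∀ μ, coeff N (R μ) = coeff 0 (S μ) := fun μ => by simpa using hN 0 μ
  simp only [hS] at h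
  have := congrArg (coeff 1) (sum_ED_eq_zero_of_X_pow_mul h)
  rw [sum_univ_castSucc_three, map_add, map_sum] at this
  simpa only [coeff_one_ED_castSucc, coeff_one_ED_last, map_zero, ← hN0] using this

/-- Next order: slow derivatives appear, together with the leading slope of the front acting through
`∂_{Y₃}`. -/
theorem coeff_two_sum_ED (hR : ∀ μ, ∀ n < N, coeff n (R μ) = 0)
    (h : ∑ μ, ED d k Φ C₀ C₁ μ (R μ) = 0) :
    ∑ i : Fin 3, (d (tan i) (coeff N (R i.castSucc)) + k i • d 5 (coeff (N + 1) (R i.castSucc))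
        - coeff 0 C₀ * (k i • d 5 (coeff 0 Φ)) * d 4 (coeff N (R i.castSucc)))
      + (d 3 (coeff N (R 3)) + d 4 (coeff (N + 1) (R 3))) = 0 := by
  obtain ⟨S, hS⟩ := exists_eq_X_pow_mul hR
  have hN : ∀ n μ, coeff (N + n) (R μ) = coeff n (S μ) := fun n μ => by
    rw [hS, add_comm, coeff_X_pow_mul]
  have hN0 : ∀ μ, coeff N (R μ) = coeff 0 (S μ) := fun μ => by simpa using hN 0 μ
  simp only [hS] at h
  have := congrArg (coeff 2) (sum_ED_eq_zero_of_X_pow_mul h)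
  rw [sum_univ_castSucc_three, map_add, map_sum] at this
  simpa only [coeff_two_ED_castSucc, coeff_two_ED_last, map_zero, ← hN0, ← hN] using this

/-- Without dependence on `Y₃` a normal derivative costs two powers of `X`. This is therefore the
order at which the slow divergence acts on coefficient `N + 1`, with just one front term and no
contribution of `C₁`. -/
theorem coeff_three_sum_ED (hR : ∀ μ, ∀ n < N, coeff n (R μ) = 0)
    (hR4 : ∀ μ n, d 4 (coeff n (R μ)) = 0) (h : ∑ μ, ED d k Φ C₀ C₁ μ (R μ) = 0) :
    ∑ i : Fin 3, (d (tan i) (coeff (N + 1) (R i.castSucc))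
        + k i • d 5 (coeff (N + 2) (R i.castSucc))
        - coeff 0 C₀ * (k i • d 5 (coeff 0 Φ)) * d 3 (coeff N (R i.castSucc)))
      + d 3 (coeff (N + 1) (R 3)) = 0 := by
  obtain ⟨S, hS⟩ := exists_eq_X_pow_mul hR
  have hN : ∀ n μ, coeff (N + n) (R μ) = coeff n (S μ) := fun n μ => by
    rw [hS, add_comm, coeff_X_pow_mul]
  have hN0 : ∀ μ, coeff N (R μ) = coeff 0 (S μ) := fun μ => by simpa using hN 0 μ
  have hS4 : ∀ μ n, d 4 (coeff n (S μ)) = 0 := fun μ n => by rw [← hN, hR4]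
  simp only [hS] at h
  have := congrArg (coeff 3) (sum_ED_eq_zero_of_X_pow_mul h)
  rw [sum_univ_castSucc_three, map_add, map_sum] at this
  simpa only [fun i : Fin 3 => coeff_three_ED_castSucc (d := d) (k := k) (Φ := Φ) (C₀ := C₀)
    (C₁ := C₁) (S i.castSucc) (hS4 _) i, coeff_three_ED_last _ (hS4 3), map_zero,
    ← hN0, ← hN] using this

/-- The tangential components of the conormal have no constant term, and their first coefficient is
the `θ`-slope of the leading front. -/
theorem coeff_succ_sum_conormal_mul (hR : ∀ μ, ∀ n < N, coeff n (R μ) = 0) :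
    coeff (N + 1) (∑ μ, conormal d k Φ μ * R μ)
      = coeff (N + 1) (R 3) - ∑ i : Fin 3, k i • d 5 (coeff 0 Φ) * coeff N (R i.castSucc) := by
  obtain ⟨S, hS⟩ := exists_eq_X_pow_mul hR
  have hN : ∀ n μ, coeff (N + n) (R μ) = coeff n (S μ) := fun n μ => by
    rw [hS, add_comm, coeff_X_pow_mul]
  have hN0 : ∀ μ, coeff N (R μ) = coeff 0 (S μ) := fun μ => by simpa using hN 0 μ
  have h1 : ∑ μ, conormal d k Φ μ * R μ = X ^ N * ∑ μ, conormal d k Φ μ * S μ := by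
    rw [mul_sum]
    exact sum_congr rfl fun μ _ => by rw [hS]; ring
  have c3 : conormal d k Φ 3 = 1 := rfl
  have ci : ∀ i : Fin 3, conormal d k Φ i.castSucc = -nab d k i Φ := fun i => by
    simp [conormal]
  rw [h1, add_comm N 1, coeff_X_pow_mul, sum_univ_castSucc_three, map_add, map_sum, c3, one_mul,
    add_comm 1 N, hN, add_comm, sub_eq_add_neg, ← sum_neg_distrib]
  congr 1
  refine sum_congr rfl fun i _ => ?_
  rw [ci, coeff_one_mul_eq, map_neg, map_neg, coeff_zero_nab, coeff_one_nab, hN0]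
  ring

end Straightened

end CurrentVortexSheet

namespace CurrentVortexSheet

/-! ### The ring of smooth functions on a domain -/

/-- The parameters of a domain `0 ≤ t ≤ T`, `0 ≤ ± y₃ ≤ a`, `± Y₃ ≥ 0`. -/
structure Box where
  T : ℝ
  T_pos : 0 < T
  s : Side
  a : ℝ
  a_pos : 0 < a

theorem Side.sgn_mul_self (s : Side) : s.sgn * s.sgn = 1 := by
  cases s <;> simp [Side.sgn]

namespace Box

variable (B : Box)

/-- The domain `0 ≤ t ≤ T`, `0 ≤ ± y₃ ≤ a`, `± Y₃ ≥ 0`. -/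
def set : Set Pt :=
  {x | x 0 ∈ Set.Icc 0 B.T ∧ B.s.sgn * x 3 ∈ Set.Icc 0 B.a ∧ 0 ≤ B.s.sgn * x 4}

theorem convex_set : Convex ℝ B.set := by
  have h0 : Convex ℝ {x : Pt | x 0 ∈ Set.Icc 0 B.T} :=
    (convex_Icc (0 : ℝ) B.T).linear_preimage (LinearMap.proj (R := ℝ) (φ := fun _ : Fin 6 => ℝ) 0)
  have h3 : Convex ℝ {x : Pt | B.s.sgn * x 3 ∈ Set.Icc 0 B.a} :=
    (convex_Icc (0 : ℝ) B.a).linear_preimage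
      (B.s.sgn • LinearMap.proj (R := ℝ) (φ := fun _ : Fin 6 => ℝ) 3)
  have h4 : Convex ℝ {x : Pt | 0 ≤ B.s.sgn * x 4} :=
    (convex_Ici (0 : ℝ)).linear_preimage
      (B.s.sgn • LinearMap.proj (R := ℝ) (φ := fun _ : Fin 6 => ℝ) 4)
  exact h0.inter (h3.inter h4)

theorem interior_set_nonempty : (interior B.set).Nonempty := by
  let U : Set Pt := {x | x 0 ∈ Set.Ioo 0 B.T ∧ B.s.sgn * x 3 ∈ Set.Ioo 0 B.a ∧ 0 < B.s.sgn * x 4}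
  have hU : IsOpen U := by
    refine (isOpen_Ioo.preimage (continuous_apply 0)).inter
      ((isOpen_Ioo.preimage (continuous_const.mul (continuous_apply 3))).inter ?_)
    exact isOpen_Ioi.preimage (continuous_const.mul (continuous_apply 4))
  have hUB : U ⊆ B.set := fun x hx =>
    ⟨Set.Ioo_subset_Icc_self hx.1, Set.Ioo_subset_Icc_self hx.2.1, hx.2.2.le⟩
  -- The factors `B.s.sgn` place the point on the correct side in both normal variables.
  refine ⟨![B.T / 2, 0, 0, B.s.sgn * (B.a / 2), B.s.sgn, 0], interior_maximal hUB hU ?_⟩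
  have hT := B.T_pos
  have ha := B.a_pos
  refine ⟨⟨?_, ?_⟩, ?_, ?_⟩
  · simpa using hT
  · simpa using hT
  · simp only [Matrix.cons_val, ← mul_assoc, Side.sgn_mul_self, one_mul]
    exact ⟨by linarith, by linarith⟩
  · simp only [Matrix.cons_val, Side.sgn_mul_self]
    norm_num

theorem uniqueDiffOn : UniqueDiffOn ℝ B.set :=
  uniqueDiffOn_convex B.convex_set B.interior_set_nonempty

theorem mem_closure_interior {x : Pt} (hx : x ∈ B.set) : x ∈ closure (interior B.set) :=
  (Convex.closure_interior_eq_closure_of_nonempty_interior B.convex_set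
    B.interior_set_nonempty).symm ▸ subset_closure hx

variable {B}

theorem update_mem {x : Pt} (hx : x ∈ B.set) {i : Fin 6} (h0 : i ≠ 0) (h3 : i ≠ 3) (h4 : i ≠ 4)
    (r : ℝ) : Function.update x i r ∈ B.set := by
  refine ⟨?_, ?_, ?_⟩
  · rw [Function.update_of_ne h0.symm]; exact hx.1
  · rw [Function.update_of_ne h3.symm]; exact hx.2.1
  · rw [Function.update_of_ne h4.symm]; exact hx.2.2

theorem update_five_mem {x : Pt} (hx : x ∈ B.set) (r : ℝ) : Function.update x 5 r ∈ B.set :=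
  update_mem hx (by decide) (by decide) (by decide) r

theorem update_four_mem {x : Pt} (hx : x ∈ B.set) {r : ℝ} (hr : 0 ≤ r) :
    Function.update x 4 (B.s.sgn * r) ∈ B.set := by
  refine ⟨?_, ?_, ?_⟩
  · rw [Function.update_of_ne (by decide)]; exact hx.1
  · rw [Function.update_of_ne (by decide)]; exact hx.2.1
  · rw [Function.update_self, ← mul_assoc, Side.sgn_mul_self, one_mul]; exact hr

variable (B)

/-- Extension by zero. -/
noncomputable def ext (f : B.set → ℝ) : Pt → ℝ := Function.extend Subtype.val f 0

variable {B}

theorem ext_apply (f : B.set → ℝ) {x : Pt} (hx : x ∈ B.set) : B.ext f x = f ⟨x, hx⟩ :=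
  Subtype.val_injective.extend_apply f 0 ⟨x, hx⟩

variable (B)

/-- The algebra of smooth functions on the domain that are `2π`-periodic in `θ`. -/
noncomputable def fnAlg : Subalgebra ℝ (B.set → ℝ) where
  carrier := {f | ContDiffOn ℝ ∞ (B.ext f) B.set ∧
    ∀ x ∈ B.set, B.ext f (Function.update x 5 (x 5 + 2 * Real.pi)) = B.ext f x}
  mul_mem' {f g} hf hg := by
    refine ⟨(hf.1.mul hg.1).congr fun x hx => ?_, fun x hx => ?_⟩
    · simp [ext_apply _ hx]
    · have h1 := hf.2 x hx
      have h2 := hg.2 x hx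
      rw [ext_apply _ hx, ext_apply _ (update_five_mem hx _)] at h1 h2 ⊢
      rw [Pi.mul_apply, Pi.mul_apply, h1, h2]
  add_mem' {f g} hf hg := by
    refine ⟨(hf.1.add hg.1).congr fun x hx => ?_, fun x hx => ?_⟩
    · simp [ext_apply _ hx]
    · have h1 := hf.2 x hx
      have h2 := hg.2 x hx
      rw [ext_apply _ hx, ext_apply _ (update_five_mem hx _)] at h1 h2 ⊢
      rw [Pi.add_apply, Pi.add_apply, h1, h2]
  algebraMap_mem' c := by
    refine ⟨(contDiffOn_const (c := c)).congr fun x hx => ?_, fun x hx => ?_⟩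
    · simp [ext_apply _ hx]
    · rw [ext_apply _ hx, ext_apply _ (update_five_mem hx _)]
      rfl

/-- The type of smooth functions on the domain that are `2π`-periodic in `θ`. -/
def Fn : Type := B.fnAlg

noncomputable instance : CommRing B.Fn := inferInstanceAs (CommRing B.fnAlg)

noncomputable instance : Algebra ℝ B.Fn := inferInstanceAs (Algebra ℝ B.fnAlg)

variable {B}

/-- The function on the whole space, extended by zero. -/
noncomputable def Fn.fn (f : B.Fn) : Pt → ℝ := B.ext (Subtype.val f)

namespace Fn

theorem smooth (f : B.Fn) : ContDiffOn ℝ ∞ f.fn B.set := (Subtype.property f).1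

theorem periodic (f : B.Fn) {x : Pt} (hx : x ∈ B.set) :
    f.fn (Function.update x 5 (x 5 + 2 * Real.pi)) = f.fn x := (Subtype.property f).2 x hx

theorem differentiableWithinAt (f : B.Fn) {x : Pt} (hx : x ∈ B.set) :
    DifferentiableWithinAt ℝ f.fn B.set x :=
  (f.smooth x hx).differentiableWithinAt (by simp)

theorem continuousOn (f : B.Fn) : ContinuousOn f.fn B.set := f.smooth.continuousOn

theorem ext_iff_fn {f g : B.Fn} : f = g ↔ ∀ x ∈ B.set, f.fn x = g.fn x := by
  refine ⟨fun h x _ => by rw [h], fun h => Subtype.ext (funext fun x => ?_)⟩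
  have := h x x.2
  rwa [fn, fn, ext_apply _ x.2, ext_apply _ x.2] at this

/-- Evaluation at a point of the domain. -/
noncomputable def eval (x : B.set) : B.Fn →ₐ[ℝ] ℝ :=
  (Pi.evalAlgHom ℝ (fun _ : B.set => ℝ) x).comp B.fnAlg.val

theorem eval_eq_fn (x : B.set) (f : B.Fn) : eval x f = f.fn x := by
  rw [fn, ext_apply _ x.2]; rfl

/-- A smooth periodic function as an element of the algebra. -/
noncomputable def mk (f : Pt → ℝ) (hf : ContDiffOn ℝ ∞ f B.set)
    (hp : ∀ x, f (Function.update x 5 (x 5 + 2 * Real.pi)) = f x) : B.Fn :=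
  Subtype.mk (fun x => f x) ⟨hf.congr fun x hx => ext_apply _ hx, fun x hx => by
    rw [ext_apply _ hx, ext_apply _ (update_five_mem hx _)]; exact hp x⟩

theorem fn_mk {f : Pt → ℝ} (hf : ContDiffOn ℝ ∞ f B.set)
    (hp : ∀ x, f (Function.update x 5 (x 5 + 2 * Real.pi)) = f x) {x : Pt} (hx : x ∈ B.set) :
    (mk f hf hp).fn x = f x := ext_apply _ hx

theorem fn_add (f g : B.Fn) {x : Pt} (hx : x ∈ B.set) : (f + g).fn x = f.fn x + g.fn x := by
  rw [← eval_eq_fn ⟨x, hx⟩, map_add, eval_eq_fn, eval_eq_fn]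

theorem fn_sub (f g : B.Fn) {x : Pt} (hx : x ∈ B.set) : (f - g).fn x = f.fn x - g.fn x := by
  rw [← eval_eq_fn ⟨x, hx⟩, map_sub, eval_eq_fn, eval_eq_fn]

theorem fn_mul (f g : B.Fn) {x : Pt} (hx : x ∈ B.set) : (f * g).fn x = f.fn x * g.fn x := by
  rw [← eval_eq_fn ⟨x, hx⟩, map_mul, eval_eq_fn, eval_eq_fn]

theorem fn_smul (c : ℝ) (f : B.Fn) {x : Pt} (hx : x ∈ B.set) : (c • f).fn x = c * f.fn x := by
  rw [← eval_eq_fn ⟨x, hx⟩, map_smul, eval_eq_fn]; rfl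

theorem fn_zero {x : Pt} (hx : x ∈ B.set) : (0 : B.Fn).fn x = 0 := by
  rw [← eval_eq_fn ⟨x, hx⟩, map_zero]

theorem fn_sum {ι : Type*} (t : Finset ι) (f : ι → B.Fn) {x : Pt} (hx : x ∈ B.set) :
    (∑ i ∈ t, f i).fn x = ∑ i ∈ t, (f i).fn x := by
  rw [← eval_eq_fn ⟨x, hx⟩, map_sum]
  simp only [eval_eq_fn]

end Fn

theorem pd_congr {D : Set Pt} {i : Fin 6} {f g : Pt → ℝ} (h : ∀ y ∈ D, f y = g y) {x : Pt}
    (hx : x ∈ D) : pd D i f x = pd D i g x := by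
  rw [pd, pd, fderivWithin_congr h (h x hx)]

theorem contDiffOn_pd {D : Set Pt} (hD : UniqueDiffOn ℝ D) {f : Pt → ℝ}
    (hf : ContDiffOn ℝ ∞ f D) (i : Fin 6) : ContDiffOn ℝ ∞ (pd D i f) D :=
  (hf.fderivWithin hD (by simp)).clm_apply contDiffOn_const

theorem update_eq_add (x : Pt) (i : Fin 6) (r : ℝ) :
    Function.update x i (x i + r) = x + Pi.single i r := by
  ext j
  by_cases h : j = i
  · subst h; simp
  · simp [h]

theorem fderivWithin_add_const_eq {D : Set Pt} (hD : UniqueDiffOn ℝ D) {f : Pt → ℝ} {v : Pt}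
    (hmap : ∀ y ∈ D, y + v ∈ D) (hf : ∀ y ∈ D, f (y + v) = f y) {x : Pt} (hx : x ∈ D)
    (hdiff : DifferentiableWithinAt ℝ f D (x + v)) :
    fderivWithin ℝ f D (x + v) = fderivWithin ℝ f D x := by
  have h1 := hdiff.hasFDerivWithinAt.comp x
    (((hasFDerivAt_id x).add_const v).hasFDerivWithinAt (s := D)) (fun y hy => hmap y hy)
  have h2 := h1.congr (f₁ := f) (fun y hy => (hf y hy).symm) (hf x hx).symm
  rw [h2.fderivWithin (hD x hx)]
  ext; simp

variable (B) in
/-- Partial derivative number `i` as a derivation. -/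
noncomputable def der (i : Fin 6) : Derivation ℝ B.Fn B.Fn :=
  Derivation.mk'
    { toFun := fun f => Subtype.mk (fun x => pd B.set i f.fn x)
        ⟨(contDiffOn_pd B.uniqueDiffOn f.smooth i).congr fun x hx => ext_apply _ hx,
        fun x hx => by
          rw [ext_apply _ hx, ext_apply _ (update_five_mem hx _)]
          simp only [pd, update_eq_add]
          rw [fderivWithin_add_const_eq B.uniqueDiffOn
            (fun y hy => by rw [← update_eq_add]; exact update_five_mem hy _)
            (fun y hy => by rw [← update_eq_add]; exact f.periodic hy) hx
            (f.differentiableWithinAt (by rw [← update_eq_add]; exact update_five_mem hx _))]⟩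
      map_add' := fun f g => by
        refine Subtype.ext (funext fun x => ?_)
        change pd B.set i (f + g).fn x = pd B.set i f.fn x + pd B.set i g.fn x
        rw [pd_congr (fun y hy => Fn.fn_add f g hy) x.2, pd,
          fderivWithin_fun_add (B.uniqueDiffOn x x.2) (f.differentiableWithinAt x.2)
            (g.differentiableWithinAt x.2)]
        rfl
      map_smul' := fun c f => by
        refine Subtype.ext (funext fun x => ?_)
        change pd B.set i (c • f).fn x = c * pd B.set i f.fn x
        rw [pd_congr (fun y hy => Fn.fn_smul c f hy) x.2, pd,
          fderivWithin_const_mul (B.uniqueDiffOn x x.2) (f.differentiableWithinAt x.2)]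
        rfl }
    (fun f g => by
      refine Subtype.ext (funext fun x => ?_)
      change pd B.set i (f * g).fn x
        = (Subtype.val f) x * pd B.set i g.fn x + (Subtype.val g) x * pd B.set i f.fn x
      rw [pd_congr (fun y hy => Fn.fn_mul f g hy) x.2, pd,
        fderivWithin_fun_mul (B.uniqueDiffOn x x.2) (f.differentiableWithinAt x.2)
          (g.differentiableWithinAt x.2), Fn.fn, Fn.fn, ext_apply _ x.2, ext_apply _ x.2]
      rfl)

theorem fn_der (i : Fin 6) (f : B.Fn) {x : Pt} (hx : x ∈ B.set) :
    (B.der i f).fn x = pd B.set i f.fn x := ext_apply _ hx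

/-- Symmetry of second derivatives holds up to the boundary since every point of the box is a limit
of interior points. -/
theorem der_comm (i j : Fin 6) (f : B.Fn) : B.der i (B.der j f) = B.der j (B.der i f) := by
  rw [Fn.ext_iff_fn]
  intro x hx
  have hd : DifferentiableWithinAt ℝ (fderivWithin ℝ f.fn B.set) B.set x :=
    ((f.smooth.fderivWithin (m := ∞) B.uniqueDiffOn (by simp)) x hx).differentiableWithinAt
      (by simp)
  have h2 : ∀ i j : Fin 6, (B.der i (B.der j f)).fn x
      = fderivWithin ℝ (fderivWithin ℝ f.fn B.set) B.set x (Pi.single i 1) (Pi.single j 1) := by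
    intro i j
    rw [fn_der _ _ hx, pd_congr (fun y hy => fn_der j f hy) hx, pd]
    unfold pd
    rw [fderivWithin_clm_apply (B.uniqueDiffOn x hx) hd (differentiableWithinAt_const _)]
    simp
  rw [h2, h2]
  exact ((f.smooth x hx).isSymmSndFDerivWithinAt
    (by simpa using WithTop.coe_le_coe.2 (le_top : (2 : ℕ∞) ≤ ⊤)) B.uniqueDiffOn
    (B.mem_closure_interior hx) hx).eq _ _

end Box

end CurrentVortexSheet

namespace CurrentVortexSheet

namespace Box

open Filter Topology

variable {B : Box}

/-! ### Averages over `θ` -/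

theorem continuous_update_five (x : Pt) : Continuous fun θ : ℝ => Function.update x 5 θ :=
  continuous_const.update 5 continuous_id

theorem Fn.continuous_five (f : B.Fn) {x : Pt} (hx : x ∈ B.set) :
    Continuous fun θ : ℝ => f.fn (Function.update x 5 θ) :=
  f.continuousOn.comp_continuous (continuous_update_five x) fun _ => update_five_mem hx _

/-- The mean in `θ` at a point, as a linear form. -/
noncomputable def avg (x : B.set) : B.Fn →ₗ[ℝ] ℝ where
  toFun f := mean f.fn x
  map_add' f g := by
    simp only [mean]
    rw [← mul_add, ← intervalIntegral.integral_add
      ((f.continuous_five x.2).intervalIntegrable _ _)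
      ((g.continuous_five x.2).intervalIntegrable _ _)]
    simp only [Fn.fn_add f g (update_five_mem x.2 _)]
  map_smul' c f := by
    simp only [mean, Fn.fn_smul c f (update_five_mem x.2 _), intervalIntegral.integral_const_mul,
      RingHom.id_apply, smul_eq_mul]
    ring

theorem avg_eq_mean (x : B.set) (f : B.Fn) : avg x f = mean f.fn x := rfl

theorem mean_congr {f g : Pt → ℝ} {x : Pt}
    (h : ∀ θ, f (Function.update x 5 θ) = g (Function.update x 5 θ)) : mean f x = mean g x := by
  simp only [mean, h]

/-- The derivative of a smooth function along a coordinate line. -/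
theorem Fn.hasDerivWithinAt_update (f : B.Fn) {x : Pt} {i : Fin 6} {S : Set ℝ}
    (hS : ∀ r ∈ S, Function.update x i r ∈ B.set) {r : ℝ} (hr : r ∈ S) :
    HasDerivWithinAt (fun r => f.fn (Function.update x i r))
      ((B.der i f).fn (Function.update x i r)) S r := by
  rw [fn_der i f (hS r hr)]
  exact (f.differentiableWithinAt (hS r hr)).hasFDerivWithinAt.comp_hasDerivWithinAt r
    (hasDerivAt_update x i r).hasDerivWithinAt hS

/-- The integral over one period is a difference of values at `2π` and `0`, which agree by
periodicity. -/
theorem avg_der_five (x : B.set) (f : B.Fn) : avg x (B.der 5 f) = 0 := by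
  have h : ∫ θ in (0 : ℝ)..(2 * Real.pi), (B.der 5 f).fn (Function.update (x : Pt) 5 θ)
      = f.fn (Function.update (x : Pt) 5 (2 * Real.pi)) - f.fn (Function.update (x : Pt) 5 0) :=
    intervalIntegral.integral_eq_sub_of_hasDerivAt
      (fun θ _ => (f.hasDerivWithinAt_update (S := Set.univ)
        (fun r _ => update_five_mem x.2 r) (Set.mem_univ θ)).hasDerivAt univ_mem)
      (((B.der 5 f).continuous_five x.2).intervalIntegrable _ _)
  have hp := f.periodic (update_five_mem x.2 0)
  rw [Function.update_idem, Function.update_self, zero_add] at hp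
  rw [avg_eq_mean, mean, h, hp, sub_self, mul_zero]

/-- A smooth function whose derivative along a coordinate vanishes is constant on the segments in
that direction. -/
theorem fn_update_eq_of_der_eq_zero {f : B.Fn} {x : Pt} {i : Fin 6} (h : B.der i f = 0)
    {S : Set ℝ} (hSc : Convex ℝ S) (hS : ∀ r ∈ S, Function.update x i r ∈ B.set)
    {r r' : ℝ} (hr : r ∈ S) (hr' : r' ∈ S) :
    f.fn (Function.update x i r) = f.fn (Function.update x i r') := by
  have := hSc.norm_image_sub_le_of_norm_hasDerivWithin_le (C := 0)
    (fun ρ hρ => f.hasDerivWithinAt_update hS hρ)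
    (fun ρ hρ => by rw [h, Fn.fn_zero (hS ρ hρ), norm_zero]) hr' hr
  rw [zero_mul, norm_le_zero_iff, sub_eq_zero] at this
  exact this

theorem avg_eq_fn {f : B.Fn} (h : B.der 5 f = 0) (x : B.set) : avg x f = f.fn x := by
  have hc : ∀ θ, f.fn (Function.update (x : Pt) 5 θ) = f.fn x := fun θ => by
    rw [fn_update_eq_of_der_eq_zero h convex_univ (fun r _ => update_five_mem x.2 r)
      (Set.mem_univ θ) (Set.mem_univ ((x : Pt) 5)), Function.update_eq_self]
  rw [avg_eq_mean, mean]
  simp only [hc, intervalIntegral.integral_const, sub_zero, smul_eq_mul]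
  rw [← mul_assoc, inv_mul_cancel₀ (by positivity), one_mul]

/-- The projection that kills the coordinate `θ`. -/
noncomputable def killFive : Pt →L[ℝ] Pt :=
  ContinuousLinearMap.pi fun j => if j = 5 then 0 else ContinuousLinearMap.proj j

theorem killFive_single {i : Fin 6} (hi : i ≠ 5) :
    killFive (Pi.single i 1) = Pi.single i (1 : ℝ) := by
  ext j
  by_cases hj : j = 5
  · subst hj; simp [killFive, hi.symm]
  · simp [killFive, hj]

theorem hasFDerivAt_update_five (θ : ℝ) (x : Pt) :
    HasFDerivAt (fun y : Pt => Function.update y 5 θ) killFive x := by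
  rw [hasFDerivAt_pi']
  intro j
  by_cases hj : j = 5
  · subst hj
    simpa [killFive, ContinuousLinearMap.proj_pi] using hasFDerivAt_const θ x
  · simpa [killFive, hj, ContinuousLinearMap.proj_pi] using
      hasFDerivAt_apply (𝕜 := ℝ) (F' := fun _ : Fin 6 => ℝ) j x

/-- Differentiation under the integral sign in a closed convex domain. -/
theorem Fn.hasFDerivWithinAt_mean (f : B.Fn) {x : Pt} (hx : x ∈ B.set) :
    HasFDerivWithinAt (mean f.fn) ((2 * Real.pi)⁻¹ • ∫ θ in (0 : ℝ)..(2 * Real.pi),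
      (fderivWithin ℝ f.fn B.set (Function.update x 5 θ)).comp killFive) B.set x := by
  set G : Pt → ℝ → Pt →L[ℝ] ℝ := fun z θ =>
    (fderivWithin ℝ f.fn B.set (Function.update z 5 θ)).comp killFive with hG
  have hupd : Continuous fun p : Pt × ℝ => Function.update p.1 5 p.2 :=
    continuous_fst.update 5 continuous_snd
  have hGc : ContinuousOn (fun p : Pt × ℝ => G p.1 p.2) (B.set ×ˢ Set.univ) := by
    have h1 : ContinuousOn (fderivWithin ℝ f.fn B.set) B.set :=
      (f.smooth.fderivWithin (m := ∞) B.uniqueDiffOn (by simp)).continuousOn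
    exact (h1.comp hupd.continuousOn fun p hp => update_five_mem hp.1 _).clm_comp
      continuousOn_const
  have hGx : Continuous (G x) :=
    hGc.comp_continuous (continuous_const.prodMk continuous_id) fun θ => ⟨hx, Set.mem_univ _⟩
  refine HasFDerivWithinAt.of_isLittleO (Asymptotics.isLittleO_iff.2 fun c hc => ?_)
  -- Compactness of `[0, 2π]` makes the continuity of the differential at `x` uniform in `θ`. The
  -- mean value inequality on the convex intersection of the box with a ball then bounds the
  -- increments uniformly in `θ`.
  have hev : ∀ᶠ z in 𝓝 x, ∀ θ ∈ Set.Icc (0 : ℝ) (2 * Real.pi), z ∈ B.set →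
      ‖G z θ - G x θ‖ ≤ c := by
    refine isCompact_Icc.eventually_forall_of_forall_eventually fun θ _ => ?_
    have h1 : ContinuousWithinAt (fun p : Pt × ℝ => ‖G p.1 p.2 - G x p.2‖) (B.set ×ˢ Set.univ)
        (x, θ) :=
      ((hGc (x, θ) ⟨hx, Set.mem_univ _⟩).sub
        (hGx.comp continuous_snd).continuousWithinAt).norm
    have h2 := h1.tendsto.eventually (eventually_le_nhds (b := c) (by simpa using hc))
    rw [eventually_nhdsWithin_iff] at h2
    filter_upwards [h2] with p hp hpB
    exact hp ⟨hpB, Set.mem_univ _⟩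
  obtain ⟨δ, hδ, hball⟩ := Metric.eventually_nhds_iff_ball.1 hev
  filter_upwards [inter_mem_nhdsWithin B.set (Metric.ball_mem_nhds x hδ)] with y hy
  have hle : ∀ θ ∈ Set.Icc (0 : ℝ) (2 * Real.pi),
      ‖f.fn (Function.update y 5 θ) - f.fn (Function.update x 5 θ) - G x θ (y - x)‖
        ≤ c * ‖y - x‖ := by
    intro θ hθ
    refine Convex.norm_image_sub_le_of_norm_hasFDerivWithin_le'
      (f := fun z => f.fn (Function.update z 5 θ)) (f' := fun z => G z θ)
      (s := B.set ∩ Metric.ball x δ) (fun z hz => ?_) (fun z hz => hball z hz.2 θ hθ hz.1)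
      (B.convex_set.inter (convex_ball x δ)) ⟨hx, Metric.mem_ball_self hδ⟩ hy
    exact ((f.differentiableWithinAt (update_five_mem hz.1 θ)).hasFDerivWithinAt.comp z
      (hasFDerivAt_update_five θ z).hasFDerivWithinAt
      (fun w hw => update_five_mem hw θ)).mono Set.inter_subset_left
  have hint : mean f.fn y - mean f.fn x - ((2 * Real.pi)⁻¹ •
        ∫ θ in (0 : ℝ)..(2 * Real.pi), G x θ) (y - x)
      = (2 * Real.pi)⁻¹ * ∫ θ in (0 : ℝ)..(2 * Real.pi),
        (f.fn (Function.update y 5 θ) - f.fn (Function.update x 5 θ) - G x θ (y - x)) := by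
    have i1 := (f.continuous_five hy.1).intervalIntegrable (μ := MeasureTheory.volume)
      0 (2 * Real.pi)
    have i2 := (f.continuous_five hx).intervalIntegrable (μ := MeasureTheory.volume)
      0 (2 * Real.pi)
    have i3 := (hGx.clm_apply continuous_const (g := fun _ => y - x)).intervalIntegrable
      (μ := MeasureTheory.volume) 0 (2 * Real.pi)
    rw [intervalIntegral.integral_sub (i1.sub i2) i3, intervalIntegral.integral_sub i1 i2,
      _root_.smul_apply, ContinuousLinearMap.intervalIntegral_apply
        (hGx.intervalIntegrable _ _), smul_eq_mul, mean, mean]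
    ring
  rw [hint, norm_mul]
  have hn := intervalIntegral.norm_integral_le_of_norm_le_const (a := 0) (b := 2 * Real.pi)
    (f := fun θ => f.fn (Function.update y 5 θ) - f.fn (Function.update x 5 θ) - G x θ (y - x))
    (C := c * ‖y - x‖) (fun θ hθ => by
      rw [Set.uIoc_of_le (by positivity)] at hθ
      exact hle θ (Set.Ioc_subset_Icc_self hθ))
  have hpi : (0 : ℝ) < 2 * Real.pi := by positivity
  rw [sub_zero, abs_of_pos hpi] at hn
  rw [Real.norm_of_nonneg (by positivity)]
  calc (2 * Real.pi)⁻¹ * _ ≤ (2 * Real.pi)⁻¹ * (c * ‖y - x‖ * (2 * Real.pi)) := by gcongr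
    _ = c * ‖y - x‖ := by field_simp

theorem Fn.differentiableWithinAt_mean (f : B.Fn) {x : Pt} (hx : x ∈ B.set) :
    DifferentiableWithinAt ℝ (mean f.fn) B.set x :=
  (f.hasFDerivWithinAt_mean hx).differentiableWithinAt

theorem Fn.pd_mean (f : B.Fn) {i : Fin 6} (hi : i ≠ 5) (x : B.set) :
    pd B.set i (mean f.fn) x = avg x (B.der i f) := by
  rw [pd, (f.hasFDerivWithinAt_mean x.2).fderivWithin (B.uniqueDiffOn x x.2),
    _root_.smul_apply, ContinuousLinearMap.intervalIntegral_apply, avg_eq_mean, mean,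
    smul_eq_mul]
  · congr 1
    refine intervalIntegral.integral_congr fun θ _ => ?_
    simp only [ContinuousLinearMap.comp_apply, killFive_single hi]
    exact (fn_der i f (update_five_mem x.2 θ)).symm
  · have h1 : ContinuousOn (fderivWithin ℝ f.fn B.set) B.set :=
      (f.smooth.fderivWithin (m := ∞) B.uniqueDiffOn (by simp)).continuousOn
    exact ((h1.comp_continuous (continuous_update_five x) fun θ => update_five_mem x.2 θ).clm_comp
      continuous_const).intervalIntegrable _ _

variable (B) in
/-- The functions with zero mean in `θ`. -/
noncomputable def meanZero : Submodule ℝ B.Fn := ⨅ x : B.set, LinearMap.ker (avg x)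

theorem mem_meanZero {f : B.Fn} : f ∈ B.meanZero ↔ ∀ x : B.set, avg x f = 0 := by
  simp [meanZero]

theorem der_five_mem_meanZero (f : B.Fn) : B.der 5 f ∈ B.meanZero :=
  mem_meanZero.2 fun x => avg_der_five x f

theorem der_mem_meanZero {f : B.Fn} (hf : f ∈ B.meanZero) {i : Fin 6} (hi : i ≠ 5) :
    B.der i f ∈ B.meanZero := by
  refine mem_meanZero.2 fun x => ?_
  rw [← f.pd_mean hi x, pd_congr (g := fun _ => (0 : ℝ))
    (fun y hy => mem_meanZero.1 hf ⟨y, hy⟩) x.2]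
  simp [pd]

/-! ### Behaviour as `Y₃ → ±∞` -/

/-- A compact interval that contains `[0, 2π]` and the coordinate `θ` of a point. -/
def angles (x : Pt) : Set ℝ := Set.Icc (-|x 5|) (2 * Real.pi + |x 5|)

theorem mem_angles_self (x : Pt) : x 5 ∈ angles x :=
  ⟨neg_abs_le _, (le_abs_self _).trans (le_add_of_nonneg_left (by positivity))⟩

theorem Icc_subset_angles (x : Pt) : Set.Icc 0 (2 * Real.pi) ⊆ angles x :=
  Set.Icc_subset_Icc (by simp) (by simp)

/-- The filter `|Y₃| → ∞`, uniformly in `θ`. -/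
def farFilter (x : Pt) : Filter (ℝ × ℝ) := atTop ×ˢ 𝓟 (angles x)

/-- The point obtained by replacing `|Y₃|` and `θ`. -/
def farPt (x : B.set) (p : ℝ × ℝ) : Pt :=
  Function.update (Function.update (x : Pt) 5 p.2) 4 (B.s.sgn * p.1)

theorem eventually_farFilter (x : Pt) : ∀ᶠ p in farFilter x, 0 ≤ p.1 ∧ p.2 ∈ angles x := by
  rw [farFilter, eventually_prod_principal_iff]
  filter_upwards [eventually_ge_atTop 0] with r hr θ hθ
  exact ⟨hr, hθ⟩

theorem farPt_mem (x : B.set) {p : ℝ × ℝ} (hp : 0 ≤ p.1) : farPt x p ∈ B.set :=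
  update_four_mem (update_five_mem x.2 _) hp

theorem eventually_farPt_mem (x : B.set) : ∀ᶠ p in farFilter x, farPt x p ∈ B.set :=
  (eventually_farFilter (x : Pt)).mono fun _ hp => farPt_mem x hp.1

/-- `f` and `g` are bounded, with the same behaviour, as `Y₃ → ±∞`. -/
def FarEq (f g : B.Fn) : Prop := ∀ x : B.set,
  (fun p => g.fn (farPt x p)) =O[farFilter x] (fun _ => (1 : ℝ)) ∧
  (fun p => f.fn (farPt x p) - g.fn (farPt x p)) =o[farFilter x] (fun _ => (1 : ℝ))

theorem convex_ray (s : Side) : Convex ℝ {r : ℝ | 0 ≤ s.sgn * r} :=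
  (convex_Ici (0 : ℝ)).linear_preimage (s.sgn • (LinearMap.id : ℝ →ₗ[ℝ] ℝ))

/-- A function with vanishing derivative in `Y₃` does not depend on `Y₃`. -/
theorem fn_farPt_eq {f : B.Fn} (h : B.der 4 f = 0) (x : B.set) (θ : ℝ) {r r' : ℝ} (hr : 0 ≤ r)
    (hr' : 0 ≤ r') : f.fn (farPt x (r, θ)) = f.fn (farPt x (r', θ)) := by
  have hS : ∀ r ∈ {r : ℝ | 0 ≤ B.s.sgn * r},
      Function.update (Function.update (x : Pt) 5 θ) 4 r ∈ B.set := fun r hr => by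
    have := update_four_mem (update_five_mem x.2 θ) (B := B) hr
    rwa [← mul_assoc, Side.sgn_mul_self, one_mul] at this
  exact fn_update_eq_of_der_eq_zero h (S := {r : ℝ | 0 ≤ B.s.sgn * r})
    (convex_ray B.s) hS
    (by simpa [← mul_assoc, Side.sgn_mul_self] using hr)
    (by simpa [← mul_assoc, Side.sgn_mul_self] using hr')

theorem farPt_self (x : B.set) : farPt x (B.s.sgn * (x : Pt) 4, (x : Pt) 5) = x := by
  rw [farPt, ← mul_assoc, Side.sgn_mul_self, one_mul, Function.update_eq_self,
    Function.update_eq_self]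

namespace FarEq

theorem add {f g f' g' : B.Fn} (h : FarEq f g) (h' : FarEq f' g') : FarEq (f + f') (g + g') :=
  fun x => by
    refine ⟨((h x).1.add (h' x).1).congr' ?_ .rfl, ((h x).2.add (h' x).2).congr' ?_ .rfl⟩ <;>
    · filter_upwards [eventually_farPt_mem x] with p hp
      simp only [Fn.fn_add _ _ hp]
      try ring

theorem mul {f g f' g' : B.Fn} (h : FarEq f g) (h' : FarEq f' g') : FarEq (f * f') (g * g') :=
  fun x => by
    have h1 := (h x).1.mul (h' x).1
    have h2 := (((h x).2.mul_isBigO (h' x).2.isBigO).add ((h x).2.mul_isBigO (h' x).1)).add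
      ((h x).1.mul_isLittleO (h' x).2)
    simp only [mul_one] at h1 h2
    refine ⟨h1.congr' ?_ .rfl, h2.congr' ?_ .rfl⟩ <;>
    · filter_upwards [eventually_farPt_mem x] with p hp
      simp only [Fn.fn_mul _ _ hp]
      try ring

theorem smul {f g : B.Fn} (c : ℝ) (h : FarEq f g) : FarEq (c • f) (c • g) := fun x => by
  refine ⟨((h x).1.const_mul_left c).congr' ?_ .rfl, ((h x).2.const_mul_left c).congr' ?_ .rfl⟩ <;>
  · filter_upwards [eventually_farPt_mem x] with p hp
    simp only [Fn.fn_smul _ _ hp]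
    try ring

theorem zero : FarEq (0 : B.Fn) 0 := fun x => by
  refine ⟨(Asymptotics.isBigO_zero _ _).congr' ?_ .rfl,
    (Asymptotics.isLittleO_zero _ _).congr' ?_ .rfl⟩ <;>
  · filter_upwards [eventually_farPt_mem x] with p hp
    simp only [Fn.fn_zero hp, sub_zero]

theorem neg {f g : B.Fn} (h : FarEq f g) : FarEq (-f) (-g) := by
  simpa using h.smul (-1)

theorem sub {f g f' g' : B.Fn} (h : FarEq f g) (h' : FarEq f' g') : FarEq (f - f') (g - g') := by
  simpa [sub_eq_add_neg] using h.add h'.neg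

theorem sum {ι : Type*} (t : Finset ι) {f g : ι → B.Fn} (h : ∀ i ∈ t, FarEq (f i) (g i)) :
    FarEq (∑ i ∈ t, f i) (∑ i ∈ t, g i) := by
  classical
  induction t using Finset.induction with
  | empty => simpa using zero
  | insert i t hi ih =>
    rw [sum_insert hi, sum_insert hi]
    exact (h i (mem_insert_self i t)).add (ih fun j hj => h j (mem_insert_of_mem hj))

theorem sub_zero_left {f g : B.Fn} (h : FarEq f g) : FarEq (f - g) 0 := fun x => by
  refine ⟨((zero (B := B)) x).1, (h x).2.congr' ?_ .rfl⟩
  filter_upwards [eventually_farPt_mem x] with p hp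
  simp only [Fn.fn_zero hp, sub_zero, Fn.fn_sub _ _ hp]

/-- A function that does not depend on `Y₃` is bounded as `Y₃ → ±∞`. -/
theorem refl {f : B.Fn} (h : B.der 4 f = 0) : FarEq f f := fun x => by
  refine ⟨?_, (Asymptotics.isLittleO_zero _ _).congr_left fun p => (sub_self _).symm⟩
  have hcont : Continuous fun θ : ℝ => f.fn (farPt x (0, θ)) :=
    f.continuousOn.comp_continuous
      ((continuous_update_five (x : Pt)).update 4 (continuous_const (y := B.s.sgn * 0)))
      fun θ => farPt_mem x le_rfl
  obtain ⟨C, hC⟩ := (isCompact_Icc : IsCompact (angles (x : Pt))).exists_bound_of_continuousOn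
    hcont.continuousOn
  refine Asymptotics.IsBigO.of_bound C ?_
  filter_upwards [eventually_farFilter (x : Pt)] with p hp
  have := fn_farPt_eq h x p.2 hp.1 le_rfl
  rw [norm_one, mul_one]
  refine le_trans (le_of_eq ?_) (hC p.2 hp.2)
  exact congrArg _ this

/-- Each value equals the values far along the ray in `Y₃`, which are arbitrarily small. -/
theorem eq_zero {f : B.Fn} (h : FarEq f 0) (h4 : B.der 4 f = 0) : f = 0 := by
  rw [Fn.ext_iff_fn]
  intro x hx
  rw [Fn.fn_zero hx, ← norm_le_zero_iff]
  refine le_of_forall_pos_le_add fun ε hε => ?_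
  have h1 := Asymptotics.isLittleO_iff.1 (h ⟨x, hx⟩).2 hε
  rw [farFilter, eventually_prod_principal_iff] at h1
  obtain ⟨r, hr, hr0⟩ := (h1.and (eventually_ge_atTop 0)).exists
  have h2 := hr _ (mem_angles_self x)
  rw [Fn.fn_zero (farPt_mem ⟨x, hx⟩ hr0), sub_zero, norm_one, mul_one,
    fn_farPt_eq h4 ⟨x, hx⟩ _ hr0 hx.2.2] at h2
  have h3 := farPt_self ⟨x, hx⟩
  simp only at h3
  rw [h3] at h2
  linarith

/-- The mean commutes with `∂_{Y₃}`, so it is constant along the ray. It tends to zero at infinity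
because the decay is uniform in `θ`. -/
theorem mem_meanZero {f : B.Fn} (h : FarEq f 0) (h4 : B.der 4 f ∈ B.meanZero) :
    f ∈ B.meanZero := by
  refine Box.mem_meanZero.2 fun x => ?_
  have hconst : ∀ r, 0 ≤ r →
      mean f.fn (Function.update (x : Pt) 4 (B.s.sgn * r)) = avg x f := by
    intro r hr
    have hS : ∀ r ∈ {r : ℝ | 0 ≤ B.s.sgn * r}, Function.update (x : Pt) 4 r ∈ B.set :=
      fun r hr => by
        have := update_four_mem x.2 (B := B) hr
        rwa [← mul_assoc, Side.sgn_mul_self, one_mul] at this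
    have hder : ∀ ρ ∈ {r : ℝ | 0 ≤ B.s.sgn * r},
        HasDerivWithinAt (fun ρ => mean f.fn (Function.update (x : Pt) 4 ρ)) 0
          {r : ℝ | 0 ≤ B.s.sgn * r} ρ := by
      intro ρ hρ
      have h1 := (f.differentiableWithinAt_mean (hS ρ hρ)).hasFDerivWithinAt.comp_hasDerivWithinAt
        ρ (hasDerivAt_update (x : Pt) 4 ρ).hasDerivWithinAt hS
      have h2 := f.pd_mean (i := 4) (by decide) ⟨_, hS ρ hρ⟩
      rw [Box.mem_meanZero.1 h4, pd] at h2
      simp only at h2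
      rwa [h2] at h1
    have h3 := Convex.norm_image_sub_le_of_norm_hasDerivWithin_le (C := 0) hder
      (fun ρ _ => by rw [norm_zero])
      (convex_ray B.s)
      (x := (x : Pt) 4) (y := B.s.sgn * r) x.2.2.2
      (by simpa [← mul_assoc, Side.sgn_mul_self] using hr)
    rw [zero_mul, norm_le_zero_iff, sub_eq_zero, Function.update_eq_self] at h3
    exact h3
  rw [← norm_le_zero_iff]
  refine le_of_forall_pos_le_add fun ε hε => ?_
  have h1 := Asymptotics.isLittleO_iff.1 (h x).2 hε
  rw [farFilter, eventually_prod_principal_iff] at h1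
  obtain ⟨r, hr, hr0⟩ := (h1.and (eventually_ge_atTop 0)).exists
  have hpi : (0 : ℝ) < 2 * Real.pi := by positivity
  have h2 := intervalIntegral.norm_integral_le_of_norm_le_const (a := 0) (b := 2 * Real.pi)
    (f := fun θ => f.fn (farPt x (r, θ))) (C := ε) (fun θ hθ => by
      rw [Set.uIoc_of_le hpi.le] at hθ
      have := hr θ (Icc_subset_angles _ (Set.Ioc_subset_Icc_self hθ))
      rwa [Fn.fn_zero (farPt_mem x hr0), sub_zero, norm_one, mul_one] at this)
  rw [← hconst r hr0, mean, norm_mul, zero_add, Real.norm_of_nonneg (by positivity)]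
  simp only [fun θ : ℝ => Function.update_comm (show (4 : Fin 6) ≠ 5 by decide) (B.s.sgn * r) θ
    (x : Pt)]
  rw [sub_zero, abs_of_pos hpi] at h2
  calc (2 * Real.pi)⁻¹ * _ ≤ (2 * Real.pi)⁻¹ * (ε * (2 * Real.pi)) :=
        mul_le_mul_of_nonneg_left h2 (by positivity)
    _ = ε := by field_simp

end FarEq

end Box

end CurrentVortexSheet

namespace CurrentVortexSheet

/-! ### Sums over indices and coefficients of products -/

theorem sum2_congr {n : ℕ} {g g' : ℕ → ℕ → ℝ} (h : ∀ a e, g a e = g' a e) :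
    sum2 n g = sum2 n g' := by
  simp only [sum2, h]

theorem sum3_congr {n : ℕ} {g g' : ℕ → ℕ → ℕ → ℝ} (h : ∀ a e f, g a e f = g' a e f) :
    sum3 n g = sum3 n g' := by
  simp only [sum3, h]

theorem sum4_congr {n : ℕ} {g g' : ℕ → ℕ → ℕ → ℕ → ℝ} (h : ∀ a e f l, g a e f l = g' a e f l) :
    sum4 n g = sum4 n g' := by
  simp only [sum4, h]

theorem sum2_add (n : ℕ) (g g' : ℕ → ℕ → ℝ) :
    sum2 n (fun a e => g a e + g' a e) = sum2 n g + sum2 n g' := by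
  simp only [sum2, sum_add_distrib]

theorem sum2_neg (n : ℕ) (g : ℕ → ℕ → ℝ) : sum2 n (fun a e => -g a e) = -sum2 n g := by
  simp only [sum2, sum_neg_distrib]

theorem sum3_neg (n : ℕ) (g : ℕ → ℕ → ℕ → ℝ) :
    sum3 n (fun a e f => -g a e f) = -sum3 n g := by
  simp only [sum3, sum2_neg]

theorem mul_sum2 (c : ℝ) (n : ℕ) (g : ℕ → ℕ → ℝ) :
    c * sum2 n g = sum2 n fun a e => c * g a e := by
  simp only [sum2, mul_sum]

theorem sum_sum2 {ι : Type*} (t : Finset ι) (n : ℕ) (g : ι → ℕ → ℕ → ℝ) :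
    ∑ i ∈ t, sum2 n (g i) = sum2 n fun a e => ∑ i ∈ t, g i a e := by
  simp only [sum2]
  exact sum_comm

/-- In the applications `e` numbers the differentiated profile, so `e = 0` contributes nothing: the
reference state is constant. The term `a = 0` is the linear one, with the matrices `A_α`; the others
carry the Hessians `𝔸_α`. -/
theorem sum2_split (n : ℕ) (g : ℕ → ℕ → ℝ) (h : ∀ a, g a 0 = 0) :
    sum2 n g = sum2 n (fun a e => if 1 ≤ a ∧ 1 ≤ e then g a e else 0) + g 0 n := by
  have h1 : g 0 n = ∑ p ∈ antidiagonal n, if p = (0, n) then g 0 n else 0 := by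
    rw [sum_ite_eq' (antidiagonal n) (0, n), if_pos (by simp)]
  rw [h1, sum2, sum2, ← sum_add_distrib]
  refine sum_congr rfl fun p hp => ?_
  rw [HasAntidiagonal.mem_antidiagonal] at hp
  obtain ⟨a, e⟩ := p
  simp only at hp ⊢
  rcases Nat.eq_zero_or_pos a with rfl | ha
  · have : e = n := by omega
    subst this; simp
  · rcases Nat.eq_zero_or_pos e with rfl | he
    · simp [h, ha.ne']
    · simp [Nat.succ_le_of_lt ha, Nat.succ_le_of_lt he, ha.ne']

theorem sum3_split (n : ℕ) (g : ℕ → ℕ → ℕ → ℝ) (h : ∀ a e, g a e 0 = 0) :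
    sum3 n g = sum3 n (fun a e f => if 1 ≤ e ∧ 1 ≤ f then g a e f else 0)
      + sum2 n fun a f => g a 0 f := by
  rw [sum3, sum3, ← sum2_add]
  exact sum2_congr fun a r => sum2_split r (g a) (h a)

theorem sum4_split (n : ℕ) (g : ℕ → ℕ → ℕ → ℕ → ℝ) (h : ∀ a e f, g a e f 0 = 0) :
    sum4 n g = sum4 n (fun a e f l => if 1 ≤ f ∧ 1 ≤ l then g a e f l else 0)
      + sum3 n fun a e l => g a e 0 l := by
  rw [sum4, sum4, sum3, ← sum2_add]
  exact sum2_congr fun a r => sum3_split r (g a) (h a)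

theorem coeff_mul_eq_sum2 (n : ℕ) (f g : PowerSeries ℝ) :
    PowerSeries.coeff n (f * g)
      = sum2 n fun a e => PowerSeries.coeff a f * PowerSeries.coeff e g :=
  PowerSeries.coeff_mul n f g

/-! ### The antisymmetric products -/

/-- Pairs of four-vectors `(w, h)`. -/
abbrev V4 (A : Type*) := (Fin 4 → A) × (Fin 4 → A)

section Bil

set_option linter.unusedSectionVars false

variable {A : Type*} [CommRing A] [Algebra ℝ A]

/-- The polarization of `w_ν h_μ - h_ν w_μ`. -/
def bil (ν μ : Fin 4) (V W : V4 A) : A :=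
  V.1 ν * W.2 μ + W.1 ν * V.2 μ - V.2 ν * W.1 μ - W.2 ν * V.1 μ

/-- The combination of the tangential products with coefficients `q_i`. -/
def qbil (q : Fin 3 → A) (μ : Fin 4) (V W : V4 A) : A := ∑ i, q i * bil i.castSucc μ V W

/-- The combination of the tangential products with coefficients `k_i`. -/
def kbil (k : Fin 3 → ℝ) (μ : Fin 4) (V W : V4 A) : A := ∑ i, k i • bil i.castSucc μ V W

/-- The four-vectors of series of given coefficients. -/
noncomputable def ser (V : ℕ → V4 A) : V4 (PowerSeries A) :=
  (fun ν => PowerSeries.mk fun l => (V l).1 ν, fun ν => PowerSeries.mk fun l => (V l).2 ν)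

theorem coeff_bil_ser (n : ℕ) (ν μ : Fin 4) (V W : ℕ → V4 ℝ) :
    PowerSeries.coeff n (bil ν μ (ser V) (ser W)) = sum2 n fun a e => bil ν μ (V a) (W e) := by
  simp only [bil, ser, map_sub, map_add, mul_comm (PowerSeries.mk fun l => (W l).1 _),
    mul_comm (PowerSeries.mk fun l => (W l).2 _), PowerSeries.coeff_mul, PowerSeries.coeff_mk, sum2,
    ← sum_add_distrib, ← sum_sub_distrib]
  exact sum_congr rfl fun p _ => by ring

theorem coeff_kbil_ser (k : Fin 3 → ℝ) (n : ℕ) (μ : Fin 4) (V W : ℕ → V4 ℝ) :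
    PowerSeries.coeff n (kbil k μ (ser V) (ser W)) = sum2 n fun a e => kbil k μ (V a) (W e) := by
  simp only [kbil, map_sum, PowerSeries.coeff_smul, coeff_bil_ser, smul_eq_mul, mul_sum2, sum_sum2]

theorem coeff_qbil_ser (q : ℕ → Fin 3 → ℝ) (n : ℕ) (μ : Fin 4) (V W : ℕ → V4 ℝ) :
    PowerSeries.coeff n (qbil (fun i => PowerSeries.mk fun l => q l i) μ (ser V) (ser W))
      = sum3 n fun a e f => qbil (q a) μ (V e) (W f) := by
  simp only [qbil, map_sum, coeff_mul_eq_sum2, coeff_bil_ser, PowerSeries.coeff_mk, mul_sum2,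
    sum_sum2, sum3]

theorem bil_zero_right (ν μ : Fin 4) (V : V4 A) : bil ν μ V 0 = 0 := by
  simp [bil]

theorem kbil_zero_right (k : Fin 3 → ℝ) (μ : Fin 4) (V : V4 A) : kbil k μ V 0 = 0 := by
  simp [kbil, bil_zero_right]

theorem qbil_zero_right (q : Fin 3 → A) (μ : Fin 4) (V : V4 A) : qbil q μ V 0 = 0 := by
  simp [qbil, bil_zero_right]

theorem sum_tangential {M : Type*} [AddCommMonoid M] (f : Fin 3 → Fin 4 → M) :
    ∑ i : Fin 3, f i i.castSucc = f 0 0 + ∑ j : Fin 2, f j.succ j.castSucc.succ := by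
  rw [Fin.sum_univ_succ]
  simp [Fin.castSucc_succ]

end Bil

/-- The pair of four-vectors `(e, u), (0, H)` of a state. -/
def st (e : ℝ) (U : Comp → ℝ) : V4 ℝ :=
  (Fin.cons e fun α => U (.vel α), Fin.cons 0 fun α => U (.mag α))

theorem st_zero_zero : st 0 (fun _ => 0) = 0 := by
  ext ν <;> (refine Fin.cases ?_ (fun _ => ?_) ν <;> simp [st])

theorem bil_succ_succ_st_zero (α i : Fin 3) (V W : Comp → ℝ) :
    bil α.succ i.succ (st 0 V) (st 0 W) = hess α V W (.mag i) := by
  simp [bil, st, hess]; ring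

theorem bil_succ_succ_st_one (P : Params) (s : Side) (α i : Fin 3) (W : Comp → ℝ) :
    bil α.succ i.succ (st 1 (P.U0 s)) (st 0 W) = P.A s α W (.mag i) := by
  simp [bil, st, hess, Params.A, jac]; ring

theorem bil_zero_succ_st (i : Fin 3) (e : ℝ) (V W : Comp → ℝ) :
    bil 0 i.succ (st e V) (st 0 W) = e * W (.mag i) := by
  simp [bil, st]

theorem bil_succ_zero_st (α : Fin 3) (e : ℝ) (V W : Comp → ℝ) :
    bil α.succ 0 (st e V) (st 0 W) = -(e * W (.mag α)) := by
  simp [bil, st]; ring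

theorem bil_zero_zero_st (e : ℝ) (V W : Comp → ℝ) : bil 0 0 (st e V) (st 0 W) = 0 := by
  simp [bil, st]

namespace Params

variable (P : Params) (s : Side)

/-- The wave vector `(τ, ξ₁, ξ₂)`. -/
def wave : Fin 3 → ℝ := Fin.cons P.tau P.xi

theorem kbil_succ_st_one (i : Fin 3) (W : Comp → ℝ) :
    kbil P.wave i.succ (st 1 (P.U0 s)) (st 0 W) = P.calA s W (.mag i) := by
  rw [kbil, sum_tangential fun i ν => P.wave i • bil ν _ (st 1 (P.U0 s)) (st 0 W)]
  simp only [bil_zero_succ_st, bil_succ_succ_st_one, wave, Fin.cons_zero, Fin.cons_succ,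
    smul_eq_mul, one_mul, calA, A0]

theorem kbil_succ_st_zero (i : Fin 3) (V W : Comp → ℝ) :
    kbil P.wave i.succ (st 0 V) (st 0 W) = P.xiHess V W (.mag i) := by
  rw [kbil, sum_tangential fun i ν => P.wave i • bil ν _ (st 0 V) (st 0 W)]
  simp only [bil_zero_succ_st, bil_succ_succ_st_zero, wave, Fin.cons_zero, Fin.cons_succ,
    smul_eq_mul, zero_mul, mul_zero, zero_add, xiHess]

theorem kbil_zero_st (e : ℝ) (V W : Comp → ℝ) :
    kbil P.wave 0 (st e V) (st 0 W) = -(e * ∑ j : Fin 2, P.xi j * W (.mag j.castSucc)) := by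
  rw [kbil, sum_tangential fun i ν => P.wave i • bil ν _ (st e V) (st 0 W)]
  simp only [bil_zero_zero_st, bil_succ_zero_st, wave, Fin.cons_zero, Fin.cons_succ,
    smul_eq_mul, mul_zero, zero_add, mul_sum, ← sum_neg_distrib]
  exact sum_congr rfl fun j _ => by ring

variable (ψ : ℕ → Pt → ℝ) (x : Pt)

theorem sp_castSucc (j : Fin 2) : sp j.castSucc = tg j := by
  fin_cases j <;> rfl

theorem sp_last : sp (Fin.last 2) = 3 := rfl

theorem tan_zero : tan 0 = 0 := rfl

theorem tan_succ (j : Fin 2) : tan j.succ = tg j := by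
  fin_cases j <;> rfl

/-- The tangential derivatives of the front profile number `a`. -/
noncomputable def slope (a : ℕ) (i : Fin 3) : ℝ := P.d s (tan i) (ψ a) x

theorem qbil_succ_st_one (a : ℕ) (i : Fin 3) (W : Comp → ℝ) :
    qbil (P.slope s ψ x a) i.succ (st 1 (P.U0 s)) (st 0 W) = P.slopeA s ψ a W (.mag i) x := by
  rw [qbil, sum_tangential fun i ν => P.slope s ψ x a i * bil ν _ (st 1 (P.U0 s)) (st 0 W)]
  simp only [bil_zero_succ_st, bil_succ_succ_st_one, slope, tan_zero, tan_succ, one_mul, slopeA, A0]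

theorem qbil_succ_st_zero (a : ℕ) (i : Fin 3) (V W : Comp → ℝ) :
    qbil (P.slope s ψ x a) i.succ (st 0 V) (st 0 W) = P.slopeHess s ψ a V W (.mag i) x := by
  rw [qbil, sum_tangential fun i ν => P.slope s ψ x a i * bil ν _ (st 0 V) (st 0 W)]
  simp only [bil_zero_succ_st, bil_succ_succ_st_zero, slope, tan_succ, zero_mul,
    mul_zero, zero_add, slopeHess]

theorem qbil_zero_st (a : ℕ) (e : ℝ) (V W : Comp → ℝ) :
    qbil (P.slope s ψ x a) 0 (st e V) (st 0 W)
      = -(e * ∑ j : Fin 2, P.d s (tg j) (ψ a) x * W (.mag j.castSucc)) := by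
  rw [qbil, sum_tangential fun i ν => P.slope s ψ x a i * bil ν _ (st e V) (st 0 W)]
  simp only [bil_zero_zero_st, bil_succ_zero_st, slope, tan_succ, mul_zero, zero_add, mul_sum,
    ← sum_neg_distrib]
  exact sum_congr rfl fun j _ => by ring

end Params

/-! ### The sources as coefficients of formal series -/

/-- The formal series at a point: those of `χ(x₃)`, `χ'(x₃)`, of the front and its derivatives, of
the four-vectors `(1, u), (0, H)` and their derivatives. -/
structure Jet where
  c₀ : PowerSeries ℝ
  c₁ : PowerSeries ℝ
  p : PowerSeries ℝ
  q : Fin 6 → PowerSeries ℝ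
  V : V4 (PowerSeries ℝ)
  W : Fin 6 → V4 (PowerSeries ℝ)

namespace Jet

open PowerSeries

variable (J : Jet) (k : Fin 3 → ℝ)

/-- The four-vectors without their constant terms. -/
noncomputable def Vpos : V4 (PowerSeries ℝ) :=
  (fun ν => J.V.1 ν - C (coeff 0 (J.V.1 ν)), fun ν => J.V.2 ν - C (coeff 0 (J.V.2 ν)))

/-- The terms with slow normal derivatives that come from the straightening of the front. -/
noncomputable def chiPart (n : ℕ) (μ : Fin 4) : ℝ :=
  coeff n (J.c₀ * qbil (fun i => J.q (tan i)) μ J.V (J.W 3))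
  + coeff (n + 1) (J.c₀ * (J.q 5 * kbil k μ J.V (J.W 3)))
  + coeff n (J.c₁ * (J.p * bil 3 μ J.V (J.W 3)))

/-- The slow divergence of the products of two profiles, with `V` as the first factor. -/
noncomputable def slowDiv (V : V4 (PowerSeries ℝ)) (n : ℕ) (μ : Fin 4) : ℝ :=
  coeff n (∑ i : Fin 3, bil i.castSucc μ V (J.W (tan i)) + bil 3 μ V (J.W 3))

/-- The source term of the cascade in the equation number `μ`. -/
noncomputable def src (n : ℕ) (μ : Fin 4) : ℝ :=
  -J.slowDiv J.V n μ + J.chiPart k n μ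
  - coeff (n + 1) (kbil k μ J.Vpos (J.W 5)) - coeff (n + 1) (bil 3 μ J.Vpos (J.W 4))
  + coeff (n + 2) (J.q 5 * kbil k μ J.V (J.W 4))
  + coeff (n + 1) (qbil (fun i => J.q (tan i)) μ J.V (J.W 4))

/-- The source term of the slow mean problem, before taking the mean, in the equation number
`μ`. -/
noncomputable def slowSrc (n : ℕ) (μ : Fin 4) : ℝ :=
  J.chiPart k n μ - J.slowDiv J.Vpos n μ

end Jet

namespace Params

variable (P : Params) (s : Side) (U : ℕ → Comp → Pt → ℝ) (ψ : ℕ → Pt → ℝ) (x : Pt)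

/-- The four-vectors of the profile number `l`. -/
noncomputable def Vseq (l : ℕ) : V4 ℝ := st (if l = 0 then 1 else 0) (val U l x)

/-- The derivative number `i` of the four-vectors of the profile number `l`. -/
noncomputable def Wseq (i : Fin 6) (l : ℕ) : V4 ℝ := st 0 (P.dU s U i l x)

/-- The formal series at a point. -/
noncomputable def jet : Jet where
  c₀ := PowerSeries.mk fun l => P.chiC ψ l x
  c₁ := PowerSeries.mk fun l => P.chiDotC ψ l x
  p := PowerSeries.mk fun l => ψ l x
  q i := PowerSeries.mk fun l => P.d s i (ψ l) x
  V := ser (Vseq U x)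
  W i := ser (P.Wseq s U x i)

variable {P s U ψ x}

theorem Vseq_zero (hU : ∀ k y, U 0 k y = P.U0 s k) : Vseq U x 0 = st 1 (P.U0 s) := by
  simp only [Vseq, if_true]
  congr
  ext k
  exact hU k x

theorem Vseq_pos {l : ℕ} (hl : 1 ≤ l) : Vseq U x l = st 0 (val U l x) := by
  rw [Vseq, if_neg (by omega)]

theorem Wseq_zero (hU : ∀ k y, U 0 k y = P.U0 s k) (i : Fin 6) : P.Wseq s U x i 0 = 0 := by
  have : P.dU s U i 0 x = fun _ => 0 := by
    ext k
    rw [dU, d, show U 0 k = fun _ => P.U0 s k from funext (hU k), pd]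
    simp
  rw [Wseq, this, st_zero_zero]

theorem jet_Vpos_eq : (P.jet s U ψ x).Vpos
    = ser fun l => if l = 0 then 0 else Vseq U x l := by
  refine Prod.ext (funext fun ν => ?_) (funext fun ν => ?_) <;>
  · ext l
    simp only [Jet.Vpos, jet, ser, map_sub, PowerSeries.coeff_mk, PowerSeries.coeff_C]
    split_ifs with h <;> simp [h]

theorem coeff_chi_qbil (c : ℕ → ℝ) (q : ℕ → Fin 3 → ℝ) (n : ℕ) (μ : Fin 4) (V W : ℕ → V4 ℝ)
    (hW : W 0 = 0) :
    PowerSeries.coeff n (PowerSeries.mk c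
      * qbil (fun i => PowerSeries.mk fun l => q l i) μ (ser V) (ser W))
    = sum4 n (fun a e f l => if 1 ≤ f ∧ 1 ≤ l then c a * qbil (q e) μ (V f) (W l) else 0)
      + sum3 n fun a e l => c a * qbil (q e) μ (V 0) (W l) := by
  rw [coeff_mul_eq_sum2]
  simp only [PowerSeries.coeff_mk, coeff_qbil_ser]
  rw [← sum4_split n (fun a e f l => c a * qbil (q e) μ (V f) (W l))
    (fun a e f => by simp [hW, qbil_zero_right])]
  simp only [sum4, sum3, mul_sum2]

theorem coeff_chi_front_mul (c q : ℕ → ℝ) (n : ℕ) (f : PowerSeries ℝ) (β : V4 ℝ → V4 ℝ → ℝ)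
    (V W : ℕ → V4 ℝ) (hf : ∀ n, PowerSeries.coeff n f = sum2 n fun a e => β (V a) (W e))
    (hβ : ∀ a, β (V a) (W 0) = 0) :
    PowerSeries.coeff n (PowerSeries.mk c * (PowerSeries.mk q * f))
    = sum4 n (fun a e f l => if 1 ≤ f ∧ 1 ≤ l then c a * q e * β (V f) (W l) else 0)
      + sum3 n fun a e l => c a * q e * β (V 0) (W l) := by
  rw [← sum4_split n (fun a e f l => c a * q e * β (V f) (W l))
    (fun a e f => by simp [hβ])]
  simp only [coeff_mul_eq_sum2, PowerSeries.coeff_mk, hf, sum4, sum3, mul_sum2, mul_assoc]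

theorem coeff_front_mul (q : ℕ → ℝ) (n : ℕ) (f : PowerSeries ℝ) (β : V4 ℝ → V4 ℝ → ℝ)
    (V W : ℕ → V4 ℝ) (hf : ∀ n, PowerSeries.coeff n f = sum2 n fun a e => β (V a) (W e))
    (hβ : ∀ a, β (V a) (W 0) = 0) :
    PowerSeries.coeff n (PowerSeries.mk q * f)
    = sum3 n (fun a e f => if 1 ≤ e ∧ 1 ≤ f then q a * β (V e) (W f) else 0)
      + sum2 n fun a l => q a * β (V 0) (W l) := by
  rw [← sum3_split n (fun a e f => q a * β (V e) (W f)) (fun a e => by simp [hβ])]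
  simp only [coeff_mul_eq_sum2, PowerSeries.coeff_mk, hf, sum3, mul_sum2]

theorem coeff_qbil_split (q : ℕ → Fin 3 → ℝ) (n : ℕ) (μ : Fin 4) (V W : ℕ → V4 ℝ)
    (hW : W 0 = 0) :
    PowerSeries.coeff n (qbil (fun i => PowerSeries.mk fun l => q l i) μ (ser V) (ser W))
    = sum3 n (fun a e f => if 1 ≤ e ∧ 1 ≤ f then qbil (q a) μ (V e) (W f) else 0)
      + sum2 n fun a l => qbil (q a) μ (V 0) (W l) := by
  rw [coeff_qbil_ser, ← sum3_split n (fun a e f => qbil (q a) μ (V e) (W f))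
    (fun a e => by simp [hW, qbil_zero_right])]

theorem coeff_pos_mul (n : ℕ) (f : PowerSeries ℝ) (β : V4 ℝ → V4 ℝ → ℝ)
    (V W : ℕ → V4 ℝ)
    (hf : ∀ n, PowerSeries.coeff n f = sum2 n fun a e => β (if a = 0 then 0 else V a) (W e))
    (hβ : ∀ a, β a (W 0) = 0) (hβ' : ∀ a, β 0 a = 0) :
    PowerSeries.coeff n f
    = sum2 n fun a e => if 1 ≤ a ∧ 1 ≤ e then β (V a) (W e) else 0 := by
  rw [hf]
  refine sum2_congr fun a e => ?_
  rcases Nat.eq_zero_or_pos a with rfl | ha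
  · simp [hβ']
  · rcases Nat.eq_zero_or_pos e with rfl | he
    · simp [hβ]
    · simp [Nat.succ_le_of_lt ha, Nat.succ_le_of_lt he, ha.ne']

theorem bil_zero_left {A : Type*} [CommRing A] (ν μ : Fin 4) (W : V4 A) : bil ν μ 0 W = 0 := by
  simp [bil]

theorem kbil_zero_left (k : Fin 3 → ℝ) (μ : Fin 4) (W : V4 ℝ) : kbil k μ 0 W = 0 := by
  simp [kbil, bil_zero_left]

/-- The slow divergence of the products of two states with derivatives `W i`. -/
noncomputable def sdiv (μ : Fin 4) (V : V4 ℝ) (W : Fin 6 → V4 ℝ) : ℝ :=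
  ∑ i : Fin 3, bil i.castSucc μ V (W (tan i)) + bil 3 μ V (W 3)

theorem sdiv_succ_st_one (i : Fin 3) (W : Fin 6 → Comp → ℝ) :
    sdiv i.succ (st 1 (P.U0 s)) (fun r => st 0 (W r))
      = A0 (W 0) (.mag i) + ∑ α : Fin 3, P.A s α (W (sp α)) (.mag i) := by
  rw [sdiv, sum_tangential fun l ν => bil ν i.succ (st 1 (P.U0 s)) (st 0 (W (tan l)))]
  rw [show (3 : Fin 4) = (Fin.last 2).succ from rfl]
  simp only [bil_zero_succ_st, bil_succ_succ_st_one, tan_zero, tan_succ, one_mul, A0]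
  rw [Fin.sum_univ_castSucc (n := 2), add_assoc]
  simp only [sp_castSucc, sp_last]

theorem sdiv_succ_st_zero (i : Fin 3) (V : Comp → ℝ) (W : Fin 6 → Comp → ℝ) :
    sdiv i.succ (st 0 V) (fun r => st 0 (W r))
      = ∑ α : Fin 3, hess α V (W (sp α)) (.mag i) := by
  rw [sdiv, sum_tangential fun l ν => bil ν i.succ (st 0 V) (st 0 (W (tan l)))]
  rw [show (3 : Fin 4) = (Fin.last 2).succ from rfl]
  simp only [bil_zero_succ_st, bil_succ_succ_st_zero, tan_succ, zero_mul, zero_add]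
  rw [Fin.sum_univ_castSucc (n := 2)]
  simp only [sp_castSucc, sp_last]

theorem sdiv_zero_st (e : ℝ) (V : Comp → ℝ) (W : Fin 6 → Comp → ℝ) :
    sdiv 0 (st e V) (fun r => st 0 (W r)) = -(e * ∑ α : Fin 3, W (sp α) (.mag α)) := by
  rw [sdiv, sum_tangential fun l ν => bil ν 0 (st e V) (st 0 (W (tan l)))]
  rw [show (3 : Fin 4) = (Fin.last 2).succ from rfl]
  simp only [bil_zero_zero_st, bil_succ_zero_st, tan_succ, zero_add]
  rw [Fin.sum_univ_castSucc (n := 2), mul_add, neg_add, mul_sum, sum_neg_distrib]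
  simp only [sp_castSucc, sp_last]

theorem coeff_sdiv_ser (n : ℕ) (μ : Fin 4) (V : ℕ → V4 ℝ) (W : Fin 6 → ℕ → V4 ℝ) :
    PowerSeries.coeff n (∑ i : Fin 3, bil i.castSucc μ (ser V) (ser (W (tan i)))
        + bil 3 μ (ser V) (ser (W 3)))
      = sum2 n fun a e => sdiv μ (V a) fun r => W r e := by
  simp only [map_add, map_sum, coeff_bil_ser, sum_sum2, sdiv, sum2_add]

theorem sdiv_zero_left (μ : Fin 4) (W : Fin 6 → V4 ℝ) : sdiv μ 0 W = 0 := by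
  simp [sdiv, bil_zero_left]

theorem sdiv_zero_right (μ : Fin 4) (V : V4 ℝ) : sdiv μ V (fun _ => 0) = 0 := by
  simp [sdiv, bil_zero_right]

end Params

end CurrentVortexSheet

/-! ### The magnetic and divergence sources as coefficients of series -/

namespace CurrentVortexSheet

namespace Params

open PowerSeries

variable {P : Params} {s : Side} {U : ℕ → Comp → Pt → ℝ} {ψ : ℕ → Pt → ℝ} {x : Pt}

section Mag

variable (hU : ∀ k y, U 0 k y = P.U0 s k) (n : ℕ) (i : Fin 3)
include hU

theorem slowDiv_mag : (P.jet s U ψ x).slowDiv (P.jet s U ψ x).V n i.succ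
    = sum2 n (fun a e => if 1 ≤ a ∧ 1 ≤ e then
        ∑ α : Fin 3, hess α (val U a x) (P.dU s U (sp α) e x) (.mag i) else 0)
      + P.Ls s U n (.mag i) x := by
  refine (coeff_sdiv_ser n i.succ (Vseq U x) (P.Wseq s U x)).trans ?_
  rw [sum2_split _ _ fun a => by simp only [Wseq_zero hU, sdiv_zero_right]]
  congr 1
  · refine sum2_congr fun a e => ?_
    split_ifs with h
    · rw [Vseq_pos h.1]
      exact sdiv_succ_st_zero i _ fun r => P.dU s U r e x
    · rfl
  · rw [Vseq_zero hU]
    exact sdiv_succ_st_one i fun r => P.dU s U r n x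

theorem slowDiv_Vpos_mag : (P.jet s U ψ x).slowDiv (P.jet s U ψ x).Vpos n i.succ
    = sum2 n (fun a e => if 1 ≤ a ∧ 1 ≤ e then
        ∑ α : Fin 3, hess α (val U a x) (P.dU s U (sp α) e x) (.mag i) else 0) := by
  rw [jet_Vpos_eq]
  refine (coeff_sdiv_ser n i.succ _ (P.Wseq s U x)).trans ?_
  rw [sum2_split _ _ fun a => by simp only [Wseq_zero hU, sdiv_zero_right]]
  rw [if_pos rfl, sdiv_zero_left, add_zero]
  refine sum2_congr fun a e => ?_
  split_ifs with h h'
  · omega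
  · rw [Vseq_pos h.1]
    exact sdiv_succ_st_zero i _ fun r => P.dU s U r e x
  · rfl

theorem chi_slope_mag : coeff n ((P.jet s U ψ x).c₀ * qbil (fun r => (P.jet s U ψ x).q (tan r))
      i.succ (P.jet s U ψ x).V ((P.jet s U ψ x).W 3))
    = sum4 n (fun a e f g => if 1 ≤ f ∧ 1 ≤ g then
        P.chiC ψ a x * P.slopeHess s ψ e (val U f x) (P.dU s U 3 g x) (.mag i) x else 0)
      + sum3 n (fun a e f => P.chiC ψ a x * P.slopeA s ψ e (P.dU s U 3 f x) (.mag i) x) := by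
  refine (coeff_chi_qbil (fun l => P.chiC ψ l x)
    (P.slope s ψ x) n i.succ (Vseq U x) (P.Wseq s U x 3)
    (Wseq_zero hU 3)).trans ?_
  congr 1
  · refine sum4_congr fun a e f g => ?_
    split_ifs with h
    · rw [Vseq_pos h.1, Wseq, qbil_succ_st_zero]
    · rfl
  · refine sum3_congr fun a e f => ?_
    rw [Vseq_zero hU, Wseq, qbil_succ_st_one]

theorem chi_front_mag : coeff n ((P.jet s U ψ x).c₀ * ((P.jet s U ψ x).q 5 *
      kbil P.wave i.succ (P.jet s U ψ x).V ((P.jet s U ψ x).W 3)))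
    = sum4 n (fun a e f g => if 1 ≤ f ∧ 1 ≤ g then
        P.chiC ψ a x * P.d s 5 (ψ e) x * P.xiHess (val U f x) (P.dU s U 3 g x) (.mag i) else 0)
      + sum3 n (fun a e f =>
          P.chiC ψ a x * P.d s 5 (ψ e) x * P.calA s (P.dU s U 3 f x) (.mag i)) := by
  refine (coeff_chi_front_mul (fun l => P.chiC ψ l x)
    (fun l => P.d s 5 (ψ l) x) n _ (kbil P.wave i.succ) (Vseq U x) (P.Wseq s U x 3)
    (fun n => coeff_kbil_ser _ n _ _ _)
    (fun a => by rw [Wseq_zero hU, kbil_zero_right])).trans ?_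
  congr 1
  · refine sum4_congr fun a e f g => ?_
    split_ifs with h
    · rw [Vseq_pos h.1, Wseq, kbil_succ_st_zero]
    · rfl
  · refine sum3_congr fun a e f => ?_
    rw [Vseq_zero hU, Wseq, kbil_succ_st_one]

theorem chiDot_mag : coeff n ((P.jet s U ψ x).c₁ * ((P.jet s U ψ x).p *
      bil 3 i.succ (P.jet s U ψ x).V ((P.jet s U ψ x).W 3)))
    = sum4 n (fun a e f g => if 1 ≤ f ∧ 1 ≤ g then
        P.chiDotC ψ a x * ψ e x * hess 2 (val U f x) (P.dU s U 3 g x) (.mag i) else 0)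
      + sum3 n (fun a e f => P.chiDotC ψ a x * ψ e x * P.A s 2 (P.dU s U 3 f x) (.mag i)) := by
  refine (coeff_chi_front_mul (fun l => P.chiDotC ψ l x)
    (fun l => ψ l x) n _ (bil 3 i.succ) (Vseq U x) (P.Wseq s U x 3)
    (fun n => coeff_bil_ser n _ _ _ _)
    (fun a => by rw [Wseq_zero hU, bil_zero_right])).trans ?_
  rw [show (3 : Fin 4) = Fin.succ 2 from rfl]
  congr 1
  · refine sum4_congr fun a e f g => ?_
    split_ifs with h
    · rw [Vseq_pos h.1, Wseq, bil_succ_succ_st_zero]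
    · rfl
  · refine sum3_congr fun a e f => ?_
    rw [Vseq_zero hU, Wseq, bil_succ_succ_st_one]

theorem fast_theta_mag : coeff n (kbil P.wave i.succ (P.jet s U ψ x).Vpos ((P.jet s U ψ x).W 5))
    = sum2 n (fun a e => if 1 ≤ a ∧ 1 ≤ e then
      P.xiHess (val U a x) (P.dU s U 5 e x) (.mag i) else 0) := by
  rw [jet_Vpos_eq]
  refine (coeff_pos_mul n _ (kbil P.wave i.succ) (Vseq U x) (P.Wseq s U x 5)
    (fun n => coeff_kbil_ser _ n _ _ _) (fun a => by rw [Wseq_zero hU, kbil_zero_right])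
    (fun a => kbil_zero_left _ _ _)).trans ?_
  refine sum2_congr fun a e => ?_
  split_ifs with h
  · rw [Vseq_pos h.1, Wseq, kbil_succ_st_zero]
  · rfl

theorem fast_normal_mag : coeff n (bil 3 i.succ (P.jet s U ψ x).Vpos ((P.jet s U ψ x).W 4))
    = sum2 n (fun a e => if 1 ≤ a ∧ 1 ≤ e then
      hess 2 (val U a x) (P.dU s U 4 e x) (.mag i) else 0) := by
  rw [jet_Vpos_eq]
  refine (coeff_pos_mul n _ (bil 3 i.succ) (Vseq U x) (P.Wseq s U x 4)
    (fun n => coeff_bil_ser n _ _ _ _) (fun a => by rw [Wseq_zero hU, bil_zero_right])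
    (fun a => bil_zero_left _ _ _)).trans ?_
  rw [show (3 : Fin 4) = Fin.succ 2 from rfl]
  refine sum2_congr fun a e => ?_
  split_ifs with h
  · rw [Vseq_pos h.1, Wseq, bil_succ_succ_st_zero]
  · rfl

theorem front_mag : coeff n ((P.jet s U ψ x).q 5 *
      kbil P.wave i.succ (P.jet s U ψ x).V ((P.jet s U ψ x).W 4))
    = sum3 n (fun a e f => if 1 ≤ e ∧ 1 ≤ f then
        P.d s 5 (ψ a) x * P.xiHess (val U e x) (P.dU s U 4 f x) (.mag i) else 0)
      + sum2 n (fun a e => P.d s 5 (ψ a) x * P.calA s (P.dU s U 4 e x) (.mag i)) := by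
  refine (coeff_front_mul (fun l => P.d s 5 (ψ l) x) n _ (kbil P.wave i.succ) (Vseq U x) (P.Wseq s U x 4)
    (fun n => coeff_kbil_ser _ n _ _ _)
    (fun a => by rw [Wseq_zero hU, kbil_zero_right])).trans ?_
  congr 1
  · refine sum3_congr fun a e f => ?_
    split_ifs with h
    · rw [Vseq_pos h.1, Wseq, kbil_succ_st_zero]
    · rfl
  · refine sum2_congr fun a e => ?_
    rw [Vseq_zero hU, Wseq, kbil_succ_st_one]

theorem slope_mag : coeff n (qbil (fun r => (P.jet s U ψ x).q (tan r)) i.succ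
      (P.jet s U ψ x).V ((P.jet s U ψ x).W 4))
    = sum3 n (fun a e f => if 1 ≤ e ∧ 1 ≤ f then
        P.slopeHess s ψ a (val U e x) (P.dU s U 4 f x) (.mag i) x else 0)
      + sum2 n (fun a e => P.slopeA s ψ a (P.dU s U 4 e x) (.mag i) x) := by
  refine (coeff_qbil_split (P.slope s ψ x) n i.succ (Vseq U x) (P.Wseq s U x 4)
    (Wseq_zero hU 4)).trans ?_
  congr 1
  · refine sum3_congr fun a e f => ?_
    split_ifs with h
    · rw [Vseq_pos h.1, Wseq, qbil_succ_st_zero]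
    · rfl
  · refine sum2_congr fun a e => ?_
    rw [Vseq_zero hU, Wseq, qbil_succ_st_one]

/-- Each product of series yields two sums of the cascade: the constant term of the undifferentiated
factor gives the one with Jacobians, its higher terms the one with Hessians. The fast terms with
constant first factor belong to the fast operator, hence the use of `Vpos` there. -/
theorem F_mag_eq_src : P.F s U ψ n (.mag i) x = (P.jet s U ψ x).src P.wave n i.succ := by
  rw [Jet.src, Jet.chiPart, slowDiv_mag hU, chi_slope_mag hU, chi_front_mag hU, chiDot_mag hU,
    fast_theta_mag hU, fast_normal_mag hU, front_mag hU, slope_mag hU, F]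
  ring

theorem slowF_mag_eq : P.slowF s U ψ n (.mag i)
    = mean fun x => (P.jet s U ψ x).slowSrc P.wave (n + 1) i.succ := by
  rw [slowF]
  congr 1
  ext x
  rw [Jet.slowSrc, Jet.chiPart, slowDiv_Vpos_mag hU, chi_slope_mag hU, chi_front_mag hU,
    chiDot_mag hU]
  ring

end Mag

theorem sum4_cond_eq_zero (n : ℕ) {g : ℕ → ℕ → ℕ → ℕ → ℝ} (h : ∀ a e f l, 1 ≤ f → g a e f l = 0) :
    sum4 n (fun a e f l => if 1 ≤ f ∧ 1 ≤ l then g a e f l else 0) = 0 := by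
  rw [sum4_congr (g' := fun _ _ _ _ => 0) fun a e f l => by
    split_ifs with h'
    · exact h a e f l h'.1
    · rfl]
  simp [sum4, sum3, sum2]

theorem sum3_cond_eq_zero (n : ℕ) {g : ℕ → ℕ → ℕ → ℝ} (h : ∀ a e f, 1 ≤ e → g a e f = 0) :
    sum3 n (fun a e f => if 1 ≤ e ∧ 1 ≤ f then g a e f else 0) = 0 := by
  rw [sum3_congr (g' := fun _ _ _ => 0) fun a e f => by
    split_ifs with h'
    · exact h a e f h'.1
    · rfl]
  simp [sum3, sum2]

theorem slowDiv_Vpos_div (n : ℕ) : (P.jet s U ψ x).slowDiv (P.jet s U ψ x).Vpos n 0 = 0 := by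
  rw [jet_Vpos_eq]
  refine (coeff_sdiv_ser n 0 _ (P.Wseq s U x)).trans ?_
  rw [sum2]
  refine sum_eq_zero fun p _ => ?_
  split_ifs with h
  · rw [sdiv_zero_left]
  · rw [Vseq, if_neg h]
    refine (sdiv_zero_st 0 _ fun r => P.dU s U r p.2 x).trans ?_
    simp

section Div

set_option linter.unusedSectionVars false

variable (hU : ∀ k y, U 0 k y = P.U0 s k) (n : ℕ)
include hU

theorem slowDiv_div : (P.jet s U ψ x).slowDiv (P.jet s U ψ x).V n 0
    = -∑ α : Fin 3, P.d s (sp α) (U n (.mag α)) x := by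
  refine (coeff_sdiv_ser n 0 (Vseq U x) (P.Wseq s U x)).trans ?_
  have h0 : ∀ a e, sdiv 0 (Vseq U x a) (fun r => P.Wseq s U x r e)
      = -((if a = 0 then 1 else 0) * ∑ α : Fin 3, P.d s (sp α) (U e (.mag α)) x) := fun a e =>
    sdiv_zero_st _ _ fun r => P.dU s U r e x
  rw [sum2_split _ _ fun a => by simp only [Wseq_zero hU, sdiv_zero_right], h0, if_pos rfl, one_mul]
  simp only [h0]
  convert zero_add _
  rw [sum2]
  refine sum_eq_zero fun p _ => ?_
  split_ifs with h h'
  · omega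
  · simp
  · rfl

theorem chi_slope_div : coeff n ((P.jet s U ψ x).c₀ * qbil (fun r => (P.jet s U ψ x).q (tan r))
      0 (P.jet s U ψ x).V ((P.jet s U ψ x).W 3))
    = -sum3 n (fun a e f => P.chiC ψ a x
        * ∑ j : Fin 2, P.d s (tg j) (ψ e) x * P.d s 3 (U f (.mag j.castSucc)) x) := by
  refine (coeff_chi_qbil (fun l => P.chiC ψ l x)
    (P.slope s ψ x) n 0 (Vseq U x) (P.Wseq s U x 3)
    (Wseq_zero hU 3)).trans ?_
  rw [sum4_cond_eq_zero n, zero_add, ← sum3_neg]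
  · refine sum3_congr fun a e f => ?_
    rw [Vseq_zero hU, Wseq, qbil_zero_st, one_mul, mul_neg]
    rfl
  · intro a e f l h
    rw [Vseq_pos h, Wseq, qbil_zero_st, zero_mul, neg_zero, mul_zero]

theorem chi_front_div : coeff n ((P.jet s U ψ x).c₀ * ((P.jet s U ψ x).q 5 *
      kbil P.wave 0 (P.jet s U ψ x).V ((P.jet s U ψ x).W 3)))
    = -sum3 n (fun a e f => P.chiC ψ a x * P.d s 5 (ψ e) x
      * ∑ j : Fin 2, P.xi j * P.d s 3 (U f (.mag j.castSucc)) x) := by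
  refine (coeff_chi_front_mul (fun l => P.chiC ψ l x)
    (fun l => P.d s 5 (ψ l) x) n _ (kbil P.wave 0) (Vseq U x) (P.Wseq s U x 3)
    (fun n => coeff_kbil_ser _ n _ _ _)
    (fun a => by rw [Wseq_zero hU, kbil_zero_right])).trans ?_
  rw [sum4_cond_eq_zero n, zero_add, ← sum3_neg]
  · refine sum3_congr fun a e f => ?_
    rw [Vseq_zero hU, Wseq, kbil_zero_st, one_mul, mul_neg]
    rfl
  · intro a e f l h
    rw [Vseq_pos h, Wseq, kbil_zero_st, zero_mul, neg_zero, mul_zero]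

theorem chiDot_div : coeff n ((P.jet s U ψ x).c₁ * ((P.jet s U ψ x).p *
      bil 3 0 (P.jet s U ψ x).V ((P.jet s U ψ x).W 3)))
    = -sum3 n (fun a e f => P.chiDotC ψ a x * ψ e x * P.d s 3 (U f (.mag 2)) x) := by
  refine (coeff_chi_front_mul (fun l => P.chiDotC ψ l x)
    (fun l => ψ l x) n _ (bil 3 0) (Vseq U x) (P.Wseq s U x 3)
    (fun n => coeff_bil_ser n _ _ _ _)
    (fun a => by rw [Wseq_zero hU, bil_zero_right])).trans ?_
  rw [show (3 : Fin 4) = Fin.succ 2 from rfl]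
  rw [sum4_cond_eq_zero n, zero_add, ← sum3_neg]
  · refine sum3_congr fun a e f => ?_
    rw [Vseq_zero hU, Wseq, bil_succ_zero_st, one_mul, mul_neg]
    rfl
  · intro a e f l h
    rw [Vseq_pos h, Wseq, bil_succ_zero_st, zero_mul, neg_zero, mul_zero]

theorem fast_theta_div : coeff n (kbil P.wave 0 (P.jet s U ψ x).Vpos ((P.jet s U ψ x).W 5))
    = 0 := by
  rw [jet_Vpos_eq]
  refine (coeff_kbil_ser _ n 0 _ (P.Wseq s U x 5)).trans (sum_eq_zero fun p _ => ?_)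
  dsimp only
  split_ifs with h
  · exact kbil_zero_left _ _ _
  · rw [Vseq, if_neg h, Wseq, kbil_zero_st, zero_mul, neg_zero]

theorem fast_normal_div : coeff n (bil 3 0 (P.jet s U ψ x).Vpos ((P.jet s U ψ x).W 4)) = 0 := by
  rw [jet_Vpos_eq]
  refine (coeff_bil_ser n 3 0 _ (P.Wseq s U x 4)).trans (sum_eq_zero fun p _ => ?_)
  rw [show (3 : Fin 4) = Fin.succ 2 from rfl]
  dsimp only
  split_ifs with h
  · exact bil_zero_left _ _ _
  · rw [Vseq, if_neg h, Wseq, bil_succ_zero_st, zero_mul, neg_zero]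

theorem front_div : coeff n ((P.jet s U ψ x).q 5 *
      kbil P.wave 0 (P.jet s U ψ x).V ((P.jet s U ψ x).W 4))
    = -sum2 n (fun a e => P.d s 5 (ψ a) x
        * ∑ j : Fin 2, P.xi j * P.d s 4 (U e (.mag j.castSucc)) x) := by
  refine (coeff_front_mul (fun l => P.d s 5 (ψ l) x) n _ (kbil P.wave 0) (Vseq U x) (P.Wseq s U x 4)
    (fun n => coeff_kbil_ser _ n _ _ _)
    (fun a => by rw [Wseq_zero hU, kbil_zero_right])).trans ?_
  rw [sum3_cond_eq_zero n, zero_add, ← sum2_neg]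
  · refine sum2_congr fun a e => ?_
    rw [Vseq_zero hU, Wseq, kbil_zero_st, one_mul, mul_neg]
    rfl
  · intro a e f h
    rw [Vseq_pos h, Wseq, kbil_zero_st, zero_mul, neg_zero, mul_zero]

theorem slope_div : coeff n (qbil (fun r => (P.jet s U ψ x).q (tan r)) 0
      (P.jet s U ψ x).V ((P.jet s U ψ x).W 4))
    = -sum2 n (fun a e => ∑ j : Fin 2, P.d s (tg j) (ψ a) x
        * P.d s 4 (U e (.mag j.castSucc)) x) := by
  refine (coeff_qbil_split (P.slope s ψ x) n 0 (Vseq U x) (P.Wseq s U x 4)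
    (Wseq_zero hU 4)).trans ?_
  rw [sum3_cond_eq_zero n, zero_add, ← sum2_neg]
  · refine sum2_congr fun a e => ?_
    rw [Vseq_zero hU, Wseq, qbil_zero_st, one_mul]
    rfl
  · intro a e f h
    rw [Vseq_pos h, Wseq, qbil_zero_st, zero_mul, neg_zero]

/-- Component `0` of `w` is exactly `1` and that of `h` is `0`. Quadratic terms therefore disappear,
and what remains is linear in the magnetic field, with a minus sign. -/
theorem F8_eq_src : P.F8 s U ψ n x = -(P.jet s U ψ x).src P.wave n 0 := by
  rw [Jet.src, Jet.chiPart, slowDiv_div hU, chi_slope_div hU, chi_front_div hU, chiDot_div hU,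
    fast_theta_div hU, fast_normal_div hU, front_div hU, slope_div hU, F8]
  ring

theorem slowF8_eq : P.slowF8 s U ψ n
    = mean fun x => -(P.jet s U ψ x).slowSrc P.wave (n + 1) 0 := by
  rw [slowF8]
  congr 1
  ext x
  rw [Jet.slowSrc, Jet.chiPart, slowDiv_Vpos_div, chi_slope_div hU, chi_front_div hU,
    chiDot_div hU]
  ring

end Div

end Params

end CurrentVortexSheet

namespace CurrentVortexSheet

open PowerSeries

/-! ### Dependence of the sources on the profiles -/

theorem X_pow_dvd_mul_sub_mul {f f' g g' : PowerSeries ℝ} {u v a b n : ℕ} (hf : X ^ u ∣ f - f')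
    (hg : X ^ v ∣ g - g') (hf' : X ^ a ∣ f') (hg' : X ^ b ∣ g) (h1 : n ≤ u + b) (h2 : n ≤ a + v) :
    X ^ n ∣ f * g - f' * g' := by
  have : f * g - f' * g' = (f - f') * g + f' * (g - g') := by ring
  rw [this]
  refine dvd_add ((pow_dvd_pow X h1).trans ?_) ((pow_dvd_pow X h2).trans ?_)
  · rw [pow_add]; exact mul_dvd_mul hf hg'
  · rw [pow_add]; exact mul_dvd_mul hf' hg

theorem coeff_eq_of_X_pow_dvd {f g : PowerSeries ℝ} {n w : ℕ} (h : X ^ w ∣ f - g) (hn : n < w) :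
    coeff n f = coeff n g := by
  have := X_pow_dvd_iff.1 h n hn
  rwa [map_sub, sub_eq_zero] at this

/-- Divisibility of all components by `X ^ a`. -/
def VDvd (a : ℕ) (V : V4 (PowerSeries ℝ)) : Prop := ∀ ν, X ^ a ∣ V.1 ν ∧ X ^ a ∣ V.2 ν

theorem VDvd.zero (V : V4 (PowerSeries ℝ)) : VDvd 0 V := fun ν => by simp

theorem VDvd.bil_dvd {a b : ℕ} {V W : V4 (PowerSeries ℝ)} (hV : VDvd a V) (hW : VDvd b W)
    (ν μ : Fin 4) : X ^ (a + b) ∣ bil ν μ V W := by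
  rw [pow_add]
  refine dvd_sub (dvd_sub (dvd_add ?_ ?_) ?_) ?_
  · exact mul_dvd_mul (hV ν).1 (hW μ).2
  · rw [mul_comm (W.1 ν)]; exact mul_dvd_mul (hV μ).2 (hW ν).1
  · exact mul_dvd_mul (hV ν).2 (hW μ).1
  · rw [mul_comm (W.2 ν)]; exact mul_dvd_mul (hV μ).1 (hW ν).2

/-- The derivative factor `W` has no constant term, so an error in the first factor gains one order.
An error in the second gains the order of vanishing `a` of the first. -/
theorem X_pow_dvd_bil_sub {M a : ℕ} (ha : a ≤ 1) {V V' W W' : V4 (PowerSeries ℝ)}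
    (hV : VDvd (M + 1) (V - V')) (hW : VDvd (M + 1) (W - W')) (hV' : VDvd a V') (hW1 : VDvd 1 W)
    (ν μ : Fin 4) : X ^ (M + 1 + a) ∣ bil ν μ V W - bil ν μ V' W' := by
  have : bil ν μ V W - bil ν μ V' W' = bil ν μ (V - V') W + bil ν μ V' (W - W') := by
    simp only [bil, Prod.fst_sub, Prod.snd_sub, Pi.sub_apply]; ring
  rw [this]
  refine dvd_add ((pow_dvd_pow X ?_).trans (hV.bil_dvd hW1 ν μ))
    ((pow_dvd_pow X ?_).trans (hV'.bil_dvd hW ν μ)) <;> omega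

theorem X_pow_dvd_kbil_sub (k : Fin 3 → ℝ) {M a : ℕ} (ha : a ≤ 1) {V V' W W' : V4 (PowerSeries ℝ)}
    (hV : VDvd (M + 1) (V - V')) (hW : VDvd (M + 1) (W - W')) (hV' : VDvd a V') (hW1 : VDvd 1 W)
    (μ : Fin 4) : X ^ (M + 1 + a) ∣ kbil k μ V W - kbil k μ V' W' := by
  rw [kbil, kbil, ← sum_sub_distrib]
  refine dvd_sum fun i _ => ?_
  rw [← smul_sub]
  exact dvd_smul_of_dvd _ (X_pow_dvd_bil_sub ha hV hW hV' hW1 _ _)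

theorem VDvd.kbil_dvd (k : Fin 3 → ℝ) {b : ℕ} (V : V4 (PowerSeries ℝ)) {W : V4 (PowerSeries ℝ)}
    (hW : VDvd b W) (μ : Fin 4) : X ^ b ∣ kbil k μ V W := by
  refine dvd_sum fun i _ => dvd_smul_of_dvd _ ?_
  simpa using (VDvd.zero V).bil_dvd hW i.castSucc μ

namespace Jet

/-- The orders of vanishing of the series of the front and of the derivatives of the profiles. -/
structure Admissible (J : Jet) : Prop where
  p : X ^ 2 ∣ J.p
  q : ∀ i, X ^ 2 ∣ J.q i
  W : ∀ i, VDvd 1 (J.W i)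

/-- Agreement of the series up to the order at which they enter the sources of step `M`. -/
structure Agree (M : ℕ) (J J' : Jet) : Prop where
  c₀ : X ^ (M + 1) ∣ J.c₀ - J'.c₀
  c₁ : X ^ (M + 1) ∣ J.c₁ - J'.c₁
  p : X ^ (M + 1) ∣ J.p - J'.p
  q : ∀ i, X ^ (M + 1) ∣ J.q i - J'.q i
  q_theta : X ^ (M + 2) ∣ J.q 5 - J'.q 5
  V : VDvd (M + 1) (J.V - J'.V)
  W : ∀ i, VDvd (M + 1) (J.W i - J'.W i)

variable {J J' : Jet} {M : ℕ}

theorem one_dvd_pow (f : PowerSeries ℝ) : X ^ 0 ∣ f := by simp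

theorem Vpos_dvd (J : Jet) : VDvd 1 J.Vpos := fun ν => by
  constructor <;>
  · rw [pow_one, X_dvd_iff]
    simp [Vpos]

/-- The constant terms of the four-vectors, as constant series. -/
noncomputable def Vconst (J : Jet) : V4 (PowerSeries ℝ) :=
  (fun ν => C (coeff 0 (J.V.1 ν)), fun ν => C (coeff 0 (J.V.2 ν)))

theorem Vpos_add_Vconst (J : Jet) : J.Vpos + J.Vconst = J.V := by
  ext <;> simp [Vpos, Vconst]

/-- The terms of the fast operator that contain the last profile. -/
noncomputable def lin (J : Jet) (k : Fin 3 → ℝ) (n : ℕ) (μ : Fin 4) : ℝ :=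
  coeff (n + 1) (kbil k μ J.Vconst (J.W 5)) + coeff (n + 1) (bil 3 μ J.Vconst (J.W 4))

section Congr

variable (h : Agree M J J') (hJ : J.Admissible) (hJ' : J'.Admissible) (k : Fin 3 → ℝ)
include h

theorem Agree.Vconst_eq : J.Vconst = J'.Vconst := by
  refine Prod.ext (funext fun ν => ?_) (funext fun ν => ?_)
  · exact congrArg C (coeff_eq_of_X_pow_dvd (h.V ν).1 (by omega))
  · exact congrArg C (coeff_eq_of_X_pow_dvd (h.V ν).2 (by omega))

theorem Agree.Vpos_sub : VDvd (M + 1) (J.Vpos - J'.Vpos) := by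
  have : J.Vpos - J'.Vpos = J.V - J'.V := by
    rw [← J.Vpos_add_Vconst, ← J'.Vpos_add_Vconst, h.Vconst_eq, add_sub_add_right_eq_sub]
  rw [this]
  exact h.V

include hJ

theorem Agree.lin_eq {n : ℕ} (hn : n + 1 ≤ M) (μ : Fin 4) : J.lin k n μ = J'.lin k n μ := by
  have h0 : VDvd (M + 1) (J.Vconst - J'.Vconst) := by
    rw [h.Vconst_eq, sub_self]; exact fun ν => by simp
  rw [lin, lin]
  congr 1
  · exact coeff_eq_of_X_pow_dvd (X_pow_dvd_kbil_sub k zero_le_one h0 (h.W 5) (VDvd.zero _)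
      (hJ.W 5) μ) (by omega)
  · exact coeff_eq_of_X_pow_dvd (X_pow_dvd_bil_sub zero_le_one h0 (h.W 4) (VDvd.zero _)
      (hJ.W 4) 3 μ) (by omega)

theorem Agree.slowDiv_eq {n : ℕ} (hn : n ≤ M) (μ : Fin 4) :
    J.slowDiv J.V n μ = J'.slowDiv J'.V n μ := by
  rw [slowDiv, slowDiv, map_add, map_add, map_sum, map_sum]
  have hb : ∀ ν i, coeff n (bil ν μ J.V (J.W i)) = coeff n (bil ν μ J'.V (J'.W i)) := fun ν i =>
    coeff_eq_of_X_pow_dvd (X_pow_dvd_bil_sub zero_le_one h.V (h.W i) (VDvd.zero _)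
      (hJ.W i) ν μ) (by omega)
  simp only [hb]

theorem Agree.slowDiv_Vpos_eq {n : ℕ} (hn : n ≤ M + 1) (μ : Fin 4) :
    J.slowDiv J.Vpos n μ = J'.slowDiv J'.Vpos n μ := by
  rw [slowDiv, slowDiv, map_add, map_add, map_sum, map_sum]
  have hb : ∀ ν i, coeff n (bil ν μ J.Vpos (J.W i)) = coeff n (bil ν μ J'.Vpos (J'.W i)) :=
    fun ν i => coeff_eq_of_X_pow_dvd (X_pow_dvd_bil_sub le_rfl h.Vpos_sub (h.W i) J'.Vpos_dvd
      (hJ.W i) ν μ) (by omega)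
  simp only [hb]

include hJ'

theorem Agree.qbil_sub (i : Fin 6) (μ : Fin 4) :
    X ^ (M + 2) ∣ qbil (fun i => J.q (tan i)) μ J.V (J.W i)
      - qbil (fun i => J'.q (tan i)) μ J'.V (J'.W i) := by
  rw [qbil, qbil, ← sum_sub_distrib]
  refine dvd_sum fun r _ => X_pow_dvd_mul_sub_mul (h.q _)
    (X_pow_dvd_bil_sub zero_le_one h.V (h.W i) (VDvd.zero _) (hJ.W i) _ μ)
    (hJ'.q _) ((VDvd.zero _).bil_dvd (hJ.W i) _ μ) ?_ ?_ <;> omega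

/-- Terms with the `θ`-slope of the front are read one order further than those with its slow
slopes. The extra agreement `q_theta` pays for that, and no other information on the last front
profile is needed. -/
theorem Agree.front_sub (i : Fin 6) (μ : Fin 4) :
    X ^ (M + 3) ∣ J.q 5 * kbil k μ J.V (J.W i) - J'.q 5 * kbil k μ J'.V (J'.W i) := by
  refine X_pow_dvd_mul_sub_mul h.q_theta
    (X_pow_dvd_kbil_sub k zero_le_one h.V (h.W i) (VDvd.zero _) (hJ.W i) μ)
    (hJ'.q _) (VDvd.kbil_dvd k _ (hJ.W i) μ) ?_ ?_ <;> omega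

theorem Agree.chiPart_eq {n : ℕ} (hn : n ≤ M + 1) (μ : Fin 4) :
    J.chiPart k n μ = J'.chiPart k n μ := by
  have hqb : X ^ 2 ∣ qbil (fun i => J.q (tan i)) μ J.V (J.W 3) :=
    dvd_sum fun r _ => (hJ.q _).mul_right _
  have hfr : X ^ (2 + 1) ∣ J.q 5 * kbil k μ J.V (J.W 3) := by
    rw [pow_add]; exact mul_dvd_mul (hJ.q 5) (VDvd.kbil_dvd k _ (hJ.W 3) μ)
  have hpb : X ^ 2 ∣ J.p * bil 3 μ J.V (J.W 3) := hJ.p.mul_right _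
  have hp : X ^ (M + 2) ∣ J.p * bil 3 μ J.V (J.W 3) - J'.p * bil 3 μ J'.V (J'.W 3) := by
    refine X_pow_dvd_mul_sub_mul h.p
      (X_pow_dvd_bil_sub zero_le_one h.V (h.W 3) (VDvd.zero _) (hJ.W 3) 3 μ)
      hJ'.p ((VDvd.zero _).bil_dvd (hJ.W 3) 3 μ) ?_ ?_ <;> omega
  rw [chiPart, chiPart]
  congr 1
  · congr 1
    · exact coeff_eq_of_X_pow_dvd (X_pow_dvd_mul_sub_mul (n := M + 2) h.c₀ (h.qbil_sub hJ hJ' 3 μ)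
        (one_dvd_pow _) hqb (by omega) (by omega)) (by omega)
    · exact coeff_eq_of_X_pow_dvd (X_pow_dvd_mul_sub_mul (n := M + 3) h.c₀
        (h.front_sub hJ hJ' k 3 μ) (one_dvd_pow _) hfr (by omega) (by omega)) (by omega)
  · exact coeff_eq_of_X_pow_dvd (X_pow_dvd_mul_sub_mul (n := M + 2) h.c₁ hp
      (one_dvd_pow _) hpb (by omega) (by omega)) (by omega)

theorem Agree.slowSrc_eq {n : ℕ} (hn : n ≤ M + 1) (μ : Fin 4) :
    J.slowSrc k n μ = J'.slowSrc k n μ := by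
  rw [slowSrc, slowSrc, h.chiPart_eq hJ hJ' k hn, h.slowDiv_Vpos_eq hJ hn]

theorem Agree.src_eq {n : ℕ} (hn : n ≤ M) (μ : Fin 4) : J.src k n μ = J'.src k n μ := by
  rw [src, src, h.chiPart_eq hJ hJ' k (by omega), h.slowDiv_eq hJ hn]
  congr 1
  · congr 1
    · congr 1
      · congr 1
        exact coeff_eq_of_X_pow_dvd (X_pow_dvd_kbil_sub k le_rfl h.Vpos_sub (h.W 5) J'.Vpos_dvd
          (hJ.W 5) μ) (by omega)
      · exact coeff_eq_of_X_pow_dvd (X_pow_dvd_bil_sub le_rfl h.Vpos_sub (h.W 4) J'.Vpos_dvd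
          (hJ.W 4) 3 μ) (by omega)
    · exact coeff_eq_of_X_pow_dvd (h.front_sub hJ hJ' k 4 μ) (by omega)
  · exact coeff_eq_of_X_pow_dvd (h.qbil_sub hJ hJ' 4 μ) (by omega)

end Congr

end Jet

/-! ### The residuals and the sources -/

section Residual

set_option linter.unusedSectionVars false

variable {A : Type*} [CommRing A] [Algebra ℝ A] (φ : A →ₐ[ℝ] ℝ)
variable (d : Fin 6 → Derivation ℝ A A) (k : Fin 3 → ℝ) (Φ C₀ C₁ : PowerSeries A)
variable (w b : Fin 4 → PowerSeries A)

/-- The values at a point of formal series. -/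
noncomputable def jetOf : Jet where
  c₀ := PowerSeries.map (φ : A →+* ℝ) C₀
  c₁ := PowerSeries.map (φ : A →+* ℝ) C₁
  p := PowerSeries.map (φ : A →+* ℝ) (X ^ 2 * Φ)
  q i := PowerSeries.map (φ : A →+* ℝ) (liftDer (d i) (X ^ 2 * Φ))
  V := (fun ν => PowerSeries.map (φ : A →+* ℝ) (w ν), fun ν => PowerSeries.map (φ : A →+* ℝ) (b ν))
  W i := (fun ν => PowerSeries.map (φ : A →+* ℝ) (liftDer (d i) (w ν)),
    fun ν => PowerSeries.map (φ : A →+* ℝ) (liftDer (d i) (b ν)))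

/-- The four-vectors of the derivatives of formal series. -/
noncomputable def dV (i : Fin 6) : V4 (PowerSeries A) :=
  (fun ν => liftDer (d i) (w ν), fun ν => liftDer (d i) (b ν))

/-- The straightened derivatives, without the cut-off in the derivatives in `Y₃`. -/
noncomputable def EY (μ : Fin 4) : Derivation ℝ (PowerSeries A) (PowerSeries A) :=
  Fin.lastCases (motive := fun _ => Derivation ℝ (PowerSeries A) (PowerSeries A))
    (((1 - C₁ * (X ^ 2 * Φ)) * X ^ 2) • liftDer (d 3) + (X : PowerSeries A) • liftDer (d 4))
    (fun i => nab d k i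
      - nab d k i Φ • ((C₀ * X ^ 2) • liftDer (d 3) + (X : PowerSeries A) • liftDer (d 4))) μ

theorem EY_castSucc (i : Fin 3) (f : PowerSeries A) :
    EY d k Φ C₀ C₁ i.castSucc f = nab d k i f
      - nab d k i Φ * (C₀ * X ^ 2 * liftDer (d 3) f + X * liftDer (d 4) f) := by
  simp [EY, mul_add]

theorem EY_last (f : PowerSeries A) :
    EY d k Φ C₀ C₁ 3 f
      = (1 - C₁ * (X ^ 2 * Φ)) * X ^ 2 * liftDer (d 3) f + X * liftDer (d 4) f := by
  rw [show (3 : Fin 4) = Fin.last 3 from rfl, EY, Fin.lastCases_last]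
  rfl

/-- The residuals of the cascade. -/
noncomputable def ResY (μ : Fin 4) : PowerSeries A :=
  ∑ ν, EY d k Φ C₀ C₁ ν (w ν * b μ - b ν * w μ)

/-- In the cascade the factor `χ(x₃)` multiplies `∂_{y₃}` but not `∂_{Y₃}`, and similarly for
`χ'(x₃)`. So `EY` is the operator that generates the sources, while `ED` is the one that commutes.
They coincide on functions without `Y₃`, and, in `EY_one_zero`, where the cut-off is `1`; the two
identities are proved in these two situations. -/
theorem EY_eq_ED {f : PowerSeries A} (hf : liftDer (d 4) f = 0) (μ : Fin 4) :
    EY d k Φ C₀ C₁ μ f = ED d k Φ C₀ C₁ μ f := by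
  induction μ using Fin.lastCases with
  | last =>
    rw [show Fin.last 3 = 3 from rfl, EY_last, ED_last, dn_apply, hf]
    ring
  | cast i =>
    rw [EY_castSucc, ED_castSucc, dn_apply, hf]
    ring

theorem EY_one_zero (μ : Fin 4) (f : PowerSeries A) :
    EY d k Φ 1 0 μ f = ED d k Φ 1 0 μ f := by
  induction μ using Fin.lastCases with
  | last =>
    rw [show Fin.last 3 = 3 from rfl, EY_last, ED_last, dn_apply]
    ring
  | cast i =>
    rw [EY_castSucc, ED_castSucc, dn_apply]
    ring

theorem ResY_eq_Res (hw : ∀ ν, liftDer (d 4) (w ν) = 0) (hb : ∀ ν, liftDer (d 4) (b ν) = 0)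
    (μ : Fin 4) : ResY d k Φ C₀ C₁ w b μ = Res d k Φ C₀ C₁ w b μ :=
  sum_congr rfl fun ν _ => EY_eq_ED d k Φ C₀ C₁ (by simp [Derivation.leibniz, hw, hb]) ν

theorem ResY_one_zero (μ : Fin 4) : ResY d k Φ 1 0 w b μ = Res d k Φ 1 0 w b μ :=
  sum_congr rfl fun ν _ => EY_one_zero d k Φ ν _

/-- Leibniz rule: a derivative of the quadratic tensor is its polarization `bil` at the field and
its derivative. Grouping by powers of `X` exposes the families of terms of the cascade. -/
theorem ResY_eq (μ : Fin 4) : ResY d k Φ C₀ C₁ w b μ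
    = X ^ 2 * (∑ i : Fin 3, bil i.castSucc μ (w, b) (dV d w b (tan i))
        + bil 3 μ (w, b) (dV d w b 3))
      + X * (kbil k μ (w, b) (dV d w b 5) + bil 3 μ (w, b) (dV d w b 4))
      - X ^ 2 * (C₀ * qbil (fun i => liftDer (d (tan i)) (X ^ 2 * Φ)) μ (w, b) (dV d w b 3))
      - X * (C₀ * (liftDer (d 5) (X ^ 2 * Φ) * kbil k μ (w, b) (dV d w b 3)))
      - X * qbil (fun i => liftDer (d (tan i)) (X ^ 2 * Φ)) μ (w, b) (dV d w b 4)
      - liftDer (d 5) (X ^ 2 * Φ) * kbil k μ (w, b) (dV d w b 4)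
      - X ^ 2 * (C₁ * ((X ^ 2 * Φ) * bil 3 μ (w, b) (dV d w b 3))) := by
  have hk : ∀ i (f : PowerSeries A), k i • f = C (algebraMap ℝ A (k i)) * f := fun i f => by
    ext n; rw [coeff_smul, coeff_C_mul, Algebra.smul_def]
  have hΨ : ∀ i, liftDer (d i) (X ^ 2 * Φ) = X ^ 2 * liftDer (d i) Φ := fun i => by
    simp [Derivation.leibniz]
  rw [ResY, sum_univ_castSucc_three]
  simp only [EY_last, EY_castSucc, nab_apply, hΨ, kbil, qbil, hk, Fin.sum_univ_three, bil, dV,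
    map_sub, Derivation.leibniz, smul_eq_mul]
  ring

theorem map_bil (V W : V4 (PowerSeries A)) (ν μ : Fin 4) :
    PowerSeries.map (φ : A →+* ℝ) (bil ν μ V W)
      = bil ν μ (fun r => PowerSeries.map (φ : A →+* ℝ) (V.1 r),
          fun r => PowerSeries.map (φ : A →+* ℝ) (V.2 r))
        (fun r => PowerSeries.map (φ : A →+* ℝ) (W.1 r),
          fun r => PowerSeries.map (φ : A →+* ℝ) (W.2 r)) := by
  simp [bil]

theorem map_kbil (V W : V4 (PowerSeries A)) (μ : Fin 4) :
    PowerSeries.map (φ : A →+* ℝ) (kbil k μ V W)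
      = kbil k μ (fun r => PowerSeries.map (φ : A →+* ℝ) (V.1 r),
          fun r => PowerSeries.map (φ : A →+* ℝ) (V.2 r))
        (fun r => PowerSeries.map (φ : A →+* ℝ) (W.1 r),
          fun r => PowerSeries.map (φ : A →+* ℝ) (W.2 r)) := by
  have hs : ∀ (c : ℝ) (f : PowerSeries A),
      PowerSeries.map (φ : A →+* ℝ) (c • f) = c • PowerSeries.map (φ : A →+* ℝ) f := fun c f => by
    ext n; simp
  simp only [kbil, map_sum, hs, map_bil]

theorem map_qbil (q : Fin 3 → PowerSeries A) (V W : V4 (PowerSeries A)) (μ : Fin 4) :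
    PowerSeries.map (φ : A →+* ℝ) (qbil q μ V W)
      = qbil (fun i => PowerSeries.map (φ : A →+* ℝ) (q i)) μ
        (fun r => PowerSeries.map (φ : A →+* ℝ) (V.1 r),
          fun r => PowerSeries.map (φ : A →+* ℝ) (V.2 r))
        (fun r => PowerSeries.map (φ : A →+* ℝ) (W.1 r),
          fun r => PowerSeries.map (φ : A →+* ℝ) (W.2 r)) := by
  simp only [qbil, map_sum, map_mul, map_bil]

variable {φ d k Φ C₀ C₁ w b}

theorem bil_add_left {R : Type*} [CommRing R] (ν μ : Fin 4) (V V' W : V4 R) :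
    bil ν μ (V + V') W = bil ν μ V W + bil ν μ V' W := by
  simp only [bil, Prod.fst_add, Prod.snd_add, Pi.add_apply]; ring

theorem kbil_add_left {R : Type*} [CommRing R] [Algebra ℝ R] (μ : Fin 4) (V V' W : V4 R) :
    kbil k μ (V + V') W = kbil k μ V W + kbil k μ V' W := by
  simp only [kbil, bil_add_left, smul_add, sum_add_distrib]

/-- The shift by two is the factor `ε²` in the straightened derivatives: coefficient `n + 2` pairs
the fast operator on profile `n + 1` with the source of index `n`. -/
theorem apply_coeff_ResY (n : ℕ) (μ : Fin 4) :
    φ (coeff (n + 2) (ResY d k Φ C₀ C₁ w b μ))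
      = (jetOf φ d Φ C₀ C₁ w b).lin k n μ - (jetOf φ d Φ C₀ C₁ w b).src k n μ := by
  set J := jetOf φ d Φ C₀ C₁ w b with hJ
  have hmap : PowerSeries.map (φ : A →+* ℝ) (ResY d k Φ C₀ C₁ w b μ)
      = X ^ 2 * (∑ i : Fin 3, bil i.castSucc μ J.V (J.W (tan i)) + bil 3 μ J.V (J.W 3))
      + X * (kbil k μ J.V (J.W 5) + bil 3 μ J.V (J.W 4))
      - X ^ 2 * (J.c₀ * qbil (fun i => J.q (tan i)) μ J.V (J.W 3))
      - X * (J.c₀ * (J.q 5 * kbil k μ J.V (J.W 3)))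
      - X * qbil (fun i => J.q (tan i)) μ J.V (J.W 4)
      - J.q 5 * kbil k μ J.V (J.W 4)
      - X ^ 2 * (J.c₁ * (J.p * bil 3 μ J.V (J.W 3))) := by
    rw [ResY_eq]
    simp only [map_sub, map_add, map_mul, map_pow, PowerSeries.map_X, map_sum, map_bil, map_kbil,
      map_qbil, hJ, jetOf, dV]
  have hφ : φ (coeff (n + 2) (ResY d k Φ C₀ C₁ w b μ))
      = coeff (n + 2) (PowerSeries.map (φ : A →+* ℝ) (ResY d k Φ C₀ C₁ w b μ)) := by
    rw [coeff_map]; rfl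
  rw [hφ, hmap]
  simp only [map_sub, map_add, coeff_X_pow_mul,
    show ∀ f : PowerSeries ℝ, coeff (n + 2) (X * f) = coeff (n + 1) f from
      fun f => coeff_succ_X_mul (n + 1) f, Jet.lin, Jet.src, Jet.chiPart, Jet.slowDiv]
  -- Separating the constant term of the fields isolates the fast operator from the quadratic fast
  -- source.
  have e1 : coeff (n + 1) (kbil k μ J.V (J.W 5)) = coeff (n + 1) (kbil k μ J.Vpos (J.W 5))
      + coeff (n + 1) (kbil k μ J.Vconst (J.W 5)) := by
    rw [← map_add, ← kbil_add_left, J.Vpos_add_Vconst]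
  have e2 : coeff (n + 1) (bil 3 μ J.V (J.W 4)) = coeff (n + 1) (bil 3 μ J.Vpos (J.W 4))
      + coeff (n + 1) (bil 3 μ J.Vconst (J.W 4)) := by
    rw [← map_add, ← bil_add_left, J.Vpos_add_Vconst]
  rw [e1, e2]
  ring

end Residual

end CurrentVortexSheet

namespace CurrentVortexSheet

open PowerSeries

/-! ### Constant coefficients -/

/-- The coefficients number `n` of four-vectors of series. -/
noncomputable def V4.coeffs (n : ℕ) (W : V4 (PowerSeries ℝ)) : V4 ℝ :=
  (fun ν => coeff n (W.1 ν), fun ν => coeff n (W.2 ν))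

namespace Jet

variable (J : Jet) (k : Fin 3 → ℝ)

theorem coeff_bil_Vconst (n : ℕ) (ν μ : Fin 4) (W : V4 (PowerSeries ℝ)) :
    coeff n (bil ν μ J.Vconst W) = bil ν μ (V4.coeffs 0 J.V) (V4.coeffs n W) := by
  simp only [bil, Vconst, V4.coeffs, map_add, map_sub, mul_comm _ (C _), coeff_C_mul]
  ring

theorem coeff_kbil_Vconst (n : ℕ) (μ : Fin 4) (W : V4 (PowerSeries ℝ)) :
    coeff n (kbil k μ J.Vconst W) = kbil k μ (V4.coeffs 0 J.V) (V4.coeffs n W) := by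
  simp only [kbil, map_sum, PowerSeries.coeff_smul, coeff_bil_Vconst]

theorem lin_eq (n : ℕ) (μ : Fin 4) : J.lin k n μ
    = kbil k μ (V4.coeffs 0 J.V) (V4.coeffs (n + 1) (J.W 5))
      + bil 3 μ (V4.coeffs 0 J.V) (V4.coeffs (n + 1) (J.W 4)) := by
  rw [lin, coeff_kbil_Vconst, coeff_bil_Vconst]

theorem slowDiv_V_eq {n : ℕ} (hW : ∀ i, V4.coeffs n (J.W i) = 0) (μ : Fin 4) :
    J.slowDiv J.V n μ = J.slowDiv J.Vpos n μ := by
  have h : ∀ ν i, coeff n (bil ν μ J.V (J.W i)) = coeff n (bil ν μ J.Vpos (J.W i)) := by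
    intro ν i
    rw [← J.Vpos_add_Vconst, bil_add_left, map_add, coeff_bil_Vconst, hW, bil_zero_right, add_zero]
  simp only [slowDiv, map_add, map_sum, h]

theorem lin_eq_zero {n : ℕ} (h5 : V4.coeffs (n + 1) (J.W 5) = 0)
    (h4 : V4.coeffs (n + 1) (J.W 4) = 0) (μ : Fin 4) : J.lin k n μ = 0 := by
  rw [lin_eq, h4, h5, bil_zero_right, kbil_zero_right, add_zero]

/-- The relation between the two kinds of sources when nothing depends on `Y₃`. -/
theorem lin_sub_src_eq {n : ℕ} (hW : ∀ i, V4.coeffs n (J.W i) = 0) (h4 : J.W 4 = 0) (μ : Fin 4) :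
    J.lin k n μ - J.src k n μ = coeff (n + 1) (kbil k μ J.V (J.W 5)) - J.slowSrc k n μ := by
  have e1 : coeff (n + 1) (kbil k μ J.V (J.W 5)) = coeff (n + 1) (kbil k μ J.Vpos (J.W 5))
      + coeff (n + 1) (kbil k μ J.Vconst (J.W 5)) := by
    rw [← map_add, ← kbil_add_left, J.Vpos_add_Vconst]
  rw [lin, src, slowSrc, J.slowDiv_V_eq hW, e1, h4]
  simp only [bil_zero_right, kbil_zero_right, qbil_zero_right, mul_zero, map_zero]
  ring

end Jet

section

variable {A : Type*} [CommRing A] [Algebra ℝ A] {φ : A →ₐ[ℝ] ℝ}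
variable {d : Fin 6 → Derivation ℝ A A} {k : Fin 3 → ℝ} {Φ C₀ C₁ : PowerSeries A}
variable {w b : Fin 4 → PowerSeries A}

variable (k w b) in
/-- The fast flux of the residuals. -/
noncomputable def fastFlux (μ : Fin 4) : PowerSeries A :=
  ∑ i : Fin 3, k i • (w i.castSucc * b μ - b i.castSucc * w μ)

theorem liftDer_fastFlux (μ : Fin 4) :
    liftDer (d 5) (fastFlux k w b μ) = kbil k μ (w, b) (dV d w b 5) := by
  simp only [fastFlux, kbil, bil, dV, map_sum, Derivation.map_smul, map_sub, Derivation.leibniz,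
    smul_eq_mul]
  refine sum_congr rfl fun i _ => ?_
  congr 1
  ring

theorem coeffs_jetOf_W {n : ℕ} (hw : ∀ ν, coeff n (w ν) = 0) (hb : ∀ ν, coeff n (b ν) = 0)
    (i : Fin 6) : V4.coeffs n ((jetOf φ d Φ C₀ C₁ w b).W i) = 0 := by
  refine Prod.ext (funext fun ν => ?_) (funext fun ν => ?_)
  · simp [V4.coeffs, jetOf, coeff_liftDer, hw]
  · simp [V4.coeffs, jetOf, coeff_liftDer, hb]

theorem apply_coeff_ResY_of_coeff_eq_zero {n : ℕ} (hw : ∀ ν, coeff (n + 1) (w ν) = 0)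
    (hb : ∀ ν, coeff (n + 1) (b ν) = 0) (μ : Fin 4) :
    φ (coeff (n + 2) (ResY d k Φ C₀ C₁ w b μ)) = -(jetOf φ d Φ C₀ C₁ w b).src k n μ := by
  rw [apply_coeff_ResY, Jet.lin_eq_zero _ _ (coeffs_jetOf_W hw hb 5) (coeffs_jetOf_W hw hb 4),
    zero_sub]

/-- Without `Y₃`, the only fast terms outside `slowSrc` are those in `∂_θ`. Linear and quadratic
parts together form an exact `θ`-derivative, which averaging removes. -/
theorem apply_coeff_ResY_slow {n : ℕ} (hw : ∀ ν, coeff n (w ν) = 0)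
    (hb : ∀ ν, coeff n (b ν) = 0) (hw4 : ∀ ν, liftDer (d 4) (w ν) = 0)
    (hb4 : ∀ ν, liftDer (d 4) (b ν) = 0) (μ : Fin 4) :
    φ (coeff (n + 2) (ResY d k Φ C₀ C₁ w b μ)) = φ (d 5 (coeff (n + 1) (fastFlux k w b μ)))
      - (jetOf φ d Φ C₀ C₁ w b).slowSrc k n μ := by
  have h4 : (jetOf φ d Φ C₀ C₁ w b).W 4 = 0 :=
    Prod.ext (funext fun ν => by simp [jetOf, hw4]) (funext fun ν => by simp [jetOf, hb4])
  rw [apply_coeff_ResY, Jet.lin_sub_src_eq _ _ (coeffs_jetOf_W hw hb) h4, ← coeff_liftDer,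
    liftDer_fastFlux]
  congr 1
  have := congrArg (coeff (n + 1)) (map_kbil φ (k := k) (w, b) (dV d w b 5) μ)
  rw [coeff_map] at this
  exact this.symm

/-- The coefficients of orders `0` and `1` vanish when the leading profiles are constant and the
front is of order `2`. -/
theorem coeff_ResY_of_lt_two (hd0 : ∀ i ν, d i (coeff 0 (w ν)) = 0)
    (hb0 : ∀ i ν, d i (coeff 0 (b ν)) = 0) {n : ℕ} (hn : n < 2) (μ : Fin 4) :
    coeff n (ResY d k Φ C₀ C₁ w b μ) = 0 := by
  have hX : ∀ f : PowerSeries A, X ^ 2 ∣ f ↔ coeff 0 f = 0 ∧ coeff 1 f = 0 := fun f => by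
    rw [X_pow_dvd_iff]
    refine ⟨fun h => ⟨h 0 (by omega), h 1 (by omega)⟩, fun h m hm => ?_⟩
    interval_cases m
    · exact h.1
    · exact h.2
  have hf : ∀ i (f : PowerSeries A), d i (coeff 0 f) = 0 → X ^ 2 ∣ X * liftDer (d i) f := by
    intro i f h
    rw [pow_two]
    refine mul_dvd_mul_left _ ?_
    rw [X_dvd_iff, ← coeff_zero_eq_constantCoeff_apply, coeff_liftDer, h]
  suffices X ^ 2 ∣ ResY d k Φ C₀ C₁ w b μ from X_pow_dvd_iff.1 this n hn
  refine dvd_sum fun ν _ => ?_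
  have h0 : ∀ i, d i (coeff 0 (w ν * b μ - b ν * w μ)) = 0 := fun i => by
    simp only [map_sub, coeff_zero_mul_eq, Derivation.leibniz, hd0, hb0, smul_zero, add_zero,
      sub_zero]
  generalize w ν * b μ - b ν * w μ = f at h0
  have hnab : ∀ (i : Fin 3) (f : PowerSeries A), d 5 (coeff 0 f) = 0 → X ^ 2 ∣ nab d k i f := by
    intro i f h
    rw [nab_apply, mul_smul_comm]
    exact dvd_add (dvd_mul_right _ _) (dvd_smul_of_dvd _ (hf 5 f h))
  induction ν using Fin.lastCases with
  | last =>
    rw [show Fin.last 3 = 3 from rfl, EY_last]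
    exact dvd_add ((dvd_mul_left _ _).mul_right _) (hf 4 f (h0 4))
  | cast i =>
    rw [EY_castSucc]
    exact dvd_sub (hnab i f (h0 5))
      (dvd_mul_of_dvd_right (dvd_add ((dvd_mul_left _ _).mul_right _) (hf 4 f (h0 4))) _)

end

namespace Params

variable {P : Params} {s : Side} {U : ℕ → Comp → Pt → ℝ} {ψ : ℕ → Pt → ℝ} {x : Pt}

theorem jet_lin_mag (hU : ∀ k y, U 0 k y = P.U0 s k) (n : ℕ) (i : Fin 3) :
    (P.jet s U ψ x).lin P.wave n i.succ = P.Lf s U (n + 1) (.mag i) x := by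
  have hV : V4.coeffs 0 (P.jet s U ψ x).V = st 1 (P.U0 s) := by
    rw [← Vseq_zero (x := x) hU]
    simp [V4.coeffs, jet, ser]
  have hW : ∀ r, V4.coeffs (n + 1) ((P.jet s U ψ x).W r) = st 0 (P.dU s U r (n + 1) x) := fun r => by
    simp [V4.coeffs, jet, ser, Wseq]
  rw [Jet.lin_eq, hV, hW, hW, kbil_succ_st_one, show (3 : Fin 4) = Fin.succ 2 from rfl,
    bil_succ_succ_st_one, Lf, add_comm]

theorem jet_lin_zero (hU : ∀ k y, U 0 k y = P.U0 s k) (n : ℕ) :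
    (P.jet s U ψ x).lin P.wave n 0 = -(P.d s 4 (U (n + 1) (.mag 2)) x
      + ∑ j : Fin 2, P.xi j * P.d s 5 (U (n + 1) (.mag j.castSucc)) x) := by
  have hV : V4.coeffs 0 (P.jet s U ψ x).V = st 1 (P.U0 s) := by
    rw [← Vseq_zero (x := x) hU]
    simp [V4.coeffs, jet, ser]
  have hW : ∀ r, V4.coeffs (n + 1) ((P.jet s U ψ x).W r) = st 0 (P.dU s U r (n + 1) x) := fun r => by
    simp [V4.coeffs, jet, ser, Wseq]
  rw [Jet.lin_eq, hV, hW, hW, kbil_zero_st, show (3 : Fin 4) = Fin.succ 2 from rfl,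
    bil_succ_zero_st]
  simp only [dU, one_mul]
  ring

end Params

end CurrentVortexSheet

namespace CurrentVortexSheet

open PowerSeries

/-! ### Partial derivatives on subdomains -/

theorem pd_subset {D D' : Set Pt} (hD : UniqueDiffOn ℝ D) (h : D ⊆ D') {f : Pt → ℝ}
    (hf : ContDiffOn ℝ ∞ f D') (i : Fin 6) {x : Pt} (hx : x ∈ D) : pd D i f x = pd D' i f x := by
  rw [pd, pd, fderivWithin_subset h (hD x hx) ((hf x (h hx)).differentiableWithinAt (by simp))]

namespace Box

variable {B : Box}

theorem update_mem_of_mem {x y : Pt} (hx : x ∈ B.set) (hy : y ∈ B.set) (i : Fin 6) :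
    Function.update y i (x i) ∈ B.set := by
  have h : ∀ j, Function.update y i (x i) j = x j ∨ Function.update y i (x i) j = y j := fun j => by
    rcases eq_or_ne j i with rfl | hj
    · simp
    · simp [hj]
  refine ⟨?_, ?_, ?_⟩
  · rcases h 0 with e | e <;> rw [e]
    exacts [hx.1, hy.1]
  · rcases h 3 with e | e <;> rw [e]
    exacts [hx.2.1, hy.2.1]
  · rcases h 4 with e | e <;> rw [e]
    exacts [hx.2.2, hy.2.2]

/-- The function equals its composition with the affine map freezing coordinate `i`. That map sends
the box to itself, so the chain rule within the box applies, and its linear part kills direction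
`i`. -/
theorem pd_eq_zero_of_indepOf {f : Pt → ℝ} {i : Fin 6} (hf : IndepOf i f)
    (hs : ContDiffOn ℝ ∞ f B.set) {x : Pt} (hx : x ∈ B.set) : pd B.set i f x = 0 := by
  have hd : HasFDerivWithinAt f (fderivWithin ℝ f B.set x) B.set x :=
    ((hs x hx).differentiableWithinAt (by simp)).hasFDerivWithinAt
  set K : Pt →L[ℝ] Pt := ContinuousLinearMap.id ℝ Pt
    - (ContinuousLinearMap.proj (R := ℝ) (φ := fun _ : Fin 6 => ℝ) i).smulRight (Pi.single i 1)
    with hK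
  have hupd : ∀ y : Pt, Function.update y i (x i) = K y + Pi.single i (x i) := fun y => by
    ext j
    rcases eq_or_ne j i with rfl | hj
    · simp [hK]
    · simp [hK, hj]
  have hu : HasFDerivWithinAt (fun y : Pt => Function.update y i (x i)) K B.set x := by
    simp only [hupd]
    exact (K.hasFDerivAt.add_const _).hasFDerivWithinAt
  have hx' : Function.update x i (x i) = x := Function.update_eq_self i x
  have hc := HasFDerivWithinAt.comp (t := B.set) x (by rw [hx']; exact hd) hu
    (fun y hy => update_mem_of_mem hx hy i)
  have hc' : HasFDerivWithinAt f ((fderivWithin ℝ f B.set x).comp K) B.set x :=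
    hc.congr (fun y _ => (hf y (x i)).symm) (hf x (x i)).symm
  rw [pd, hc'.fderivWithin (B.uniqueDiffOn x hx)]
  simp [hK]

theorem der_mk_eq_zero {f : Pt → ℝ} (hf : ContDiffOn ℝ ∞ f B.set)
    (hp : ∀ x, f (Function.update x 5 (x 5 + 2 * Real.pi)) = f x) {i : Fin 6} (hi : IndepOf i f) :
    B.der i (Fn.mk f hf hp) = 0 := by
  rw [Fn.ext_iff_fn]
  intro x hx
  rw [Fn.fn_zero hx, fn_der _ _ hx, pd_congr (fun y hy => Fn.fn_mk hf hp hy) hx,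
    pd_eq_zero_of_indepOf hi hf hx]

theorem fn_der_mk {f : Pt → ℝ} (hf : ContDiffOn ℝ ∞ f B.set)
    (hp : ∀ x, f (Function.update x 5 (x 5 + 2 * Real.pi)) = f x) (i : Fin 6) {x : Pt}
    (hx : x ∈ B.set) : (B.der i (Fn.mk f hf hp)).fn x = pd B.set i f x := by
  rw [fn_der _ _ hx, pd_congr (fun y hy => Fn.fn_mk hf hp hy) hx]

/-- Exponential decay of the difference with a function that does not depend on `Y₃`. -/
theorem FarEq.of_decay {f g : B.Fn} (hg : B.der 4 g = 0) {δ C : ℝ} (hδ : 0 < δ)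
    (h : ∀ x ∈ B.set, |f.fn x - g.fn x| ≤ C * Real.exp (-δ * |x 4|)) : FarEq f g := fun x => by
  refine ⟨(FarEq.refl hg x).1, ?_⟩
  rw [Asymptotics.isLittleO_one_iff]
  have h1 : Filter.Tendsto (fun p : ℝ × ℝ => C * Real.exp (-δ * p.1)) (farFilter (x : Pt))
      (nhds 0) := by
    have h2 : Filter.Tendsto (fun r : ℝ => -δ * r) Filter.atTop Filter.atBot :=
      Filter.tendsto_id.const_mul_atTop_of_neg (by linarith)
    simpa [farFilter] using ((Real.tendsto_exp_atBot.comp h2).comp Filter.tendsto_fst).const_mul C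
  refine squeeze_zero_norm' ?_ h1
  filter_upwards [eventually_farFilter (x : Pt)] with p hp
  have := h _ (farPt_mem x hp.1)
  have h4 : |farPt x p 4| = p.1 := by
    rw [farPt, Function.update_self, abs_mul, abs_of_nonneg hp.1]
    cases B.s <;> simp [Side.sgn]
  rw [h4] at this
  exact this

/-! ### Traces on `y₃ = Y₃ = 0` -/

theorem atZero_mem {x : Pt} (hx : x 0 ∈ Set.Icc 0 B.T) : atZero x ∈ B.set := by
  have ha := B.a_pos
  refine ⟨?_, ?_, ?_⟩
  · simpa [atZero] using hx
  · simp [atZero, ha.le]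
  · simp [atZero]

theorem atZero_update_five (x : Pt) (θ : ℝ) :
    atZero (Function.update x 5 θ) = Function.update (atZero x) 5 θ := by
  ext j
  fin_cases j <;> simp [atZero]

/-- The derivatives of a trace. -/
theorem pd_comp_atZero {D : Set Pt} (hD : UniqueDiffOn ℝ D) (hmap : ∀ y ∈ D, y 0 ∈ Set.Icc 0 B.T)
    {f : Pt → ℝ} {x : Pt} (hx : x ∈ D) (hf : DifferentiableWithinAt ℝ f B.set (atZero x))
    {i : Fin 6} (h3 : i ≠ 3) (h4 : i ≠ 4) :
    pd D i (fun y => f (atZero y)) x = pd B.set i f (atZero x) := by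
  set K : Pt →L[ℝ] Pt := ContinuousLinearMap.pi fun j =>
    if j = 3 ∨ j = 4 then 0 else ContinuousLinearMap.proj j with hK
  have hat : ∀ y : Pt, atZero y = K y := fun y => by
    ext j
    fin_cases j <;> simp [hK, atZero]
  have hu : HasFDerivWithinAt atZero K D x := by
    rw [show atZero = fun y => K y from funext hat]
    exact K.hasFDerivAt.hasFDerivWithinAt
  have hc := HasFDerivWithinAt.comp (t := B.set) x hf.hasFDerivWithinAt hu
    (fun y hy => atZero_mem (hmap y hy))
  have hs : K (Pi.single i 1) = Pi.single i (1 : ℝ) := by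
    ext j
    by_cases hj : j = 3 ∨ j = 4
    · rcases hj with rfl | rfl
      · simp [hK, h3.symm]
      · simp [hK, h4.symm]
    · simp [hK, hj]
  rw [pd, show (fun y => f (atZero y)) = f ∘ atZero from rfl, hc.fderivWithin (hD x hx), pd,
    ContinuousLinearMap.comp_apply, hs]

theorem mean_comp_atZero (f : Pt → ℝ) (x : Pt) :
    mean (fun y => f (atZero y)) x = mean f (atZero x) := by
  simp only [mean, atZero_update_five]

variable (B) in
/-- The ideal of the functions that vanish for `y₃ = Y₃ = 0`. -/
noncomputable def traceZero : Ideal B.Fn where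
  carrier := {f | ∀ x ∈ B.set, f.fn (atZero x) = 0}
  add_mem' {f g} hf hg x hx := by rw [Fn.fn_add _ _ (atZero_mem hx.1), hf x hx, hg x hx, add_zero]
  zero_mem' x hx := Fn.fn_zero (atZero_mem hx.1)
  smul_mem' c f hf x hx := by rw [smul_eq_mul, Fn.fn_mul _ _ (atZero_mem hx.1), hf x hx, mul_zero]

theorem der_mem_traceZero {f : B.Fn} (hf : f ∈ B.traceZero) {i : Fin 6} (h3 : i ≠ 3) (h4 : i ≠ 4) :
    B.der i f ∈ B.traceZero := fun x hx => by
  rw [fn_der _ _ (atZero_mem hx.1), ← pd_comp_atZero B.uniqueDiffOn (fun y hy => hy.1) hx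
    (f.differentiableWithinAt (atZero_mem hx.1)) h3 h4,
    pd_congr (g := fun _ => (0 : ℝ)) hf hx]
  simp [pd]

theorem avg_eq_of_sub_mem_traceZero {f g : B.Fn} (h : f - g ∈ B.traceZero) {x : Pt}
    (hx : x ∈ B.set) : avg ⟨atZero x, atZero_mem hx.1⟩ f = avg ⟨atZero x, atZero_mem hx.1⟩ g := by
  rw [← sub_eq_zero, ← map_sub, avg_eq_mean, ← mean_comp_atZero, mean]
  have : ∀ θ, (f - g).fn (atZero (Function.update x 5 θ)) = 0 := fun θ =>
    h _ (update_five_mem hx θ)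
  simp [this]

end Box

end CurrentVortexSheet

namespace CurrentVortexSheet

open PowerSeries

/-! ### Series of profiles -/

/-- Smooth periodic profiles of indices up to `m` on one side, and front profiles of indices up to
`m + 1`. -/
structure Cascade (P : Params) (s : Side) (m : ℕ) where
  U : ℕ → Comp → Pt → ℝ
  psi : ℕ → Pt → ℝ
  U_zero : ∀ k x, U 0 k x = P.U0 s k
  U_smooth : ∀ l ≤ m, ∀ k, ContDiffOn ℝ ∞ (U l k) (dom P.T s)
  U_periodic : ∀ l ≤ m, ∀ k, IsPeriodic (U l k)
  psi_zero : ∀ x, psi 0 x = 0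
  psi_one : ∀ x, psi 1 x = 0
  psi_mem : ∀ l ≤ m + 1, IsFront P.T (psi l)

theorem dom_subset (T : ℝ) (s : Side) : dom T s ⊆ {x | x 0 ∈ Set.Icc 0 T} := fun _ hx => hx.1

namespace Cascade

variable {P : Params} {s : Side} {m : ℕ} (D : Cascade P s m) {B : Box} (hB : B.set ⊆ dom P.T s)

/-- The profile number `l`, or zero if `l > m`. -/
noncomputable def prof (l : ℕ) (k : Comp) : B.Fn :=
  if h : l ≤ m then Box.Fn.mk (D.U l k) ((D.U_smooth l h k).mono hB)
    (D.U_periodic l h k 5 (by simp)) else 0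

/-- The front profile number `l`, or zero if `l > m + 1`. -/
noncomputable def front (l : ℕ) : B.Fn :=
  if h : l ≤ m + 1 then Box.Fn.mk (D.psi l)
    ((D.psi_mem l h).smooth.mono (hB.trans (dom_subset _ _)))
    ((D.psi_mem l h).periodic 5 (by simp)) else 0

variable {D}

theorem fn_prof {l : ℕ} (hl : l ≤ m) (k : Comp) {x : Pt} (hx : x ∈ B.set) :
    (D.prof hB l k).fn x = D.U l k x := by
  rw [prof, dif_pos hl, Box.Fn.fn_mk _ _ hx]

theorem fn_der_prof {l : ℕ} (hl : l ≤ m) (k : Comp) (i : Fin 6) {x : Pt} (hx : x ∈ B.set) :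
    (B.der i (D.prof hB l k)).fn x = P.d s i (D.U l k) x := by
  rw [prof, dif_pos hl, Box.fn_der_mk _ _ _ hx, Params.d,
    pd_subset B.uniqueDiffOn hB (D.U_smooth l hl k) i hx]

theorem prof_eq_zero {l : ℕ} (hl : m < l) (k : Comp) : D.prof hB l k = 0 := by
  rw [prof, dif_neg (by omega)]

theorem fn_front {l : ℕ} (hl : l ≤ m + 1) {x : Pt} (hx : x ∈ B.set) :
    (D.front hB l).fn x = D.psi l x := by
  rw [front, dif_pos hl, Box.Fn.fn_mk _ _ hx]

theorem fn_der_front {l : ℕ} (hl : l ≤ m + 1) (i : Fin 6) {x : Pt} (hx : x ∈ B.set) :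
    (B.der i (D.front hB l)).fn x = P.d s i (D.psi l) x := by
  rw [front, dif_pos hl, Box.fn_der_mk _ _ _ hx, Params.d,
    pd_subset B.uniqueDiffOn hB ((D.psi_mem l hl).smooth.mono (dom_subset _ _)) i hx]

theorem front_eq_zero_of_lt {l : ℕ} (hl : m + 1 < l) : D.front hB l = 0 := by
  rw [front, dif_neg (by omega)]

theorem front_eq_zero {l : ℕ} (hl : l ≤ 1) : D.front hB l = 0 := by
  rw [Box.Fn.ext_iff_fn]
  intro x hx
  rw [Box.Fn.fn_zero hx, fn_front hB (by omega) hx]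
  interval_cases l
  exacts [D.psi_zero x, D.psi_one x]

theorem der_front_eq_zero {i : Fin 6} (hi : i = 3 ∨ i = 4) (l : ℕ) :
    B.der i (D.front hB l) = 0 := by
  rw [front]
  split_ifs with h
  · refine Box.der_mk_eq_zero _ _ ?_
    rcases hi with rfl | rfl
    exacts [(D.psi_mem l h).indep_y, (D.psi_mem l h).indep_Y]
  · exact map_zero _

theorem der_prof_zero (k : Comp) (i : Fin 6) : B.der i (D.prof hB 0 k) = 0 := by
  rw [prof, dif_pos (Nat.zero_le m)]
  exact Box.der_mk_eq_zero _ _ fun x r => by rw [D.U_zero, D.U_zero]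

theorem prof_zero (k : Comp) : D.prof hB 0 k = algebraMap ℝ B.Fn (P.U0 s k) := by
  rw [Box.Fn.ext_iff_fn]
  intro x hx
  rw [fn_prof hB (Nat.zero_le m) k hx, D.U_zero, ← Box.Fn.eval_eq_fn ⟨x, hx⟩, AlgHom.commutes]
  rfl

variable (D)

/-- The series of the four-vectors `(1, u)`. -/
noncomputable def w : Fin 4 → PowerSeries B.Fn :=
  Fin.cons 1 fun α => PowerSeries.mk fun l => D.prof hB l (.vel α)

/-- The series of the four-vectors `(0, H)`. -/
noncomputable def h : Fin 4 → PowerSeries B.Fn :=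
  Fin.cons 0 fun α => PowerSeries.mk fun l => D.prof hB l (.mag α)

/-- The series of the front, divided by `ε²`. -/
noncomputable def Phi : PowerSeries B.Fn := PowerSeries.mk fun n => D.front hB (n + 2)

end Cascade

theorem Params.contDiff_cut (P : Params) (N : ℕ) :
    ContDiff ℝ ∞ fun x : Pt => iteratedDeriv N P.chi (x 3) := by
  rw [iteratedDeriv_eq_iterate]
  exact (P.chi_smooth.iterate_deriv N).comp (contDiff_apply ℝ ℝ 3)

/-- The derivatives of the cut-off function, as functions on a domain. -/
noncomputable def Params.cut (P : Params) (B : Box) (N : ℕ) : B.Fn :=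
  Box.Fn.mk (fun x => iteratedDeriv N P.chi (x 3)) (P.contDiff_cut N).contDiffOn
    (fun x => by rw [Function.update_of_ne (by decide)])

namespace Params

variable (P : Params) {B : Box}

theorem der_cut_eq_zero {i : Fin 6} (hi : i ≠ 3) (N : ℕ) : B.der i (P.cut B N) = 0 :=
  Box.der_mk_eq_zero _ _ fun x r => by rw [Function.update_of_ne hi.symm]

theorem der_three_cut (N : ℕ) : B.der 3 (P.cut B N) = P.cut B (N + 1) := by
  rw [Box.Fn.ext_iff_fn]
  intro x hx
  rw [cut, cut, Box.fn_der_mk _ _ _ hx, Box.Fn.fn_mk _ _ hx, pd]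
  have h1 : HasDerivAt (iteratedDeriv N P.chi) (iteratedDeriv (N + 1) P.chi (x 3)) (x 3) := by
    rw [iteratedDeriv_succ]
    exact ((P.chi_smooth.differentiable_iteratedDeriv N
      (by exact_mod_cast WithTop.coe_lt_top N)) (x 3)).hasDerivAt
  have h2 : HasFDerivAt (fun x : Pt => x 3)
      (ContinuousLinearMap.proj (R := ℝ) (φ := fun _ : Fin 6 => ℝ) 3) x :=
    hasFDerivAt_apply (𝕜 := ℝ) (F' := fun _ : Fin 6 => ℝ) 3 x
  have h3 := (h1.comp_hasFDerivAt x h2).hasFDerivWithinAt (s := B.set)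
  have h4 := h3.fderivWithin (B.uniqueDiffOn x hx)
  rw [Function.comp_def] at h4
  rw [h4]
  simp

/-- The bound `1 / 4` is below `1 / 3`, so `χ` is `1` on a whole neighbourhood of each `y₃` and all
its derivatives vanish there. -/
theorem cut_small (hB : B.a ≤ 1 / 4) (N : ℕ) : P.cut B N = if N = 0 then 1 else 0 := by
  rw [Box.Fn.ext_iff_fn]
  intro x hx
  have h3 : |x 3| ≤ 1 / 4 := by
    have h := hx.2.1
    cases hs : B.s <;> rw [hs] at h <;> simp only [Side.sgn, Set.mem_Icc] at h <;>
      rw [abs_le] <;> constructor <;> linarith [h.1, h.2]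
  have hev : P.chi =ᶠ[nhds (x 3)] fun _ => 1 := by
    filter_upwards [Icc_mem_nhds (a := -(1 / 3 : ℝ)) (b := 1 / 3) (by linarith [(abs_le.1 h3).1])
      (by linarith [(abs_le.1 h3).2])] with r hr
    exact P.chi_eq_one r hr
  rw [cut, Box.Fn.fn_mk _ _ hx, hev.iteratedDeriv_eq N, iteratedDeriv_const]
  split_ifs with h
  · rw [← Box.Fn.eval_eq_fn ⟨x, hx⟩, map_one]
  · rw [Box.Fn.fn_zero hx]

end Params

namespace Cascade

variable {P : Params} {s : Side} {m : ℕ} (D : Cascade P s m) {B : Box} (hB : B.set ⊆ dom P.T s)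

/-- The series of `χ(x₃)`. -/
noncomputable def C₀ : PowerSeries B.Fn := tsub (P.cut B) (picLim (P.cut B) (X ^ 2 * D.Phi hB))

/-- The series of `χ'(x₃)`. -/
noncomputable def C₁ : PowerSeries B.Fn :=
  tsub (fun N => P.cut B (N + 1)) (picLim (P.cut B) (X ^ 2 * D.Phi hB))

theorem dn_Phi : dn B.der (D.Phi hB) = 0 := by
  have h : ∀ i : Fin 6, i = 3 ∨ i = 4 → liftDer (B.der i) (D.Phi hB) = 0 := fun i hi => by
    ext n
    rw [coeff_liftDer, Phi, coeff_mk, der_front_eq_zero hB hi, map_zero]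
  rw [dn_apply, h 3 (Or.inl rfl), h 4 (Or.inr rfl), mul_zero, mul_zero, add_zero]

theorem straightening (k : Fin 3 → ℝ) :
    Straightening B.der k (D.Phi hB) (D.C₀ hB) (D.C₁ hB) :=
  straightening_tsub (fun i j f => Box.der_comm i j f) (D.dn_Phi hB)
    (fun _ hi N => P.der_cut_eq_zero hi N) (fun N => P.der_three_cut N)

theorem C₀_eq_one (ha : B.a ≤ 1 / 4) : D.C₀ hB = 1 := by
  rw [C₀, tsub_single 1 _ (by rw [P.cut_small ha, if_pos rfl])
    (fun N => by rw [P.cut_small ha, if_neg (by omega)]), map_one]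

theorem C₁_eq_zero (ha : B.a ≤ 1 / 4) : D.C₁ hB = 0 := by
  rw [C₁, show (fun N => P.cut B (N + 1)) = fun _ => 0 from
    funext fun N => by rw [P.cut_small ha, if_neg (by omega)], tsub_zero_fun]

theorem coeff_zero_C₀ : coeff 0 (D.C₀ hB) = P.cut B 0 := by
  rw [C₀]
  simp [tsub]

theorem coeff_front (n : ℕ) : coeff n (X ^ 2 * D.Phi hB) = D.front hB n := by
  rw [coeff_X_pow_mul']
  split_ifs with h
  · rw [Phi, coeff_mk, Nat.sub_add_cancel h]
  · rw [front_eq_zero hB (by omega)]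

/-- The formal series at a point agree with those of any family of profiles with the same first
terms. -/
theorem agree {x : Pt} (hx : x ∈ B.set) {ψ : ℕ → Pt → ℝ} (hψ : ∀ l ≤ m, ψ l = D.psi l)
    (hψ5 : P.d s 5 (ψ (m + 1)) x = P.d s 5 (D.psi (m + 1)) x) :
    Jet.Agree m (P.jet s D.U ψ x)
      (jetOf (Box.Fn.eval ⟨x, hx⟩) B.der (D.Phi hB) (D.C₀ hB) (D.C₁ hB) (D.w hB) (D.h hB)) := by
  have key : ∀ {M : ℕ} {f g : PowerSeries ℝ}, (∀ l < M, coeff l f = coeff l g) →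
      X ^ M ∣ f - g := fun h => by
    rw [X_pow_dvd_iff]
    intro l hl
    rw [map_sub, h l hl, sub_self]
  have hΨ : (X : PowerSeries B.Fn) ∣ X ^ 2 * D.Phi hB := (dvd_pow_self X two_ne_zero).mul_right _
  have hcut : ∀ N, Box.Fn.eval ⟨x, hx⟩ (P.cut B N) = iteratedDeriv N P.chi (x 3) := fun N => by
    rw [Box.Fn.eval_eq_fn, Params.cut, Box.Fn.fn_mk _ _ hx]
  have hcoef : ∀ l ≤ m, ∀ n ≤ l, coeff n (PowerSeries.mk fun n => ψ n x)
      = Box.Fn.eval ⟨x, hx⟩ (coeff n (X ^ 2 * D.Phi hB)) := fun l hl n hn => by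
    rw [coeff_mk, coeff_front, Box.Fn.eval_eq_fn, fn_front hB (by omega) hx, hψ n (by omega)]
  have hq : ∀ i, ∀ l ≤ m, coeff l ((P.jet s D.U ψ x).q i)
      = Box.Fn.eval ⟨x, hx⟩ (coeff l (liftDer (B.der i) (X ^ 2 * D.Phi hB))) := fun i l hl => by
    rw [coeff_liftDer, coeff_front, Box.Fn.eval_eq_fn, fn_der_front hB (by omega) i hx,
      Params.jet, coeff_mk, hψ l hl]
  refine ⟨key fun l hl => ?_, key fun l hl => ?_, key fun l hl => ?_, fun i => key fun l hl => ?_,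
    key fun l hl => ?_, fun ν => ⟨key fun l hl => ?_, key fun l hl => ?_⟩,
    fun i ν => ⟨key fun l hl => ?_, key fun l hl => ?_⟩⟩
  · simp only [jetOf, coeff_map]
    refine Eq.trans ?_ (apply_coeff_tsub_picLim (Box.Fn.eval ⟨x, hx⟩) (P.cut B) (P.cut B) hΨ
      _ l (hcoef l (by omega))).symm
    simp only [hcut]
    exact coeff_mk l fun l => P.chiC ψ l x
  · simp only [jetOf, coeff_map]
    refine Eq.trans ?_ (apply_coeff_tsub_picLim (Box.Fn.eval ⟨x, hx⟩) (fun N => P.cut B (N + 1))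
      (P.cut B) hΨ _ l (hcoef l (by omega))).symm
    simp only [hcut]
    exact coeff_mk l fun l => P.chiDotC ψ l x
  · simp only [jetOf, coeff_map]
    exact hcoef l (by omega) l le_rfl
  · simp only [jetOf, coeff_map]
    exact hq i l (by omega)
  · simp only [jetOf, coeff_map]
    rcases Nat.lt_succ_iff_lt_or_eq.1 hl with h | rfl
    · exact hq 5 l (by omega)
    -- At order `m + 1` only the `θ`-derivative of the front is compared. Hence `ψ^{m+1}` may be
    -- taken with or without its slow mean.
    · rw [coeff_liftDer, coeff_front, RingHom.coe_coe, Box.Fn.eval_eq_fn,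
        fn_der_front hB le_rfl 5 hx, Params.jet, coeff_mk, hψ5]
  · refine Fin.cases ?_ (fun α => ?_) ν
    · simp [jetOf, Params.jet, ser, Params.Vseq, st, w, coeff_one]
    · simp [jetOf, Params.jet, ser, Params.Vseq, st, w, Box.Fn.eval_eq_fn,
        fn_prof hB (show l ≤ m by omega) _ hx, Params.val]
  · refine Fin.cases ?_ (fun α => ?_) ν
    · simp [jetOf, Params.jet, ser, Params.Vseq, st, h]
    · simp [jetOf, Params.jet, ser, Params.Vseq, st, h, Box.Fn.eval_eq_fn,
        fn_prof hB (show l ≤ m by omega) _ hx, Params.val]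
  · refine Fin.cases ?_ (fun α => ?_) ν
    · simp [jetOf, Params.jet, ser, Params.Wseq, st, w]
    · simp [jetOf, Params.jet, ser, Params.Wseq, st, w, Box.Fn.eval_eq_fn, coeff_liftDer,
        fn_der_prof hB (show l ≤ m by omega) _ i hx, Params.dU]
  · refine Fin.cases ?_ (fun α => ?_) ν
    · simp [jetOf, Params.jet, ser, Params.Wseq, st, h]
    · simp [jetOf, Params.jet, ser, Params.Wseq, st, h, Box.Fn.eval_eq_fn, coeff_liftDer,
        fn_der_prof hB (show l ≤ m by omega) _ i hx, Params.dU]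

end Cascade

end CurrentVortexSheet

/-! ### The coefficients of the residuals of a truncated cascade -/

namespace CurrentVortexSheet

open PowerSeries

theorem Jet.Agree.admissible {J J' : Jet} {M : ℕ} (h : Jet.Agree M J J')
    (hM : 1 ≤ M) (hJ : J.Admissible) : J'.Admissible := by
  have key : ∀ {a b : ℕ} {f g : PowerSeries ℝ}, X ^ a ∣ f - g → X ^ b ∣ f → b ≤ a → X ^ b ∣ g := by
    intro a b f g h1 h2 h3
    have := dvd_sub h2 ((pow_dvd_pow X h3).trans h1)
    rwa [sub_sub_cancel] at this
  exact ⟨key h.p hJ.p (by omega), fun i => key (h.q i) (hJ.q i) (by omega), fun i ν =>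
    ⟨key (h.W i ν).1 (hJ.W i ν).1 (by omega), key (h.W i ν).2 (hJ.W i ν).2 (by omega)⟩⟩

namespace Cascade

variable {P : Params} {s : Side} {m : ℕ} (D : Cascade P s m) {B : Box} (hB : B.set ⊆ dom P.T s)

/-- The residuals of the cascade. -/
noncomputable def R (μ : Fin 4) : PowerSeries B.Fn :=
  ResY B.der P.wave (D.Phi hB) (D.C₀ hB) (D.C₁ hB) (D.w hB) (D.h hB) μ

theorem coeff_zero_w_h (ν : Fin 4) (i : Fin 6) :
    B.der i (coeff 0 (D.w hB ν)) = 0 ∧ B.der i (coeff 0 (D.h hB ν)) = 0 := by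
  refine Fin.cases ?_ (fun α => ?_) ν
  · simp [w, h]
  · simp only [w, h, Fin.cons_succ, coeff_mk, der_prof_zero, and_self]

theorem coeff_w_h_eq_zero {l : ℕ} (hl : m < l) (ν : Fin 4) :
    coeff l (D.w hB ν) = 0 ∧ coeff l (D.h hB ν) = 0 := by
  refine Fin.cases ?_ (fun α => ?_) ν
  · simp [w, h, coeff_one, show l ≠ 0 by omega]
  · simp only [w, h, Fin.cons_succ, coeff_mk, prof_eq_zero hB hl, and_self]

theorem coeff_R_of_lt_two {n : ℕ} (hn : n < 2) (μ : Fin 4) : coeff n (D.R hB μ) = 0 :=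
  coeff_ResY_of_lt_two (fun i ν => (D.coeff_zero_w_h hB ν i).1)
    (fun i ν => (D.coeff_zero_w_h hB ν i).2) hn μ

theorem psi_eq_zero_of_le_one (hm : 1 ≤ m) {ψ : ℕ → Pt → ℝ} (hψ : ∀ l ≤ m, ψ l = D.psi l) (l : ℕ)
    (hl : l ≤ 1) : ψ l = fun _ => 0 := by
  rw [hψ l (by omega)]
  ext x
  interval_cases l
  exacts [D.psi_zero x, D.psi_one x]

section Agree

variable {x : Pt} (hx : x ∈ B.set) {ψ : ℕ → Pt → ℝ} (hψ : ∀ l ≤ m, ψ l = D.psi l)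
  (hψ5 : P.d s 5 (ψ (m + 1)) x = P.d s 5 (D.psi (m + 1)) x)

theorem jet_admissible (h1 : ∀ l ≤ 1, ψ l = fun _ => 0) : (P.jet s D.U ψ x).Admissible := by
  have hX : ∀ {f : PowerSeries ℝ}, (∀ l ≤ 1, coeff l f = 0) → X ^ 2 ∣ f := fun h => by
    rw [X_pow_dvd_iff]
    exact fun l hl => h l (by omega)
  refine ⟨hX fun l hl => ?_, fun i => hX fun l hl => ?_, fun i ν => ?_⟩
  · simp [Params.jet, h1 l hl]
  · simp [Params.jet, h1 l hl, Params.d, pd]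
  · have h0 := Params.Wseq_zero (x := x) D.U_zero i
    rw [pow_one, X_dvd_iff, X_dvd_iff]
    constructor
    · simpa [Params.jet, ser] using congrFun (congrArg Prod.fst h0) ν
    · simpa [Params.jet, ser] using congrFun (congrArg Prod.snd h0) ν

variable (hm : 1 ≤ m)
include hψ hψ5 hm hx

theorem fn_coeff_R {n : ℕ} (hn : n + 1 ≤ m) (μ : Fin 4) : (coeff (n + 2) (D.R hB μ)).fn x
    = (P.jet s D.U ψ x).lin P.wave n μ - (P.jet s D.U ψ x).src P.wave n μ := by
  have hag := D.agree hB hx hψ hψ5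
  have hJ := D.jet_admissible (x := x) (D.psi_eq_zero_of_le_one hm hψ)
  rw [← Box.Fn.eval_eq_fn ⟨x, hx⟩, R, apply_coeff_ResY,
    hag.lin_eq hJ P.wave hn, hag.src_eq hJ (hag.admissible hm hJ) P.wave (by omega)]

/-- Profile `m + 1` is zero in the truncated series, so the fast operator contributes nothing and
the source stands alone. -/
theorem fn_coeff_R_last (μ : Fin 4) : (coeff (m + 2) (D.R hB μ)).fn x
    = -(P.jet s D.U ψ x).src P.wave m μ := by
  have hag := D.agree hB hx hψ hψ5
  have hJ := D.jet_admissible (x := x) (D.psi_eq_zero_of_le_one hm hψ)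
  rw [← Box.Fn.eval_eq_fn ⟨x, hx⟩, R,
    apply_coeff_ResY_of_coeff_eq_zero (fun ν => (D.coeff_w_h_eq_zero hB (by omega) ν).1)
      (fun ν => (D.coeff_w_h_eq_zero hB (by omega) ν).2),
    hag.src_eq hJ (hag.admissible hm hJ) P.wave le_rfl]

/-- At this order truncation also removes the slow linear derivatives of profile `m + 1`. Up to a
`θ`-derivative, the source of the slow mean problem is what is left. -/
theorem fn_coeff_R_slow (h4 : ∀ l k, B.der 4 (D.prof hB l k) = 0) (μ : Fin 4) :
    (coeff (m + 3) (D.R hB μ)).fn x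
      = (B.der 5 (coeff (m + 2) (fastFlux P.wave (D.w hB) (D.h hB) μ))).fn x
        - (P.jet s D.U ψ x).slowSrc P.wave (m + 1) μ := by
  have hag := D.agree hB hx hψ hψ5
  have hJ := D.jet_admissible (x := x) (D.psi_eq_zero_of_le_one hm hψ)
  have hw4 : ∀ ν, liftDer (B.der 4) (D.w hB ν) = 0 ∧ liftDer (B.der 4) (D.h hB ν) = 0 := fun ν => by
    refine Fin.cases ?_ (fun α => ?_) ν
    · simp [w, h]
    · constructor <;>
      · ext n
        simp [w, h, coeff_liftDer, h4]
  rw [← Box.Fn.eval_eq_fn ⟨x, hx⟩, R,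
    apply_coeff_ResY_slow (fun ν => (D.coeff_w_h_eq_zero hB (by omega) ν).1)
      (fun ν => (D.coeff_w_h_eq_zero hB (by omega) ν).2) (fun ν => (hw4 ν).1) (fun ν => (hw4 ν).2),
    hag.slowSrc_eq hJ (hag.admissible hm hJ) P.wave le_rfl, Box.Fn.eval_eq_fn]

end Agree

section Vanishing

variable (hm : 1 ≤ m)
include hm

/-- The fast equations say precisely that these coefficients vanish. The family `ψ` is kept distinct
from `D.psi` because the cascade is stated with `ψ_♯^{m+1}`, whereas the series use the full front.
-/
theorem coeff_R_eq_zero {n : ℕ} (hn : n + 1 ≤ m) {ψ : ℕ → Pt → ℝ} (hψ : ∀ l ≤ m, ψ l = D.psi l)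
    (hψ5 : ∀ x ∈ dom P.T s, P.d s 5 (ψ (m + 1)) x = P.d s 5 (D.psi (m + 1)) x)
    (hfast : ∀ k, ∀ x ∈ dom P.T s, P.Lf s D.U (n + 1) k x = P.F s D.U ψ n k x)
    (hdiv : ∀ x ∈ dom P.T s, P.d s 4 (D.U (n + 1) (.mag 2)) x
      + ∑ j : Fin 2, P.xi j * P.d s 5 (D.U (n + 1) (.mag j.castSucc)) x = P.F8 s D.U ψ n x)
    (μ : Fin 4) : coeff (n + 2) (D.R hB μ) = 0 := by
  rw [Box.Fn.ext_iff_fn]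
  intro x hx
  rw [Box.Fn.fn_zero hx, D.fn_coeff_R hB hx hψ (hψ5 x (hB hx)) hm hn]
  refine Fin.cases ?_ (fun i => ?_) μ
  · rw [Params.jet_lin_zero D.U_zero, hdiv x (hB hx), Params.F8_eq_src D.U_zero]
    ring
  · rw [Params.jet_lin_mag D.U_zero, hfast _ x (hB hx), Params.F_mag_eq_src D.U_zero, sub_self]

theorem fn_coeff_R_succ {ψ : ℕ → Pt → ℝ} (hψ : ∀ l ≤ m, ψ l = D.psi l)
    (hψ5 : ∀ x ∈ dom P.T s, P.d s 5 (ψ (m + 1)) x = P.d s 5 (D.psi (m + 1)) x) (i : Fin 3)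
    {x : Pt} (hx : x ∈ B.set) :
    (coeff (m + 2) (D.R hB i.succ)).fn x = -P.F s D.U ψ m (.mag i) x := by
  rw [D.fn_coeff_R_last hB hx hψ (hψ5 x (hB hx)) hm, Params.F_mag_eq_src D.U_zero]

theorem fn_coeff_R_zero {ψ : ℕ → Pt → ℝ} (hψ : ∀ l ≤ m, ψ l = D.psi l)
    (hψ5 : ∀ x ∈ dom P.T s, P.d s 5 (ψ (m + 1)) x = P.d s 5 (D.psi (m + 1)) x)
    {x : Pt} (hx : x ∈ B.set) :
    (coeff (m + 2) (D.R hB 0)).fn x = P.F8 s D.U ψ m x := by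
  rw [D.fn_coeff_R_last hB hx hψ (hψ5 x (hB hx)) hm, Params.F8_eq_src D.U_zero]

theorem avg_coeff_R_slow (h4 : ∀ l k, B.der 4 (D.prof hB l k) = 0) (x : B.set) (μ : Fin 4) :
    Box.avg x (coeff (m + 3) (D.R hB μ))
      = mean (fun y => -(P.jet s D.U D.psi y).slowSrc P.wave (m + 1) μ) x := by
  set g := coeff (m + 2) (fastFlux P.wave (D.w hB) (D.h hB) μ) with hg
  have h1 : Box.avg x (coeff (m + 3) (D.R hB μ) - B.der 5 g)
      = mean (fun y => -(P.jet s D.U D.psi y).slowSrc P.wave (m + 1) μ) x := by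
    rw [Box.avg_eq_mean]
    refine Box.mean_congr fun θ => ?_
    have hx := Box.update_five_mem x.2 θ
    rw [Box.Fn.fn_sub _ _ hx, D.fn_coeff_R_slow hB hx (fun _ _ => rfl) rfl hm h4]
    ring
  rw [← h1, map_sub, Box.avg_der_five, sub_zero]

theorem slowF_mag_eq (h4 : ∀ l k, B.der 4 (D.prof hB l k) = 0) (x : B.set) (i : Fin 3) :
    P.slowF s D.U D.psi m (.mag i) x = -Box.avg x (coeff (m + 3) (D.R hB i.succ)) := by
  rw [D.avg_coeff_R_slow hB hm h4, Params.slowF_mag_eq D.U_zero]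
  simp only [mean, intervalIntegral.integral_neg]
  ring

theorem slowF8_eq (h4 : ∀ l k, B.der 4 (D.prof hB l k) = 0) (x : B.set) :
    P.slowF8 s D.U D.psi m x = Box.avg x (coeff (m + 3) (D.R hB 0)) := by
  rw [D.avg_coeff_R_slow hB hm h4, Params.slowF8_eq D.U_zero]

end Vanishing

end Cascade

end CurrentVortexSheet

/-! ### The first identity for profiles independent of `Y₃` -/

namespace CurrentVortexSheet

open PowerSeries

namespace Cascade

variable {P : Params} {s : Side} {m : ℕ} (D : Cascade P s m) {B : Box} (hB : B.set ⊆ dom P.T s)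

theorem liftDer_four_w_h (h4 : ∀ l k, B.der 4 (D.prof hB l k) = 0) (ν : Fin 4) :
    liftDer (B.der 4) (D.w hB ν) = 0 ∧ liftDer (B.der 4) (D.h hB ν) = 0 := by
  refine Fin.cases ?_ (fun α => ?_) ν
  · simp [w, h]
  · constructor <;>
    · ext n
      simp [w, h, coeff_liftDer, h4]

theorem sum_ED_R (h4 : ∀ l k, B.der 4 (D.prof hB l k) = 0) :
    ∑ μ, ED B.der P.wave (D.Phi hB) (D.C₀ hB) (D.C₁ hB) μ (D.R hB μ) = 0 := by
  rw [← (D.straightening hB P.wave).sum_ED_Res (D.w hB) (D.h hB)]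
  refine sum_congr rfl fun μ _ => ?_
  rw [R, ResY_eq_Res _ _ _ _ _ _ _ (fun ν => (D.liftDer_four_w_h hB h4 ν).1)
    (fun ν => (D.liftDer_four_w_h hB h4 ν).2)]

/-- Neither the front nor the derivatives of `χ(y₃)` involve `Y₃`. Differentiating the fixed point
equation for `x₃ - y₃` gives a homogeneous linear equation with invertible coefficient. -/
theorem liftDer_four_C (g : ℕ → B.Fn) (hg : ∀ N, B.der 4 (g N) = 0) :
    liftDer (B.der 4) (tsub g (picLim (P.cut B) (X ^ 2 * D.Phi hB))) = 0 := by
  have hΨ : (X : PowerSeries B.Fn) ∣ X ^ 2 * D.Phi hB := (dvd_pow_self X two_ne_zero).mul_right _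
  have hXΞ := X_dvd_picLim (P.cut B) hΨ
  have hΨ4 : liftDer (B.der 4) (X ^ 2 * D.Phi hB) = 0 := by
    ext n
    rw [coeff_liftDer, coeff_front, der_front_eq_zero hB (Or.inr rfl), map_zero]
  set Ξ := picLim (P.cut B) (X ^ 2 * D.Phi hB) with hΞ
  have hfix : Ξ = X ^ 2 * D.Phi hB * tsub (P.cut B) Ξ := picLim_eq _ hΨ
  have hcut := P.der_cut_eq_zero (B := B) (i := 4) (by decide)
  have h1 : liftDer (B.der 4) Ξ
      = X ^ 2 * D.Phi hB * (tsub (fun N => P.cut B (N + 1)) Ξ * liftDer (B.der 4) Ξ) := by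
    conv_lhs => rw [hfix]
    rw [Derivation.leibniz, hΨ4, liftDer_tsub_of_ne hcut hXΞ, smul_zero, add_zero, smul_eq_mul]
  have hunit : IsUnit (1 - X ^ 2 * D.Phi hB * tsub (fun N => P.cut B (N + 1)) Ξ) := by
    rw [isUnit_iff_constantCoeff]; simp
  have h2 : liftDer (B.der 4) Ξ = 0 := by
    refine hunit.mul_left_cancel ?_
    linear_combination h1
  rw [liftDer_tsub_of_ne hg hXΞ, h2, mul_zero]

theorem liftDer_four_C₀_C₁ :
    liftDer (B.der 4) (D.C₀ hB) = 0 ∧ liftDer (B.der 4) (D.C₁ hB) = 0 :=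
  ⟨D.liftDer_four_C hB _ fun N => P.der_cut_eq_zero (by decide) N,
    D.liftDer_four_C hB _ fun N => P.der_cut_eq_zero (by decide) (N + 1)⟩

theorem liftDer_four_Phi : liftDer (B.der 4) (D.Phi hB) = 0 := by
  ext n
  rw [coeff_liftDer, Phi, coeff_mk, der_front_eq_zero hB (Or.inr rfl), map_zero]

theorem _root_.CurrentVortexSheet.Box.liftDer_comm (i j : Fin 6) (f : PowerSeries B.Fn) :
    liftDer (B.der i) (liftDer (B.der j) f) = liftDer (B.der j) (liftDer (B.der i) f) :=
  CurrentVortexSheet.liftDer_comm (fun f => Box.der_comm i j f) f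

theorem liftDer_four_R (h4 : ∀ l k, B.der 4 (D.prof hB l k) = 0) (μ : Fin 4) :
    liftDer (B.der 4) (D.R hB μ) = 0 := by
  have hw := fun ν => (D.liftDer_four_w_h hB h4 ν).1
  have hh := fun ν => (D.liftDer_four_w_h hB h4 ν).2
  have hC := D.liftDer_four_C₀_C₁ hB
  have hΦ := D.liftDer_four_Phi hB
  have hX : ∀ n, liftDer (B.der 4) ((X : PowerSeries B.Fn) ^ n) = 0 := fun n => liftDer_X_pow _ n
  have hX1 : liftDer (B.der 4) (X : PowerSeries B.Fn) = 0 := liftDer_X _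
  rw [R, ResY, map_sum]
  refine sum_eq_zero fun ν _ => ?_
  have hf : liftDer (B.der 4) (D.w hB ν * D.h hB μ - D.h hB ν * D.w hB μ) = 0 := by
    simp [Derivation.leibniz, hw, hh]
  generalize D.w hB ν * D.h hB μ - D.h hB ν * D.w hB μ = f at hf
  have hc : ∀ (i : Fin 6) (f : PowerSeries B.Fn), liftDer (B.der 4) f = 0 →
      liftDer (B.der 4) (liftDer (B.der i) f) = 0 := fun i f h => by
    rw [Box.liftDer_comm, h, map_zero]
  have hn : ∀ (i : Fin 3) (f : PowerSeries B.Fn), liftDer (B.der 4) f = 0 →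
      liftDer (B.der 4) (nab B.der P.wave i f) = 0 := fun i f h => by
    simp only [nab_apply, map_add, Derivation.leibniz, Derivation.map_smul, hc _ f h, hX, hX1,
      smul_zero, add_zero]
  induction ν using Fin.lastCases with
  | last =>
    rw [show Fin.last 3 = 3 from rfl, EY_last]
    simp only [map_add, map_sub, Derivation.leibniz, hc _ f hf, hX, hX1, hΦ, hC.2, smul_zero,
      add_zero, Derivation.map_one_eq_zero, sub_zero]
  | cast i =>
    rw [EY_castSucc]
    simp only [map_add, map_sub, Derivation.leibniz, hc _ f hf, hn i f hf, hn i _ hΦ, hX, hX1,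
      hC.1, smul_zero, add_zero, sub_zero]

/-- The first identity, for profiles that do not depend on `Y₃`. -/
theorem pd_slowF8_eq (hm : 1 ≤ m) (h4 : ∀ l k, B.der 4 (D.prof hB l k) = 0)
    (hR : ∀ μ, ∀ n < m + 2, coeff n (D.R hB μ) = 0) (x : B.set) :
    pd B.set 0 (P.slowF8 s D.U D.psi m) x
      = ∑ α : Fin 3, pd B.set (sp α) (P.slowF s D.U D.psi m (.mag α)) x := by
  have hR4 : ∀ μ n, B.der 4 (coeff n (D.R hB μ)) = 0 := fun μ n => by
    rw [← coeff_liftDer, D.liftDer_four_R hB h4, map_zero]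
  -- The lowest order gives `∑ k_i ∂_θ (coeff (m + 2) R_i) = 0`; the third order contains the
  -- identity to be proved.
  have h1 := coeff_one_sum_ED hR (D.sum_ED_R hB h4)
  have h3 := coeff_three_sum_ED hR hR4 (D.sum_ED_R hB h4)
  rw [hR4, add_zero] at h1
  have h0 : pd B.set 0 (P.slowF8 s D.U D.psi m) x
      = Box.avg x (B.der 0 (coeff (m + 3) (D.R hB 0))) := by
    rw [← Box.Fn.pd_mean _ (by decide)]
    exact Box.pd_congr (fun y hy => D.slowF8_eq hB hm h4 ⟨y, hy⟩) x.2
  have hα : ∀ α : Fin 3, pd B.set (sp α) (P.slowF s D.U D.psi m (.mag α)) x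
      = -Box.avg x (B.der (sp α) (coeff (m + 3) (D.R hB α.succ))) := fun α => by
    have h5 : sp α ≠ 5 := by fin_cases α <;> decide
    rw [← map_neg, ← map_neg, ← Box.Fn.pd_mean _ h5]
    exact Box.pd_congr (fun y hy => (D.slowF_mag_eq hB hm h4 ⟨y, hy⟩ α).trans
      (map_neg (Box.avg ⟨y, hy⟩) _).symm) x.2
  -- The front term is a `θ`-derivative. The factor `coeff 0 C₀` is `χ(y₃)`, independent of `θ`, and
  -- moving `∂_θ` off the front produces the normal derivative of the lowest order relation, which
  -- vanishes.
  have h5 : ∑ i : Fin 3, coeff 0 (D.C₀ hB) * (P.wave i • B.der 5 (coeff 0 (D.Phi hB)))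
        * B.der 3 (coeff (m + 2) (D.R hB i.castSucc))
      = B.der 5 (∑ i : Fin 3, coeff 0 (D.C₀ hB) * coeff 0 (D.Phi hB)
        * (P.wave i • B.der 3 (coeff (m + 2) (D.R hB i.castSucc)))) := by
    have hz : ∑ i : Fin 3, P.wave i • B.der 5 (B.der 3 (coeff (m + 2) (D.R hB i.castSucc))) = 0 := by
      have := congrArg (B.der 3) h1
      rw [map_sum, map_zero] at this
      simpa only [Derivation.map_smul, Box.der_comm 3 5] using this
    rw [← mul_sum, Derivation.leibniz, map_sum]
    simp only [Derivation.map_smul]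
    rw [hz, Derivation.leibniz, D.coeff_zero_C₀, P.der_cut_eq_zero (by decide), smul_zero, smul_zero,
      add_zero, zero_add, smul_eq_mul, smul_eq_mul, sum_mul]
    refine sum_congr rfl fun i _ => ?_
    simp only [Algebra.smul_def]
    ring
  rw [sum_sub_distrib, h5] at h3
  -- Averaging over `θ` eliminates this term and coefficient `m + 4`, about which nothing is known.
  have h6 := congrArg (Box.avg x) h3
  rw [map_add, map_sub, Box.avg_der_five, sub_zero, map_sum, map_zero] at h6
  simp only [map_add, map_smul, Box.avg_der_five, smul_zero, add_zero] at h6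
  rw [h0]
  simp only [hα]
  rw [Fin.sum_univ_three] at h6 ⊢
  have e0 : B.der (sp 0) (coeff (m + 3) (D.R hB (Fin.succ 0)))
    = B.der (tan 1) (coeff (m + 2 + 1) (D.R hB (Fin.castSucc 1))) := rfl
  have e1 : B.der (sp 1) (coeff (m + 3) (D.R hB (Fin.succ 1)))
    = B.der (tan 2) (coeff (m + 2 + 1) (D.R hB (Fin.castSucc 2))) := rfl
  have e2 : B.der (sp 2) (coeff (m + 3) (D.R hB (Fin.succ 2)))
    = B.der 3 (coeff (m + 2 + 1) (D.R hB 3)) := rfl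
  have e3 : B.der 0 (coeff (m + 3) (D.R hB 0))
    = B.der (tan 0) (coeff (m + 2 + 1) (D.R hB (Fin.castSucc 0))) := rfl
  rw [e0, e1, e2, e3]
  linarith

end Cascade

end CurrentVortexSheet

namespace CurrentVortexSheet

open PowerSeries

/-! ### Series with the same behaviour as `Y₃ → ±∞` -/

namespace Box

variable {B : Box}

/-- The coefficients of the series have the same behaviour as `Y₃ → ±∞`. -/
def SeriesFarEq (f g : PowerSeries B.Fn) : Prop := ∀ n, FarEq (coeff n f) (coeff n g)

namespace SeriesFarEq

variable {f g f' g' : PowerSeries B.Fn}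

theorem refl (h : liftDer (B.der 4) f = 0) : SeriesFarEq f f := fun n =>
  FarEq.refl (by rw [← coeff_liftDer, h, map_zero])

theorem add (h : SeriesFarEq f g) (h' : SeriesFarEq f' g') : SeriesFarEq (f + f') (g + g') :=
  fun n => by rw [map_add, map_add]; exact (h n).add (h' n)

theorem sub (h : SeriesFarEq f g) (h' : SeriesFarEq f' g') : SeriesFarEq (f - f') (g - g') :=
  fun n => by rw [map_sub, map_sub]; exact (h n).sub (h' n)

theorem smul (c : ℝ) (h : SeriesFarEq f g) : SeriesFarEq (c • f) (c • g) :=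
  fun n => by rw [PowerSeries.coeff_smul, PowerSeries.coeff_smul]; exact (h n).smul c

theorem mul (h : SeriesFarEq f g) (h' : SeriesFarEq f' g') : SeriesFarEq (f * f') (g * g') :=
  fun n => by
    rw [coeff_mul, coeff_mul]
    exact FarEq.sum _ fun p _ => (h p.1).mul (h' p.2)

theorem sum {ι : Type*} (t : Finset ι) {f g : ι → PowerSeries B.Fn}
    (h : ∀ i ∈ t, SeriesFarEq (f i) (g i)) : SeriesFarEq (∑ i ∈ t, f i) (∑ i ∈ t, g i) :=
  fun n => by
    rw [map_sum, map_sum]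
    exact FarEq.sum _ fun i hi => h i hi n

theorem X_pow_mul (k : ℕ) (h : SeriesFarEq f g) : SeriesFarEq (X ^ k * f) (X ^ k * g) :=
  (refl (liftDer_X_pow _ k)).mul h

theorem X_mul (h : SeriesFarEq f g) : SeriesFarEq (X * f) (X * g) :=
  (refl (liftDer_X _)).mul h

end SeriesFarEq

/-- The series and their first derivatives have the same behaviour as `Y₃ → ±∞`. -/
structure SeriesFarEqOne (f g : PowerSeries B.Fn) : Prop where
  zero : SeriesFarEq f g
  der : ∀ i, SeriesFarEq (liftDer (B.der i) f) (liftDer (B.der i) g)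

namespace SeriesFarEqOne

variable {f g f' g' : PowerSeries B.Fn}

theorem sub (h : SeriesFarEqOne f g) (h' : SeriesFarEqOne f' g') :
    SeriesFarEqOne (f - f') (g - g') :=
  ⟨h.zero.sub h'.zero, fun i => by rw [map_sub, map_sub]; exact (h.der i).sub (h'.der i)⟩

theorem mul (h : SeriesFarEqOne f g) (h' : SeriesFarEqOne f' g') :
    SeriesFarEqOne (f * f') (g * g') :=
  ⟨h.zero.mul h'.zero, fun i => by
    rw [Derivation.leibniz, Derivation.leibniz]
    exact (h.zero.mul (h'.der i)).add (h'.zero.mul (h.der i))⟩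

variable (k : Fin 3 → ℝ) {Φ C₀ C₁ : PowerSeries B.Fn}

theorem nab (h : SeriesFarEqOne f g) (i : Fin 3) :
    SeriesFarEq (nab B.der k i f) (nab B.der k i g) := by
  rw [nab_apply, nab_apply]
  exact ((h.der _).X_pow_mul 2).add (((h.der 5).smul _).X_mul)

theorem liftDer_four_nab {f : PowerSeries B.Fn} (hf : liftDer (B.der 4) f = 0) (i : Fin 3) :
    liftDer (B.der 4) (CurrentVortexSheet.nab B.der k i f) = 0 := by
  simp only [nab_apply, map_add, Derivation.leibniz, Derivation.map_smul, Box.liftDer_comm 4, hf,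
    map_zero, liftDer_X_pow, liftDer_X, smul_zero, add_zero]

theorem EY (hΦ : liftDer (B.der 4) Φ = 0) (h0 : liftDer (B.der 4) C₀ = 0)
    (h1 : liftDer (B.der 4) C₁ = 0) (h : SeriesFarEqOne f g) (μ : Fin 4) :
    SeriesFarEq (EY B.der k Φ C₀ C₁ μ f) (EY B.der k Φ C₀ C₁ μ g) := by
  induction μ using Fin.lastCases with
  | last =>
    rw [show Fin.last 3 = 3 from rfl, EY_last, EY_last]
    refine ((SeriesFarEq.refl ?_).mul (h.der 3)).add (h.der 4).X_mul
    simp [Derivation.leibniz, hΦ, h1]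
  | cast i =>
    rw [EY_castSucc, EY_castSucc]
    refine (h.nab k i).sub ((SeriesFarEq.refl (liftDer_four_nab k hΦ i)).mul
      (((SeriesFarEq.refl ?_).mul (h.der 3)).add (h.der 4).X_mul))
    simp [Derivation.leibniz, h0]

end SeriesFarEqOne

/-- Decay is used for the profile itself and for its first derivatives, the only ones in the
residuals: the lists `[]` and `[i]`. -/
theorem FarEq.of_inSstar {T : ℝ} {s : Side} {f g : B.Fn} {v : Pt → ℝ}
    (hB : B.set ⊆ dom T s) (hv : InSstar T s v) (hg : B.der 4 g = 0)
    (h : ∀ x ∈ B.set, f.fn x - g.fn x = v x) :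
    FarEq f g ∧ ∀ i, FarEq (B.der i f) (B.der i g) := by
  obtain ⟨δ, hδ, hd⟩ := hv.decay
  refine ⟨?_, fun i => ?_⟩
  · obtain ⟨C, hC⟩ := hd []
    refine FarEq.of_decay hg hδ (C := C) fun x hx => ?_
    rw [h x hx]
    exact hC x (hB hx)
  · obtain ⟨C, hC⟩ := hd [i]
    refine FarEq.of_decay (by rw [der_comm, hg, map_zero]) hδ (C := C) fun x hx => ?_
    rw [← Fn.fn_sub _ _ hx, ← map_sub, fn_der _ _ hx,
      pd_congr (fun y hy => (Fn.fn_sub f g hy).trans (h y hy)) hx,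
      pd_subset B.uniqueDiffOn hB hv.smooth i hx]
    exact hC x (hB hx)

end Box

/-! ### Comparison of the full profiles with their limits -/

namespace Cascade

variable {P : Params} {s : Side} {m : ℕ} (D D' : Cascade P s m) {B : Box}
  (hB : B.set ⊆ dom P.T s)

theorem front_congr (h : D.psi = D'.psi) (l : ℕ) : D.front hB l = D'.front hB l := by
  rcases le_or_gt l (m + 1) with hl | hl
  · rw [Box.Fn.ext_iff_fn]
    intro x hx
    rw [fn_front hB hl hx, fn_front hB hl hx, h]
  · rw [front_eq_zero_of_lt hB hl, front_eq_zero_of_lt hB hl]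

theorem Phi_congr (h : D.psi = D'.psi) : D.Phi hB = D'.Phi hB := by
  simp only [Phi, front_congr D D' hB h]

theorem C₀_congr (h : D.psi = D'.psi) : D.C₀ hB = D'.C₀ hB := by
  rw [C₀, C₀, Phi_congr D D' hB h]

theorem C₁_congr (h : D.psi = D'.psi) : D.C₁ hB = D'.C₁ hB := by
  rw [C₁, C₁, Phi_congr D D' hB h]

/-- `D'` is the limit of `D` as `Y₃ → ±∞`. -/
structure IsLimit : Prop where
  psi : D.psi = D'.psi
  indep : ∀ l ≤ m, ∀ k, IndepOf 4 (D'.U l k)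
  decay : ∀ l ≤ m, ∀ k, InSstar P.T s fun x => D.U l k x - D'.U l k x

variable {D D'} (hD : D.IsLimit D')
include hD

theorem IsLimit.der_four_prof (l : ℕ) (k : Comp) : B.der 4 (D'.prof hB l k) = 0 := by
  rw [prof]
  split_ifs with h
  · exact Box.der_mk_eq_zero _ _ (hD.indep l h k)
  · exact map_zero _

theorem IsLimit.farEq_prof (l : ℕ) (k : Comp) :
    Box.FarEq (D.prof hB l k) (D'.prof hB l k)
      ∧ ∀ i, Box.FarEq (B.der i (D.prof hB l k)) (B.der i (D'.prof hB l k)) := by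
  rcases le_or_gt l m with hl | hl
  · exact Box.FarEq.of_inSstar hB (hD.decay l hl k) (hD.der_four_prof hB l k) fun x hx => by
      rw [fn_prof hB hl k hx, fn_prof hB hl k hx]
  · rw [prof_eq_zero hB hl, prof_eq_zero hB hl]
    exact ⟨Box.FarEq.zero, fun i => by rw [map_zero]; exact Box.FarEq.zero⟩

theorem IsLimit.farEq_w_h (ν : Fin 4) : Box.SeriesFarEqOne (D.w hB ν) (D'.w hB ν)
    ∧ Box.SeriesFarEqOne (D.h hB ν) (D'.h hB ν) := by
  have hc : ∀ c : ℕ, Box.SeriesFarEqOne (c : PowerSeries B.Fn) c := fun c =>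
    ⟨Box.SeriesFarEq.refl (Derivation.map_natCast _ _), fun i => by
      rw [Derivation.map_natCast]
      exact Box.SeriesFarEq.refl (map_zero _)⟩
  refine Fin.cases ?_ (fun α => ?_) ν
  · have h1 := hc 1
    have h0 := hc 0
    rw [Nat.cast_one] at h1
    rw [Nat.cast_zero] at h0
    exact ⟨h1, h0⟩
  · refine ⟨⟨fun n => ?_, fun i n => ?_⟩, ⟨fun n => ?_, fun i n => ?_⟩⟩ <;>
      simp only [w, h, Fin.cons_succ, coeff_liftDer, coeff_mk]
    exacts [(hD.farEq_prof hB n _).1, (hD.farEq_prof hB n _).2 i, (hD.farEq_prof hB n _).1,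
      (hD.farEq_prof hB n _).2 i]

/-- Residuals are polynomial in the fields and their first derivatives, with coefficients
independent of `Y₃`, and the two cascades share the front. -/
theorem IsLimit.farEq_R (μ : Fin 4) : Box.SeriesFarEq (D.R hB μ) (D'.R hB μ) := by
  rw [R, R, ResY, ResY, ← Phi_congr D D' hB hD.psi, ← C₀_congr D D' hB hD.psi,
    ← C₁_congr D D' hB hD.psi]
  refine Box.SeriesFarEq.sum _ fun ν _ => Box.SeriesFarEqOne.EY _ (D.liftDer_four_Phi hB)
    (D.liftDer_four_C₀_C₁ hB).1 (D.liftDer_four_C₀_C₁ hB).2 ?_ ν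
  have h1 := fun ν => (hD.farEq_w_h hB ν).1
  have h2 := fun ν => (hD.farEq_w_h hB ν).2
  exact ((h1 ν).mul (h2 μ)).sub ((h2 ν).mul (h1 μ))

/-- The coefficient for the limit profiles does not depend on `Y₃` and tends to zero, hence
vanishes. The cascade for the residual profiles thus needs no separate assumption. -/
theorem IsLimit.coeff_R_eq_zero {n : ℕ} {μ : Fin 4} (h : coeff n (D.R hB μ) = 0) :
    coeff n (D'.R hB μ) = 0 := by
  have h1 := (hD.farEq_R hB μ n).sub_zero_left
  rw [h, zero_sub] at h1
  have h2 := h1.neg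
  rw [neg_neg, neg_zero] at h2
  refine h2.eq_zero ?_
  rw [← coeff_liftDer, D'.liftDer_four_R hB (hD.der_four_prof hB), map_zero]

end Cascade

end CurrentVortexSheet

/-! ### Products of the front with traces -/

namespace CurrentVortexSheet

open PowerSeries

theorem sum2_split_right (n : ℕ) (g : ℕ → ℕ → ℝ) :
    sum2 n g = sum2 n (fun a e => if 1 ≤ e then g a e else 0) + g n 0 := by
  have h : ∀ a e, g a e = (if 1 ≤ e then g a e else 0) + if e = 0 then g a e else 0 := by
    intro a e
    rcases Nat.eq_zero_or_pos e with rfl | he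
    · simp
    · simp [Nat.succ_le_of_lt he, he.ne']
  have h2 : sum2 n (fun a e => if e = 0 then g a e else 0) = g n 0 := by
    rw [sum2, sum_eq_single (n, 0)]
    · simp
    · rintro ⟨a, e⟩ hp hne
      rw [HasAntidiagonal.mem_antidiagonal] at hp
      dsimp only at hp ⊢
      rw [if_neg]
      rintro rfl
      exact hne (by rw [← hp, add_zero])
    · intro h
      exact absurd (by simp) h
  rw [← h2, ← sum2_add]
  exact sum2_congr h

theorem sum2_succ_left (n : ℕ) (g : ℕ → ℕ → ℝ) :
    sum2 (n + 1) g = g 0 (n + 1) + sum2 n fun a e => g (a + 1) e :=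
  Nat.sum_antidiagonal_succ (f := fun p => g p.1 p.2)

theorem sum2_congr' {n : ℕ} {g h : ℕ → ℕ → ℝ} (H : ∀ a e, a + e = n → g a e = h a e) :
    sum2 n g = sum2 n h :=
  sum_congr rfl fun p hp => H p.1 p.2 (HasAntidiagonal.mem_antidiagonal.1 hp)

/-- The boundary products, with the terms that contain the leading profile put apart. -/
theorem sum2_slope_split (n : ℕ) (k : ℝ) {q r : ℕ → ℝ} (hr : r 0 = 0) (Y : ℕ → ℝ) :
    sum2 (n + 1) (fun a e => (q a + k * r (a + 1)) * Y e)
      = (q (n + 1) + k * r (n + 2)) * Y 0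
        + sum2 (n + 2) (fun a e => if 1 ≤ e then r a * (k * Y e) else 0)
        + sum2 (n + 1) (fun a e => if 1 ≤ e then q a * Y e else 0) := by
  rw [sum2_split_right, sum2_succ_left (n + 1) fun a e => if 1 ≤ e then r a * (k * Y e) else 0]
  have : sum2 (n + 1) (fun a e => if 1 ≤ e then (q a + k * r (a + 1)) * Y e else 0)
      = sum2 (n + 1) (fun a e => if 1 ≤ e then r (a + 1) * (k * Y e) else 0)
        + sum2 (n + 1) (fun a e => if 1 ≤ e then q a * Y e else 0) := by
    rw [← sum2_add]
    refine sum2_congr fun a e => ?_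
    split_ifs <;> ring
  rw [this, hr]
  simp only [zero_mul, ite_self]
  ring

namespace Cascade

variable {P : Params} {s : Side} {m : ℕ} (D : Cascade P s m) {B : Box} (hB : B.set ⊆ dom P.T s)

theorem coeff_nab_Phi (i : Fin 3) (n : ℕ) : coeff n (nab B.der P.wave i (D.Phi hB))
    = B.der (tan i) (D.front hB n) + P.wave i • B.der 5 (D.front hB (n + 1)) := by
  -- Multiplication by `X` restores the whole front `X ^ 2 * Φ`, so the lowest coefficients need no
  -- separate treatment.
  have h : X * nab B.der P.wave i (D.Phi hB)
      = X * liftDer (B.der (tan i)) (X ^ 2 * D.Phi hB)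
        + P.wave i • liftDer (B.der 5) (X ^ 2 * D.Phi hB) := by
    rw [nab_apply]
    simp only [Derivation.leibniz, liftDer_X_pow, smul_eq_mul, mul_add, mul_smul_comm]
    ring_nf
  have h2 := congrArg (coeff (n + 1)) h
  rw [coeff_succ_X_mul, map_add, coeff_succ_X_mul, PowerSeries.coeff_smul, coeff_liftDer,
    coeff_liftDer, coeff_front, coeff_front] at h2
  exact h2

theorem d_psi_atZero {l : ℕ} (hl : l ≤ m + 1) {i : Fin 6} (h3 : i ≠ 3) (h4 : i ≠ 4) {z : Pt}
    (hz : z ∈ dom P.T s) : P.d s i (D.psi l) z = P.d s i (D.psi l) (atZero z) := by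
  let B₁ : Box := ⟨P.T, P.T_pos, s, 1, one_pos⟩
  have hf := D.psi_mem l hl
  have hat : (fun y => D.psi l (atZero y)) = D.psi l := by
    ext y
    rw [atZero, hf.indep_Y, hf.indep_y]
  have := Box.pd_comp_atZero (B := B₁) (D := dom P.T s) B₁.uniqueDiffOn (fun y hy => hy.1)
    (f := D.psi l) hz (((hf.smooth.mono (dom_subset _ _)) _
      (Box.atZero_mem (B := B₁) hz.1)).differentiableWithinAt (by simp)) h3 h4
  rwa [hat] at this

theorem tg_ne (j : Fin 2) : tg j ≠ 3 ∧ tg j ≠ 4 ∧ tg j ≠ 5 := by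
  fin_cases j <;> simp [tg]

/-- The boundary products of the front with the tangential components of a field. -/
theorem fn_sum_tg {n : ℕ} (hn : n ≤ m) (κ : Fin 3 → Comp) {z : Pt} (hz : z ∈ dom P.T s)
    (hy : atZero z ∈ B.set) :
    (∑ j : Fin 2, coeff (n + 1) (nab B.der P.wave j.succ (D.Phi hB)
        * PowerSeries.mk fun l => D.prof hB l (κ j.castSucc))).fn (atZero z)
    = ∑ j : Fin 2, P.U0 s (κ j.castSucc) * P.d s (tg j) (D.psi (n + 1)) z
      + (∑ j : Fin 2, P.xi j * P.U0 s (κ j.castSucc)) * (B.der 5 (D.front hB (n + 2))).fn (atZero z)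
      + sum2 (n + 2) (fun a e => if 1 ≤ e then
        P.d s 5 (D.psi a) z * ∑ j : Fin 2, P.xi j * D.U e (κ j.castSucc) (atZero z) else 0)
      + sum2 (n + 1) (fun a e => if 1 ≤ e then
        ∑ j : Fin 2, P.d s (tg j) (D.psi a) z * D.U e (κ j.castSucc) (atZero z) else 0) := by
  have hψ : ∀ i : Fin 6, i ≠ 3 → i ≠ 4 → ∀ l ≤ m + 1,
      (B.der i (D.front hB l)).fn (atZero z) = P.d s i (D.psi l) z := fun i h3 h4 l hl => by
    rw [fn_der_front hB hl i hy, D.d_psi_atZero hl h3 h4 hz]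
  have hψ0 : ∀ i : Fin 6, i ≠ 3 → i ≠ 4 → ∀ l ≤ 1, P.d s i (D.psi l) z = 0 :=
    fun i h3 h4 l hl => by
      rw [← hψ i h3 h4 l (by omega), front_eq_zero hB hl, map_zero, Box.Fn.fn_zero hy]
  have hU : ∀ e ≤ m, ∀ k, (D.prof hB e k).fn (atZero z) = D.U e k (atZero z) :=
    fun e he k => fn_prof hB he k hy
  have hterm : ∀ j : Fin 2, (coeff (n + 1) (nab B.der P.wave j.succ (D.Phi hB)
        * PowerSeries.mk fun l => D.prof hB l (κ j.castSucc))).fn (atZero z)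
      = (P.d s (tg j) (D.psi (n + 1)) z
          + P.xi j * (B.der 5 (D.front hB (n + 2))).fn (atZero z)) * P.U0 s (κ j.castSucc)
        + sum2 (n + 2) (fun a e => if 1 ≤ e then
          P.d s 5 (D.psi a) z * (P.xi j * D.U e (κ j.castSucc) (atZero z)) else 0)
        + sum2 (n + 1) (fun a e => if 1 ≤ e then
          P.d s (tg j) (D.psi a) z * D.U e (κ j.castSucc) (atZero z) else 0) := by
    intro j
    have h1 : (coeff (n + 1) (nab B.der P.wave j.succ (D.Phi hB)
        * PowerSeries.mk fun l => D.prof hB l (κ j.castSucc))).fn (atZero z)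
      = sum2 (n + 1) fun a e => ((B.der (tg j) (D.front hB a)).fn (atZero z)
        + P.xi j * (B.der 5 (D.front hB (a + 1))).fn (atZero z))
          * (D.prof hB e (κ j.castSucc)).fn (atZero z) := by
      rw [coeff_mul, Box.Fn.fn_sum _ _ hy, sum2]
      refine sum_congr rfl fun p _ => ?_
      rw [Box.Fn.fn_mul _ _ hy, coeff_nab_Phi, coeff_mk, Box.Fn.fn_add _ _ hy,
        Box.Fn.fn_smul _ _ hy, Params.tan_succ]
      rfl
    rw [h1, sum2_slope_split (n := n) (k := P.xi j)
      (q := fun a => (B.der (tg j) (D.front hB a)).fn (atZero z))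
      (r := fun a => (B.der 5 (D.front hB a)).fn (atZero z))
      (Y := fun e => (D.prof hB e (κ j.castSucc)).fn (atZero z))
      (by rw [front_eq_zero hB (by omega), map_zero, Box.Fn.fn_zero hy])]
    congr 1
    · congr 1
      · rw [hψ _ (tg_ne j).1 (tg_ne j).2.1 _ (by omega), hU 0 (Nat.zero_le _), D.U_zero]
      · refine sum2_congr' fun a e hae => ?_
        split_ifs with he
        · rw [hψ 5 (by decide) (by decide) a (by omega)]
          -- For `a ≤ 1` the front vanishes; otherwise `e ≤ n ≤ m`, so the truncated profile is the
          -- true one.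
          rcases le_or_gt a 1 with ha | ha
          · rw [hψ0 5 (by decide) (by decide) a ha, zero_mul, zero_mul]
          · rw [hU e (by omega)]
        · rfl
    · refine sum2_congr' fun a e hae => ?_
      split_ifs with he
      · rw [hψ _ (tg_ne j).1 (tg_ne j).2.1 a (by omega)]
        rcases le_or_gt a 0 with ha | ha
        · rw [hψ0 _ (tg_ne j).1 (tg_ne j).2.1 a (by omega), zero_mul, zero_mul]
        · rw [hU e (by omega)]
      · rfl
  rw [Box.Fn.fn_sum _ _ hy]
  simp only [hterm]
  rw [sum_add_distrib, sum_add_distrib, sum_sum2, sum_sum2]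
  congr 1
  · congr 1
    · simp only [Fin.sum_univ_two]
      ring
    · refine sum2_congr fun a e => ?_
      split_ifs
      · rw [mul_sum]
      · exact sum_const_zero
  · refine sum2_congr fun a e => ?_
    split_ifs
    · rfl
    · exact sum_const_zero

end Cascade

end CurrentVortexSheet

namespace CurrentVortexSheet

open PowerSeries

theorem Params.U0_castSucc (P : Params) (s : Side) (j : Fin 2) :
    P.U0 s (.vel j.castSucc) = P.u0 s j ∧ P.U0 s (.mag j.castSucc) = P.H0 s j := by
  fin_cases j <;> exact ⟨rfl, rfl⟩

/-- The velocity four-vector `(1, u₁⁰, u₂⁰)`. -/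
def Params.vel (P : Params) (s : Side) : Fin 3 → ℝ := Fin.cons 1 (P.u0 s)

/-- The magnetic four-vector `(0, H₁⁰, H₂⁰)`. -/
def Params.mag (P : Params) (s : Side) : Fin 3 → ℝ := Fin.cons 0 (P.H0 s)

/-! ### The interior problem near the boundary -/

section

variable {A : Type*} [CommRing A] [Algebra ℝ A] {d : Fin 6 → Derivation ℝ A A} {k : Fin 3 → ℝ}
  {Φ : PowerSeries A}

theorem conormal_castSucc (i : Fin 3) : conormal d k Φ i.castSucc = -nab d k i Φ := by
  simp [conormal]

theorem conormal_last : conormal d k Φ 3 = 1 := rfl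

end

namespace Box

variable {B : Box}

theorem smul_der_five_mem_meanZero (c : ℝ) (f : B.Fn) : c • B.der 5 f ∈ B.meanZero :=
  Submodule.smul_mem _ c (der_five_mem_meanZero f)

/-- The mean of the normal component at the second order of a divergence free surface wave. -/
theorem surface_mem_meanZero {k : Fin 3 → ℝ} {Φ C₁ : PowerSeries B.Fn} {N : ℕ}
    {S : Fin 4 → PowerSeries B.Fn} (hS : ∀ μ, ∀ n < N, coeff n (S μ) = 0)
    (hdiv : ∑ μ, ED B.der k Φ 1 C₁ μ (S μ) = 0) (hfar : ∀ μ, SeriesFarEq (S μ) 0)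
    (hΦ : B.der 4 (coeff 0 Φ) = 0) {V : Fin 3 → B.Fn} (hV : ∀ i r, FarEq (B.der r (V i)) 0)
    (hSV : ∀ i : Fin 3, coeff N (S i.castSucc) - B.der 4 (V i) ∈ B.meanZero) :
    coeff (N + 1) (S 3) - ∑ i : Fin 3, k i • B.der 5 (coeff 0 Φ) * coeff N (S i.castSucc)
      + ∑ i : Fin 3, B.der (tan i) (V i) ∈ B.meanZero := by
  have hz : ∀ μ n, FarEq (coeff n (S μ)) 0 := fun μ n => by simpa using hfar μ n
  -- The lowest order of the divergence makes `∂_{Y₃}` of the normal component a `θ`-derivative;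
  -- decay then forces a zero mean.
  have h3 : coeff N (S 3) ∈ B.meanZero := by
    refine (hz 3 N).mem_meanZero ?_
    rw [eq_neg_of_add_eq_zero_right (coeff_one_sum_ED hS hdiv)]
    exact Submodule.neg_mem _ (Submodule.sum_mem _ fun i _ => smul_der_five_mem_meanZero _ _)
  have hΦ' : ∀ i : Fin 3, B.der 4 (k i • B.der 5 (coeff 0 Φ)) = 0 := fun i => by
    rw [Derivation.map_smul, der_comm, hΦ, map_zero, smul_zero]
  have h2 := coeff_two_sum_ED hS hdiv
  refine FarEq.mem_meanZero ?_ ?_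
  · have h1 : FarEq (∑ i : Fin 3, k i • B.der 5 (coeff 0 Φ) * coeff N (S i.castSucc)) 0 := by
      simpa using FarEq.sum univ fun (i : Fin 3) _ => (FarEq.refl (hΦ' i)).mul (hz i.castSucc N)
    have h4 : FarEq (∑ i : Fin 3, B.der (tan i) (V i)) 0 := by
      simpa using FarEq.sum univ fun (i : Fin 3) _ => hV i (tan i)
    simpa using ((hz 3 (N + 1)).sub h1).add h4
  -- The second order gives the `Y₃`-derivative of the combination, front term included. All its
  -- terms have zero mean: the `V i` absorb the tangential fluxes, and `∂_{y₃}` acts on a function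
  -- already known to have zero mean.
  · have e : B.der 4 (coeff (N + 1) (S 3)
        - ∑ i : Fin 3, k i • B.der 5 (coeff 0 Φ) * coeff N (S i.castSucc)
        + ∑ i : Fin 3, B.der (tan i) (V i))
        = -(∑ i : Fin 3, (B.der (tan i) (coeff N (S i.castSucc) - B.der 4 (V i))
            + k i • B.der 5 (coeff (N + 1) (S i.castSucc)))) - B.der 3 (coeff N (S 3)) := by
      simp only [map_add, map_sub, map_sum, Derivation.leibniz, hΦ', smul_eq_mul, mul_zero,
        add_zero, der_comm 4 (tan _)]
      rw [coeff_zero_one] at h2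
      simp only [one_mul, sum_add_distrib, sum_sub_distrib] at h2 ⊢
      linear_combination h2
    rw [e]
    refine Submodule.sub_mem _ (Submodule.neg_mem _ (Submodule.sum_mem _ fun i _ =>
      Submodule.add_mem _ (der_mem_meanZero (hSV i) (tan_ne i).2.2)
        (smul_der_five_mem_meanZero _ _))) (der_mem_meanZero h3 (by decide))

end Box

namespace Cascade

variable {P : Params} {s : Side} {m : ℕ} (D : Cascade P s m) {B : Box} (hB : B.set ⊆ dom P.T s)

/-- The conormal component of the magnetic field. -/
noncomputable def normalH : PowerSeries B.Fn :=
  ∑ μ, conormal B.der P.wave (D.Phi hB) μ * D.h hB μ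

/-- The conormal component of the velocity four-vector. -/
noncomputable def normalW : PowerSeries B.Fn :=
  ∑ μ, conormal B.der P.wave (D.Phi hB) μ * D.w hB μ

theorem normalH_eq : D.normalH hB = (PowerSeries.mk fun l => D.prof hB l (.mag 2))
    - ∑ j : Fin 2, nab B.der P.wave j.succ (D.Phi hB)
      * PowerSeries.mk fun l => D.prof hB l (.mag j.castSucc) := by
  rw [normalH, sum_univ_castSucc_three, Fin.sum_univ_succ]
  simp only [conormal_castSucc, conormal_last, Fin.castSucc_zero, h, Fin.cons_zero, mul_zero,
    zero_add, one_mul, neg_mul, sum_neg_distrib]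
  rw [neg_add_eq_sub]
  rfl

theorem normalW_eq : D.normalW hB = (PowerSeries.mk fun l => D.prof hB l (.vel 2))
    - nab B.der P.wave 0 (D.Phi hB)
    - ∑ j : Fin 2, nab B.der P.wave j.succ (D.Phi hB)
      * PowerSeries.mk fun l => D.prof hB l (.vel j.castSucc) := by
  rw [normalW, sum_univ_castSucc_three, Fin.sum_univ_succ]
  simp only [conormal_castSucc, conormal_last, Fin.castSucc_zero, w, Fin.cons_zero, mul_one,
    one_mul, neg_mul, sum_neg_distrib]
  rw [show conormal B.der P.wave (D.Phi hB) 0 = -nab B.der P.wave 0 (D.Phi hB) from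
    conormal_castSucc 0, sub_sub, ← neg_add, neg_add_eq_sub]
  rfl

/-- On the boundary this coefficient is the left side minus the right side of the magnetic jump
condition number `n + 1`. The front of index `n + 2` stays in truncated form, since for `n = m` it
exceeds the prescribed range. -/
theorem fn_coeff_normalH {n : ℕ} (hn : n ≤ m) {z : Pt} (hz : z ∈ dom P.T s)
    (hy : atZero z ∈ B.set) : (coeff (n + 1) (D.normalH hB)).fn (atZero z)
      = (D.prof hB (n + 1) (.mag 2)).fn (atZero z)
        - P.b s * (B.der 5 (D.front hB (n + 2))).fn (atZero z) - P.G2 s D.U D.psi n z := by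
  rw [normalH_eq, map_sub, map_sum, coeff_mk, Box.Fn.fn_sub _ _ hy, D.fn_sum_tg hB hn .mag hz hy,
    Params.G2, Params.b]
  simp only [(P.U0_castSucc s _).2]
  ring

theorem fn_coeff_normalW {n : ℕ} (hn : n ≤ m) {z : Pt} (hz : z ∈ dom P.T s)
    (hy : atZero z ∈ B.set) : (coeff (n + 1) (D.normalW hB)).fn (atZero z)
      = (D.prof hB (n + 1) (.vel 2)).fn (atZero z)
        - P.c s * (B.der 5 (D.front hB (n + 2))).fn (atZero z) - P.G1 s D.U D.psi n z := by
  have h0 : (coeff (n + 1) (nab B.der P.wave 0 (D.Phi hB))).fn (atZero z)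
      = P.d s 0 (D.psi (n + 1)) z
        + P.tau * (B.der 5 (D.front hB (n + 2))).fn (atZero z) := by
    rw [coeff_nab_Phi, Box.Fn.fn_add _ _ hy, Box.Fn.fn_smul _ _ hy,
      D.d_psi_atZero (by omega) (by decide) (by decide) hz,
      ← fn_der_front hB (by omega) 0 hy]
    rfl
  rw [normalW_eq, map_sub, map_sub, map_sum, coeff_mk, Box.Fn.fn_sub _ _ hy, Box.Fn.fn_sub _ _ hy,
    D.fn_sum_tg hB hn .vel hz hy, h0, Params.G1, Params.c]
  simp only [(P.U0_castSucc s _).1]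
  ring

theorem coeff_zero_normal : coeff 0 (D.normalH hB) = 0 ∧ coeff 0 (D.normalW hB) = 0 := by
  rw [normalH_eq, normalW_eq]
  simp only [map_sub, map_sum, coeff_zero_mul_eq, coeff_zero_nab, zero_mul, sum_const_zero,
    coeff_mk, prof_zero, sub_zero]
  exact ⟨map_zero _, map_zero _⟩

/-- The jump conditions of the fast problems. -/
structure Jumps : Prop where
  vel : ∀ n, n + 1 ≤ m → ∀ x ∈ dom P.T s,
    D.U (n + 1) (.vel 2) (atZero x) - P.c s * P.d s 5 (D.psi (n + 2)) x = P.G1 s D.U D.psi n x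
  mag : ∀ n, n + 1 ≤ m → ∀ x ∈ dom P.T s,
    D.U (n + 1) (.mag 2) (atZero x) - P.b s * P.d s 5 (D.psi (n + 2)) x = P.G2 s D.U D.psi n x

variable {D} in
-- The jump conditions express that fields and front satisfy `h · n = w · n = 0` on the interface,
-- order by order, `n` being the conormal.
theorem Jumps.normal_mem (hJ : D.Jumps) {l : ℕ} (hl : l ≤ m) :
    coeff l (D.normalH hB) ∈ B.traceZero ∧ coeff l (D.normalW hB) ∈ B.traceZero := by
  rcases l with _ | n
  · rw [(D.coeff_zero_normal hB).1, (D.coeff_zero_normal hB).2]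
    exact ⟨Submodule.zero_mem _, Submodule.zero_mem _⟩
  · have h5 : ∀ {z}, z ∈ B.set → (B.der 5 (D.front hB (n + 2))).fn (atZero z)
        = P.d s 5 (D.psi (n + 2)) z := fun {z} hz => by
      rw [fn_der_front hB (by omega) 5 (Box.atZero_mem hz.1),
        D.d_psi_atZero (by omega) (by decide) (by decide) (hB hz)]
    refine ⟨fun z hz => ?_, fun z hz => ?_⟩
    · rw [D.fn_coeff_normalH hB (by omega) (hB hz) (Box.atZero_mem hz.1), h5 hz,
        fn_prof hB hl _ (Box.atZero_mem hz.1), hJ.mag n hl z (hB hz), sub_self]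
    · rw [D.fn_coeff_normalW hB (by omega) (hB hz) (Box.atZero_mem hz.1), h5 hz,
        fn_prof hB hl _ (Box.atZero_mem hz.1), hJ.vel n hl z (hB hz), sub_self]

/-- At order `m + 1` both the profile and the front of the jump condition are truncated to zero,
leaving the boundary source alone. -/
theorem fn_coeff_normal_last {z : Pt} (hz : z ∈ dom P.T s) (hy : atZero z ∈ B.set) :
    (coeff (m + 1) (D.normalH hB)).fn (atZero z) = -P.G2 s D.U D.psi m z
      ∧ (coeff (m + 1) (D.normalW hB)).fn (atZero z) = -P.G1 s D.U D.psi m z := by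
  rw [D.fn_coeff_normalH hB le_rfl hz hy, D.fn_coeff_normalW hB le_rfl hz hy,
    prof_eq_zero hB (by omega), prof_eq_zero hB (by omega), front_eq_zero_of_lt hB (by omega),
    map_zero, Box.Fn.fn_zero hy]
  constructor <;> ring

end Cascade

end CurrentVortexSheet

/-! ### The second identity near the boundary -/

namespace CurrentVortexSheet

open PowerSeries

namespace Cascade

variable {P : Params} {s : Side} {m : ℕ} {D D' : Cascade P s m} {B : Box}
  (hB : B.set ⊆ dom P.T s)

theorem coeff_zero_w_castSucc (i : Fin 3) :
    coeff 0 (D.w hB i.castSucc) = algebraMap ℝ B.Fn (P.vel s i)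
      ∧ coeff 0 (D.h hB i.castSucc) = algebraMap ℝ B.Fn (P.mag s i) := by
  refine Fin.cases ?_ (fun j => ?_) i
  · simp [w, h, Params.vel, Params.mag]
  · rw [Fin.castSucc_succ]
    simp only [w, h, Fin.cons_succ, coeff_mk, prof_zero, Params.vel, Params.mag,
      (P.U0_castSucc s j).1, (P.U0_castSucc s j).2, and_self]

/-- All lower coefficients of `g` have zero trace, so in the Cauchy product only the constant term
of `f` survives on the boundary. -/
theorem coeff_succ_mul_sub_mem {B : Box} {f g : PowerSeries B.Fn} {m : ℕ}
    (hg : ∀ l ≤ m, coeff l g ∈ B.traceZero) :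
    coeff (m + 1) (f * g) - coeff 0 f * coeff (m + 1) g ∈ B.traceZero := by
  have h : coeff (m + 1) (f * g) - coeff 0 f * coeff (m + 1) g
      = ∑ p ∈ antidiagonal m, coeff (p.1 + 1) f * coeff p.2 g := by
    rw [coeff_mul, Nat.sum_antidiagonal_succ, add_sub_cancel_left]
  rw [h]
  refine Ideal.sum_mem _ fun p hp => Ideal.mul_mem_left _ _ (hg _ ?_)
  rw [HasAntidiagonal.mem_antidiagonal] at hp
  omega

/-- The mean of the normal component of the residual on the boundary. -/
theorem avg_conormal_R (ha : B.a ≤ 1 / 4) (hR : ∀ μ, ∀ n < m + 2, coeff n (D.R hB μ) = 0)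
    (hJ : D.Jumps) {x : Pt} (hx : x ∈ B.set) :
    Box.avg ⟨atZero x, Box.atZero_mem hx.1⟩ (coeff (m + 3) (D.R hB 3)
        - ∑ i : Fin 3, P.wave i • B.der 5 (coeff 0 (D.Phi hB))
          * coeff (m + 2) (D.R hB i.castSucc))
      = ∑ i : Fin 3, Box.avg ⟨atZero x, Box.atZero_mem hx.1⟩ (B.der (tan i)
        (P.vel s i • coeff (m + 1) (D.normalH hB) - P.mag s i • coeff (m + 1) (D.normalW hB))) := by
  have hRes : ∀ μ, D.R hB μ = Res B.der P.wave (D.Phi hB) 1 0 (D.w hB) (D.h hB) μ := fun μ => by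
    rw [R, D.C₀_eq_one hB ha, D.C₁_eq_zero hB ha, ResY_one_zero]
  have h1 := coeff_succ_sum_conormal_mul (k := P.wave) (d := B.der) (Φ := D.Phi hB) hR
  rw [← h1]
  have h2 : ∑ μ, conormal B.der P.wave (D.Phi hB) μ * D.R hB μ
      = ∑ i : Fin 3, nab B.der P.wave i (D.w hB i.castSucc * D.normalH hB
        - D.h hB i.castSucc * D.normalW hB) := by
    simp only [hRes]
    exact sum_conormal_mul_Res (fun i j f => Box.der_comm i j f) _ _
  rw [h2, map_sum, map_sum]
  refine sum_congr rfl fun i _ => ?_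
  -- The weight `ε²` of the tangential derivative turns order `m + 3` into order `m + 1`, where the
  -- boundary sources appear.
  rw [show m + 2 + 1 = (m + 1) + 2 from rfl, coeff_add_two_nab, map_add, map_smul,
    Box.avg_der_five, smul_zero, add_zero]
  -- Tangential derivatives preserve zero trace, so the flux may be replaced by its leading part on
  -- the boundary before differentiating.
  refine Box.avg_eq_of_sub_mem_traceZero ?_ hx
  rw [← map_sub]
  refine Box.der_mem_traceZero ?_ (tan_ne i).1 (tan_ne i).2.1
  have e1 := coeff_succ_mul_sub_mem (f := D.w hB i.castSucc) (g := D.normalH hB) (m := m)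
    fun l hl => (hJ.normal_mem hB hl).1
  have e2 := coeff_succ_mul_sub_mem (f := D.h hB i.castSucc) (g := D.normalW hB) (m := m)
    fun l hl => (hJ.normal_mem hB hl).2
  rw [(coeff_zero_w_castSucc hB i).1, ← Algebra.smul_def] at e1
  rw [(coeff_zero_w_castSucc hB i).2, ← Algebra.smul_def] at e2
  have e3 := Ideal.sub_mem _ e1 e2
  rw [map_sub]
  convert e3 using 1
  abel

/-- The second identity in terms of means of smooth functions. -/
theorem slowF_normal_eq (hm : 1 ≤ m) (ha : B.a ≤ 1 / 4) (hD : D.IsLimit D')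
    (hR : ∀ μ, ∀ n < m + 2, coeff n (D.R hB μ) = 0) (hJ : D.Jumps) {vH vU : B.Fn}
    (hH : ∀ r, Box.FarEq (B.der r vH) 0) (hU : ∀ r, Box.FarEq (B.der r vU) 0)
    (hS : ∀ i : Fin 3, coeff (m + 2) (D.R hB i.castSucc) - coeff (m + 2) (D'.R hB i.castSucc)
      - (P.vel s i • B.der 4 vH - P.mag s i • B.der 4 vU) ∈ B.meanZero)
    {x : Pt} (hx : x ∈ B.set) :
    P.slowF s D'.U D'.psi m (.mag 2) (atZero x)
      = ∑ i : Fin 3, (P.vel s i * Box.avg ⟨atZero x, Box.atZero_mem hx.1⟩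
          (B.der (tan i) (-coeff (m + 1) (D.normalH hB) - vH))
        - P.mag s i * Box.avg ⟨atZero x, Box.atZero_mem hx.1⟩
          (B.der (tan i) (-coeff (m + 1) (D.normalW hB) - vU))) := by
  set y : B.set := ⟨atZero x, Box.atZero_mem hx.1⟩ with hy
  have hR' : ∀ μ, ∀ n < m + 2, coeff n (D'.R hB μ) = 0 := fun μ n hn =>
    hD.coeff_R_eq_zero hB (hR μ n hn)
  have h4 := hD.der_four_prof (B := B) hB
  have hstr : Straightening B.der P.wave (D.Phi hB) 1 0 := by
    have := D.straightening hB P.wave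
    rwa [D.C₀_eq_one hB ha, D.C₁_eq_zero hB ha] at this
  have hdiv' : ∑ μ, ED B.der P.wave (D.Phi hB) 1 0 μ (D'.R hB μ) = 0 := by
    have := D'.sum_ED_R hB h4
    rwa [D'.C₀_eq_one hB ha, D'.C₁_eq_zero hB ha, ← Phi_congr D D' hB hD.psi] at this
  have hdiv : ∑ μ, ED B.der P.wave (D.Phi hB) 1 0 μ (D.R hB μ) = 0 := by
    refine (sum_congr rfl fun μ _ => ?_).trans (hstr.sum_ED_Res (D.w hB) (D.h hB))
    rw [R, D.C₀_eq_one hB ha, D.C₁_eq_zero hB ha, ResY_one_zero]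
  have hΦ4 : B.der 4 (coeff 0 (D.Phi hB)) = 0 := by
    rw [← coeff_liftDer, D.liftDer_four_Phi hB, map_zero]
  -- The surface wave part of the residuals is divergence free, as a difference of two divergence
  -- free fields for the same derivations, and it decays in `Y₃`.
  have hs := Box.surface_mem_meanZero (k := P.wave) (Φ := D.Phi hB) (C₁ := 0) (N := m + 2)
    (S := fun μ => D.R hB μ - D'.R hB μ)
    (fun μ n hn => by rw [map_sub, hR μ n hn, hR' μ n hn, sub_zero])
    (by simp only [map_sub, sum_sub_distrib, hdiv, hdiv', sub_zero])
    (fun μ n => by simpa using (hD.farEq_R hB μ n).sub_zero_left) hΦ4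
    (V := fun i => P.vel s i • vH - P.mag s i • vU)
    (fun i r => by
      simp only [map_sub, Derivation.map_smul]
      simpa using ((hH r).smul (P.vel s i)).sub ((hU r).smul (P.mag s i)))
    (fun i => by simpa only [map_sub, Derivation.map_smul] using hS i)
  have hs' := Box.mem_meanZero.1 hs y
  have h1 := coeff_one_sum_ED hR' hdiv'
  rw [show B.der 4 (coeff (m + 2) (D'.R hB 3)) = 0 by
    rw [← coeff_liftDer, D'.liftDer_four_R hB h4, map_zero], add_zero] at h1
  -- For the residual profiles the tangential part of the conormal component is a `θ`-derivative.
  -- Its mean therefore reduces to that of the third component, which is `-𝔽_6`.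
  have h5 : ∑ i : Fin 3, P.wave i • B.der 5 (coeff 0 (D.Phi hB))
        * coeff (m + 2) (D'.R hB i.castSucc)
      = B.der 5 (∑ i : Fin 3, coeff 0 (D.Phi hB)
        * (P.wave i • coeff (m + 2) (D'.R hB i.castSucc))) := by
    rw [← mul_sum, Derivation.leibniz, map_sum]
    simp only [Derivation.map_smul]
    rw [h1, smul_zero, zero_add, smul_eq_mul, sum_mul]
    refine sum_congr rfl fun i _ => ?_
    simp only [Algebra.smul_def]
    ring
  have hb := avg_conormal_R hB ha hR hJ hx
  rw [D'.slowF_mag_eq hB hm h4 y 2]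
  have h6 := congrArg (Box.avg y) h5
  rw [Box.avg_der_five] at h6
  simp only [map_sub, mul_sub, sum_sub_distrib, map_add, h6, sub_zero] at hs'
  rw [map_sub] at hb
  rw [show D'.R hB (Fin.succ 2) = D'.R hB 3 from rfl]
  have e : ∑ i : Fin 3, Box.avg y (B.der (tan i)
        (P.vel s i • coeff (m + 1) (D.normalH hB) - P.mag s i • coeff (m + 1) (D.normalW hB)))
      + Box.avg y (∑ i : Fin 3, B.der (tan i) (P.vel s i • vH))
      - Box.avg y (∑ i : Fin 3, B.der (tan i) (P.mag s i • vU))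
      = -∑ i : Fin 3, (P.vel s i * Box.avg y (B.der (tan i) (-coeff (m + 1) (D.normalH hB) - vH))
        - P.mag s i * Box.avg y (B.der (tan i) (-coeff (m + 1) (D.normalW hB) - vU))) := by
    simp only [map_sum, map_sub, map_neg, Derivation.map_smul, map_smul, smul_eq_mul,
      ← sum_add_distrib, ← sum_sub_distrib, ← sum_neg_distrib]
    exact sum_congr rfl fun i _ => by ring
  linarith

end Cascade

end CurrentVortexSheet

/-! ### From the hypotheses to the full and residual cascades -/

namespace CurrentVortexSheet

open PowerSeries

theorem pd_zero_fun (D : Set Pt) (i : Fin 6) : pd D i (fun _ => 0) = fun _ => 0 := by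
  ext x
  simp [pd]

theorem InSstar.zero (T : ℝ) (s : Side) : InSstar T s fun _ => 0 := by
  refine ⟨contDiffOn_const, fun _ _ _ => rfl, 1, one_pos, fun l => ⟨0, fun x _ => ?_⟩⟩
  have : l.foldr (pd (dom T s)) (fun _ => 0) = fun _ => 0 := by
    induction l with
    | nil => rfl
    | cons i l ih => rw [List.foldr_cons, ih, pd_zero_fun]
  rw [this]
  simp

theorem IsFront.zero (T : ℝ) : IsFront T fun _ => 0 :=
  ⟨contDiffOn_const, fun _ _ _ => rfl, fun _ _ => rfl, fun _ _ => rfl⟩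

theorem IsFront.add {T : ℝ} {f g : Pt → ℝ} (hf : IsFront T f) (hg : IsFront T g) :
    IsFront T fun x => f x + g x :=
  ⟨hf.smooth.add hg.smooth, fun i hi x => by rw [hf.periodic i hi, hg.periodic i hi],
    fun x r => by rw [hf.indep_y, hg.indep_y], fun x r => by rw [hf.indep_Y, hg.indep_Y]⟩

/-- The box that is the whole domain of one side. -/
def Params.box (P : Params) (s : Side) : Box := ⟨P.T, P.T_pos, s, 1, one_pos⟩

/-- The box next to the boundary, where the cut-off function is `1`. -/
noncomputable def Params.thinBox (P : Params) (s : Side) : Box :=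
  ⟨P.T, P.T_pos, s, 1 / 4, by norm_num⟩

theorem Params.box_set (P : Params) (s : Side) : (P.box s).set = dom P.T s := rfl

theorem Params.thinBox_subset (P : Params) (s : Side) : (P.thinBox s).set ⊆ dom P.T s :=
  fun _ hx => ⟨hx.1, ⟨hx.2.1.1, hx.2.1.2.trans (by norm_num [thinBox])⟩, hx.2.2⟩

namespace Profiles.SolvesUpTo

variable {Q : Profiles} {P : Params} {m : ℕ} (hQ : Q.SolvesUpTo P m)
  (hm : 1 ≤ m) {p : Pt → ℝ} (hp : IsFront P.T p) (s : Side)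

theorem fullPsi_of_le {l : ℕ} (hl : l ≤ m) : Q.fullPsi m p l = Q.psi l :=
  Function.update_of_ne (by omega) _ _

theorem fullPsi_last : Q.fullPsi m p (m + 1) = fun x => Q.psi (m + 1) x + p x :=
  Function.update_self _ _ _

/-- The condition `1 ≤ e` restricts the front to indices at most `n + 1 ≤ m`, so the slow mean of
`ψ^{m+1}` does not enter the sources of earlier steps. -/
theorem G_fullPsi {n : ℕ} (hn : n + 1 ≤ m) (U : ℕ → Comp → Pt → ℝ) (x : Pt) :
    P.G1 s U (Q.fullPsi m p) n x = P.G1 s U Q.psi n x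
      ∧ P.G2 s U (Q.fullPsi m p) n x = P.G2 s U Q.psi n x := by
  have h0 : Q.fullPsi m p (n + 1) = Q.psi (n + 1) := fullPsi_of_le hn
  have h1 : ∀ (N : ℕ) (hN : N ≤ m + 1) (f : (Pt → ℝ) → ℕ → ℝ),
      sum2 N (fun a e => if 1 ≤ e then f (Q.fullPsi m p a) e else 0)
        = sum2 N (fun a e => if 1 ≤ e then f (Q.psi a) e else 0) := by
    intro N hN f
    refine sum2_congr' fun a e hae => ?_
    split_ifs with he
    · rw [fullPsi_of_le (by omega)]
    · rfl
  constructor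
  · rw [Params.G1, Params.G1, h0]
    congr 1
    · congr 1
      exact h1 (n + 2) (by omega) (fun ψ e => P.d s 5 ψ x
        * ∑ j : Fin 2, P.xi j * U e (.vel j.castSucc) (atZero x))
    · exact h1 (n + 1) (by omega) (fun ψ e => ∑ j : Fin 2, P.d s (tg j) ψ x
        * U e (.vel j.castSucc) (atZero x))
  · rw [Params.G2, Params.G2, h0]
    congr 1
    · congr 1
      exact h1 (n + 2) (by omega) (fun ψ e => P.d s 5 ψ x
        * ∑ j : Fin 2, P.xi j * U e (.mag j.castSucc) (atZero x))
    · exact h1 (n + 1) (by omega) (fun ψ e => ∑ j : Fin 2, P.d s (tg j) ψ x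
        * U e (.mag j.castSucc) (atZero x))

include hQ

theorem U_zero (k : Comp) (x : Pt) : Q.U s 0 k x = P.U0 s k := by
  rw [U, hQ.Ubar_zero, hQ.Ustar_zero, add_zero]

theorem smooth_bar {l : ℕ} (hl : l ≤ m) (k : Comp) :
    ContDiffOn ℝ ∞ (Q.Ubar s l k) (dom P.T s) ∧ IsPeriodic (Q.Ubar s l k)
      ∧ IndepOf 4 (Q.Ubar s l k) := by
  rcases Nat.eq_zero_or_pos l with rfl | h
  · rw [show Q.Ubar s 0 k = fun _ => P.U0 s k from funext (hQ.Ubar_zero s k)]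
    exact ⟨contDiffOn_const, fun _ _ _ => rfl, fun _ _ => rfl⟩
  · have := hQ.Ubar_mem s l k h hl
    exact ⟨this.smooth, this.periodic, this.indep⟩

theorem star_mem {l : ℕ} (hl : l ≤ m) (k : Comp) : InSstar P.T s (Q.Ustar s l k) := by
  rcases Nat.eq_zero_or_pos l with rfl | h
  · rw [show Q.Ustar s 0 k = fun _ => 0 from funext (hQ.Ustar_zero s k)]
    exact InSstar.zero _ _
  · exact hQ.Ustar_mem s l k h hl

include hm hp

theorem fullPsi_mem {l : ℕ} (hl : l ≤ m + 1) : IsFront P.T (Q.fullPsi m p l) := by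
  rcases Nat.lt_or_ge l 2 with h | h
  · rw [fullPsi_of_le (by omega)]
    interval_cases l
    · rw [show Q.psi 0 = fun _ => 0 from funext hQ.psi_zero]
      exact IsFront.zero _
    · rw [show Q.psi 1 = fun _ => 0 from funext hQ.psi_one]
      exact IsFront.zero _
  · rcases Nat.lt_or_ge m l with h' | h'
    · obtain rfl : l = m + 1 := by omega
      rw [fullPsi_last]
      exact (hQ.psi_mem _ h le_rfl).add hp
    · rw [fullPsi_of_le h']
      exact hQ.psi_mem l h hl

/-- The cascade of the full profiles. -/
noncomputable def full : Cascade P s m where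
  U := Q.U s
  psi := Q.fullPsi m p
  U_zero := hQ.U_zero s
  U_smooth l hl k := (hQ.smooth_bar s hl k).1.add (hQ.star_mem s hl k).smooth
  U_periodic l hl k i hi x := by
    rw [U, U, (hQ.smooth_bar s hl k).2.1 i hi, (hQ.star_mem s hl k).periodic i hi]
  psi_zero x := by rw [fullPsi_of_le (Nat.zero_le m), hQ.psi_zero]
  psi_one x := by rw [fullPsi_of_le hm, hQ.psi_one]
  psi_mem l hl := hQ.fullPsi_mem hm hp hl

/-- The cascade of the residual profiles. -/
noncomputable def residual : Cascade P s m where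
  U := Q.Ubar s
  psi := Q.fullPsi m p
  U_zero := hQ.Ubar_zero s
  U_smooth l hl k := (hQ.smooth_bar s hl k).1
  U_periodic l hl k := (hQ.smooth_bar s hl k).2.1
  psi_zero x := by rw [fullPsi_of_le (Nat.zero_le m), hQ.psi_zero]
  psi_one x := by rw [fullPsi_of_le hm, hQ.psi_one]
  psi_mem l hl := hQ.fullPsi_mem hm hp hl

theorem isLimit : (hQ.full hm hp s).IsLimit (hQ.residual hm hp s) where
  psi := rfl
  indep l hl k := (hQ.smooth_bar s hl k).2.2
  decay l hl k := by
    have : (fun x => (hQ.full hm hp s).U l k x - (hQ.residual hm hp s).U l k x)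
        = Q.Ustar s l k := by
      ext x
      exact add_sub_cancel_left _ _
    rw [this]
    exact hQ.star_mem s hl k

variable (hpθ : IndepOf 5 p)
include hpθ

/-- The added slow mean does not depend on `θ`. This is why the conclusion holds for every choice of
it. -/
theorem d_five_fullPsi {x : Pt} (hx : x ∈ dom P.T s) {l : ℕ} (hl : l ≤ m + 1) :
    P.d s 5 (Q.psi l) x = P.d s 5 (Q.fullPsi m p l) x := by
  rcases Nat.lt_or_ge m l with h' | h'
  · obtain rfl : l = m + 1 := by omega
    have hps := hp.smooth.mono (dom_subset P.T s)
    rw [fullPsi_last, Params.d, Params.d, pd, pd, fderivWithin_fun_add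
      (show UniqueDiffWithinAt ℝ (dom P.T s) x from (P.box s).uniqueDiffOn x hx)
      ((((hQ.psi_mem _ (by omega) le_rfl).smooth.mono (dom_subset P.T s)) x
        hx).differentiableWithinAt (by simp))
      ((hps x hx).differentiableWithinAt (by simp)), _root_.add_apply]
    have := Box.pd_eq_zero_of_indepOf (B := P.box s) hpθ hps hx
    rw [pd, P.box_set] at this
    rw [this, add_zero]
  · rw [fullPsi_of_le h']

theorem coeff_R_full {B : Box} (hB : B.set ⊆ dom P.T s) (μ : Fin 4) (n : ℕ) (hn : n < m + 2) :
    coeff n ((hQ.full hm hp s).R hB μ) = 0 := by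
  rcases Nat.lt_or_ge n 2 with h | h
  · exact (hQ.full hm hp s).coeff_R_of_lt_two hB h μ
  · obtain ⟨n, rfl⟩ := Nat.exists_eq_add_of_le' h
    exact (hQ.full hm hp s).coeff_R_eq_zero hB hm (ψ := Q.psi) (by omega)
      (fun l hl => (fullPsi_of_le hl).symm)
      (fun x hx => hQ.d_five_fullPsi hm hp s hpθ hx le_rfl)
      (hQ.fast s n (by omega)) (hQ.fast_div s n (by omega)) μ

theorem jumps : (hQ.full hm hp s).Jumps where
  vel n hn x hx := by
    change Q.U s (n + 1) (.vel 2) (atZero x) - P.c s * P.d s 5 (Q.fullPsi m p (n + 2)) x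
      = P.G1 s (Q.U s) (Q.fullPsi m p) n x
    rw [(G_fullPsi s hn _ x).1, ← hQ.d_five_fullPsi hm hp s hpθ hx (by omega)]
    exact hQ.jump_vel s n hn x hx
  mag n hn x hx := by
    change Q.U s (n + 1) (.mag 2) (atZero x) - P.b s * P.d s 5 (Q.fullPsi m p (n + 2)) x
      = P.G2 s (Q.U s) (Q.fullPsi m p) n x
    rw [(G_fullPsi s hn _ x).2, ← hQ.d_five_fullPsi hm hp s hpθ hx (by omega)]
    exact hQ.jump_mag s n hn x hx

/-- The compatibility of the interior source terms. -/
theorem pd_slowF8_eq {x : Pt} (hx : x ∈ dom P.T s) :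
    pd (dom P.T s) 0 (P.slowF8 s (Q.Ubar s) (Q.fullPsi m p) m) x
      = ∑ α : Fin 3,
          pd (dom P.T s) (sp α) (P.slowF s (Q.Ubar s) (Q.fullPsi m p) m (.mag α)) x := by
  have hB : (P.box s).set ⊆ dom P.T s := subset_rfl
  have hD := hQ.isLimit hm hp s
  exact (hQ.residual hm hp s).pd_slowF8_eq hB hm (hD.der_four_prof hB)
    (fun μ n hn => hD.coeff_R_eq_zero hB (hQ.coeff_R_full hm hp s hpθ hB μ n hn)) ⟨x, hx⟩

end Profiles.SolvesUpTo

end CurrentVortexSheet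

/-! ### Fast means, boundary sources and conclusion -/

namespace CurrentVortexSheet

open PowerSeries

/-- Slow tangential derivatives commute both with the trace and with the mean in `θ`. -/
theorem Box.pd_eq_avg_der {B : Box} {D : Set Pt} (hD : UniqueDiffOn ℝ D)
    (hmap : ∀ y ∈ D, y 0 ∈ Set.Icc 0 B.T) {f : B.Fn} {φ : Pt → ℝ}
    (hφ : ∀ z ∈ D, φ z = mean f.fn (atZero z)) {x : Pt} (hx : x ∈ D) {i : Fin 6} (h3 : i ≠ 3)
    (h4 : i ≠ 4) (h5 : i ≠ 5) {y : B.set} (hy : (y : Pt) = atZero x) :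
    pd D i φ x = Box.avg y (B.der i f) := by
  rw [Box.pd_congr hφ hx, Box.pd_comp_atZero hD hmap hx
    (f.differentiableWithinAt_mean (Box.atZero_mem (hmap x hx))) h3 h4, ← f.pd_mean h5, hy]

theorem atZero_atZero (x : Pt) : atZero (atZero x) = atZero x := by
  ext j
  fin_cases j <;> simp [atZero]

namespace Profiles

namespace IsFastPrimitive

variable {T : ℝ} {s : Side} {g v : Pt → ℝ} (hv : IsFastPrimitive T s g v) {B : Box}
  (hB : B.set ⊆ dom T s)

/-- A fast primitive as a function on a box. -/
noncomputable def toFn : B.Fn := Box.Fn.mk v (hv.mem.smooth.mono hB) (hv.mem.periodic 5 (by simp))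

theorem fn_toFn {x : Pt} (hx : x ∈ B.set) : (hv.toFn hB).fn x = v x := Box.Fn.fn_mk _ _ hx

theorem der_five_toFn : B.der 5 (hv.toFn hB) = 0 := Box.der_mk_eq_zero _ _ hv.indep

theorem avg_toFn (x : B.set) : Box.avg x (hv.toFn hB) = v x := by
  rw [Box.avg_eq_fn (hv.der_five_toFn hB), hv.fn_toFn hB x.2]

theorem avg_der_four_toFn (x : B.set) : Box.avg x (B.der 4 (hv.toFn hB)) = mean g x := by
  rw [Box.avg_eq_fn (by rw [Box.der_comm, hv.der_five_toFn, map_zero]), toFn,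
    Box.fn_der_mk _ _ _ x.2, pd_subset B.uniqueDiffOn hB hv.mem.smooth 4 x.2, hv.eq _ (hB x.2)]

theorem farEq_der_toFn (r : Fin 6) : Box.FarEq (B.der r (hv.toFn hB)) 0 := by
  have := (Box.FarEq.of_inSstar (f := hv.toFn hB) (g := 0) hB hv.mem (map_zero _) fun x hx => by
    rw [hv.fn_toFn hB hx, Box.Fn.fn_zero hx, sub_zero]).2 r
  rwa [map_zero] at this

end IsFastPrimitive

namespace SolvesUpTo

variable {Q : Profiles} {P : Params} {m : ℕ} (hQ : Q.SolvesUpTo P m)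
  (hm : 1 ≤ m) {p : Pt → ℝ} (hp : IsFront P.T p) (s : Side) (hpθ : IndepOf 5 p)
  {u3star H3star : Side → Pt → ℝ}
  (hu3 : ∀ s, Profiles.IsFastPrimitive P.T s (Q.Fstar P s m .pres) (u3star s))
  (hH3 : ∀ s, Profiles.IsFastPrimitive P.T s (Q.F8star P s m) (H3star s))

/-- The order `m + 1` conormal components have boundary values `-G_1^m` and `-G_2^m`, and the fast
primitives equal their own means, being independent of `θ`. -/
theorem slowG_eq {B : Box} (hB : B.set ⊆ dom P.T s) (hT : B.T = P.T) {z : Pt}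
    (hz : z ∈ dom P.T s) :
    P.slowG1 s (Q.U s) (Q.fullPsi m p) m (u3star s) z
      = mean (-coeff (m + 1) ((hQ.full hm hp s).normalW hB) - (hu3 s).toFn hB).fn (atZero z)
    ∧ P.slowG2 s (Q.U s) (Q.fullPsi m p) m (H3star s) z
      = mean (-coeff (m + 1) ((hQ.full hm hp s).normalH hB) - (hH3 s).toFn hB).fn (atZero z) := by
  have hy : atZero z ∈ B.set := Box.atZero_mem (by rw [hT]; exact hz.1)
  have key : ∀ {f v : B.Fn} {G w : Pt → ℝ}, (∀ θ, f.fn (atZero (Function.update z 5 θ))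
        = -G (Function.update z 5 θ)) → Box.avg ⟨atZero z, hy⟩ v = w (atZero z) →
      mean G z - w (atZero z) = mean (-f - v).fn (atZero z) := by
    intro f v G w hf hv
    have h1 : Box.avg ⟨atZero z, hy⟩ f = -mean G z := by
      rw [Box.avg_eq_mean, ← Box.mean_comp_atZero]
      simp only [mean, hf, intervalIntegral.integral_neg, mul_neg]
    rw [← Box.avg_eq_mean ⟨atZero z, hy⟩, map_sub, map_neg, h1, neg_neg, hv]
  have hzθ : ∀ θ, Function.update z 5 θ ∈ dom P.T s := fun θ =>
    Box.update_five_mem (B := P.box s) hz θ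
  have hyθ : ∀ θ, atZero (Function.update z 5 θ) ∈ B.set := fun θ =>
    Box.atZero_mem (by rw [hT]; exact (hzθ θ).1)
  refine ⟨key (fun θ => ?_) ((hu3 s).avg_toFn hB _), key (fun θ => ?_) ((hH3 s).avg_toFn hB _)⟩
  · exact ((hQ.full hm hp s).fn_coeff_normal_last hB (hzθ θ) (hyθ θ)).2
  · exact ((hQ.full hm hp s).fn_coeff_normal_last hB (hzθ θ) (hyθ θ)).1

include hpθ

theorem avg_coeff_R_sub {B : Box} (hB : B.set ⊆ dom P.T s) (x : B.set) :
    Box.avg x (coeff (m + 2) ((hQ.full hm hp s).R hB 0)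
        - coeff (m + 2) ((hQ.residual hm hp s).R hB 0)) = mean (Q.F8star P s m) x
      ∧ ∀ i : Fin 3, Box.avg x (coeff (m + 2) ((hQ.full hm hp s).R hB i.succ)
        - coeff (m + 2) ((hQ.residual hm hp s).R hB i.succ))
          = -mean (Q.Fstar P s m (.mag i)) x := by
  have hψ : ∀ l ≤ m, Q.psi l = Q.fullPsi m p l := fun l hl => (fullPsi_of_le hl).symm
  have hψ5 : ∀ x ∈ dom P.T s, P.d s 5 (Q.psi (m + 1)) x = P.d s 5 (Q.fullPsi m p (m + 1)) x :=
    fun x hx => hQ.d_five_fullPsi hm hp s hpθ hx le_rfl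
  refine ⟨?_, fun i => ?_⟩
  · rw [Box.avg_eq_mean]
    refine Box.mean_congr fun θ => ?_
    have hx := Box.update_five_mem x.2 θ
    rw [Box.Fn.fn_sub _ _ hx, (hQ.full hm hp s).fn_coeff_R_zero hB hm hψ hψ5 hx,
      (hQ.residual hm hp s).fn_coeff_R_zero hB hm hψ hψ5 hx]
    rfl
  · have h : -mean (Q.Fstar P s m (.mag i)) x = mean (fun y => -Q.Fstar P s m (.mag i) y) x := by
      simp only [mean, intervalIntegral.integral_neg, mul_neg]
    rw [Box.avg_eq_mean, h]
    refine Box.mean_congr fun θ => ?_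
    have hx := Box.update_five_mem x.2 θ
    rw [Box.Fn.fn_sub _ _ hx, (hQ.full hm hp s).fn_coeff_R_succ hB hm hψ hψ5 i hx,
      (hQ.residual hm hp s).fn_coeff_R_succ hB hm hψ hψ5 i hx]
    rw [Fstar, Fbar, neg_sub, neg_sub_neg]
    rfl

/-- Component `0` is the equation defining `Ĥ_{3,⋆}^{m+1}(0)`. The tangential components are the
magnetic compatibility of the fast means, with `F_{7,⋆}` and `F_{8,⋆}` replaced by `Y₃`-derivatives
of the primitives. -/
theorem coeff_R_sub_mem {B : Box} (hB : B.set ⊆ dom P.T s) (i : Fin 3) :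
    coeff (m + 2) ((hQ.full hm hp s).R hB i.castSucc)
      - coeff (m + 2) ((hQ.residual hm hp s).R hB i.castSucc)
      - (P.vel s i • B.der 4 ((hH3 s).toFn hB) - P.mag s i • B.der 4 ((hu3 s).toFn hB))
      ∈ B.meanZero := by
  refine Box.mem_meanZero.2 fun x => ?_
  rw [map_sub, map_sub (Box.avg x) (P.vel s i • _), map_smul, map_smul,
    (hH3 s).avg_der_four_toFn hB, (hu3 s).avg_der_four_toFn hB]
  refine Fin.cases ?_ (fun j => ?_) i
  · rw [Fin.castSucc_zero, (hQ.avg_coeff_R_sub hm hp s hpθ hB x).1]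
    simp [Params.vel, Params.mag]
  · rw [Fin.castSucc_succ, (hQ.avg_coeff_R_sub hm hp s hpθ hB x).2,
      ← hQ.fast_mean_mag s j x (hB x.2)]
    simp only [Params.vel, Params.mag, Fin.cons_succ, smul_eq_mul]
    ring

include hQ hm hp hu3 hH3

/-- The compatibility of the interior and boundary source terms. -/
theorem slowF_atZero_eq {x : Pt} (hx : x ∈ dom P.T s) :
    P.slowF s (Q.Ubar s) (Q.fullPsi m p) m (.mag 2) (atZero x)
      = pd (dom P.T s) 0 (P.slowG2 s (Q.U s) (Q.fullPsi m p) m (H3star s)) x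
        + ∑ j : Fin 2, P.u0 s j *
            pd (dom P.T s) (tg j) (P.slowG2 s (Q.U s) (Q.fullPsi m p) m (H3star s)) x
        - ∑ j : Fin 2, P.H0 s j *
            pd (dom P.T s) (tg j) (P.slowG1 s (Q.U s) (Q.fullPsi m p) m (u3star s)) x := by
  have hB := P.thinBox_subset s
  have hy : atZero x ∈ (P.thinBox s).set := Box.atZero_mem hx.1
  -- The identity is applied at `atZero x`, since `x` itself may lie outside the thin box.
  have h := Cascade.slowF_normal_eq hB hm le_rfl (hQ.isLimit hm hp s)
    (hQ.coeff_R_full hm hp s hpθ hB) (hQ.jumps hm hp s hpθ)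
    (fun r => (hH3 s).farEq_der_toFn hB r) (fun r => (hu3 s).farEq_der_toFn hB r)
    (hQ.coeff_R_sub_mem hm hp s hpθ hu3 hH3 hB) hy
  simp only [atZero_atZero] at h
  have hu : UniqueDiffOn ℝ (dom P.T s) := (P.box s).uniqueDiffOn
  have e : ∀ {i : Fin 6}, i ≠ 3 → i ≠ 4 → i ≠ 5 → _ := fun {i} h3 h4 h5 =>
    And.intro
      (Box.pd_eq_avg_der (B := P.thinBox s) hu (fun y hy => hy.1)
        (fun z hz => (hQ.slowG_eq hm hp s hu3 hH3 hB rfl hz).1) hx h3 h4 h5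
        (y := ⟨atZero x, hy⟩) rfl)
      (Box.pd_eq_avg_der (B := P.thinBox s) hu (fun y hy => hy.1)
        (fun z hz => (hQ.slowG_eq hm hp s hu3 hH3 hB rfl hz).2) hx h3 h4 h5
        (y := ⟨atZero x, hy⟩) rfl)
  refine h.trans ?_
  rw [(e (i := 0) (by decide) (by decide) (by decide)).2, Fin.sum_univ_succ]
  simp only [fun j : Fin 2 => (e (Cascade.tg_ne j).1 (Cascade.tg_ne j).2.1 (Cascade.tg_ne j).2.2).1,
    fun j : Fin 2 => (e (Cascade.tg_ne j).1 (Cascade.tg_ne j).2.1 (Cascade.tg_ne j).2.2).2,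
    Params.vel, Params.mag, Fin.cons_zero, Fin.cons_succ, Params.tan_zero, Params.tan_succ,
    sum_sub_distrib, one_mul, zero_mul, sub_zero]
  rw [add_sub_assoc]

end SolvesUpTo

end Profiles

end CurrentVortexSheet

open CurrentVortexSheet in
theorem mainTheorem10 (P : Params) (Q : Profiles) (m : ℕ) (hm : 1 ≤ m)
    (hQ : Q.SolvesUpTo P m)
    (u3star H3star : Side → Pt → ℝ)
    (hu3 : ∀ s, Profiles.IsFastPrimitive P.T s (Q.Fstar P s m .pres) (u3star s))
    (hH3 : ∀ s, Profiles.IsFastPrimitive P.T s (Q.F8star P s m) (H3star s))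
    (p : Pt → ℝ) (hp : IsFront P.T p) (hpθ : IndepOf 5 p) (s : Side) :
    (∀ x ∈ dom P.T s,
      pd (dom P.T s) 0 (P.slowF8 s (Q.Ubar s) (Q.fullPsi m p) m) x
        = ∑ α : Fin 3,
            pd (dom P.T s) (sp α) (P.slowF s (Q.Ubar s) (Q.fullPsi m p) m (.mag α)) x) ∧
    (∀ x ∈ dom P.T s,
      P.slowF s (Q.Ubar s) (Q.fullPsi m p) m (.mag 2) (atZero x)
        = pd (dom P.T s) 0 (P.slowG2 s (Q.U s) (Q.fullPsi m p) m (H3star s)) x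
          + ∑ j : Fin 2, P.u0 s j *
              pd (dom P.T s) (tg j) (P.slowG2 s (Q.U s) (Q.fullPsi m p) m (H3star s)) x
          - ∑ j : Fin 2, P.H0 s j *
              pd (dom P.T s) (tg j) (P.slowG1 s (Q.U s) (Q.fullPsi m p) m (u3star s)) x) := by
  exact ⟨fun x hx => hQ.pd_slowF8_eq hm hp s hpθ hx,
    fun x hx => hQ.slowF_atZero_eq hm hp s hpθ hu3 hH3 hx⟩
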